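/- Let $(M,g)$ be a smooth Riemannian surface (without boundary), let $\mu$ be its area measure and $s$ its one-dimensional (arc length) measure. A compact smooth domain is a compact set $E\subset M$ (not necessarily connected) which near each point of $\partial E$ has the form $\{\rho\le 0\}$ for a smooth function $\rho$ with $d\rho\neq 0$. Let $0<\theta\le 1$ and $\kappa\in\mathbb{R}$, and assume that $(M,g)$ satisfies the $(\theta,\kappa)$-isoperimetric inequality, that is, $$4\pi\theta\,\mu(E)-\kappa\,\mu(E)^2\le s(\partial E)^2\quad\text{for every compact smooth domain } E\subset M.$$ Let $\Omega\subset M$ be a nonempty open set with compact closure, let $\lambda\in\mathbb{R}$, and let $u\in C^\infty(\overline{\Omega})$ and $f:\Omega\to\mathbb{R}$ be such that $$-\Delta_g u+\kappa=\lambda e^{2u}+f\ \text{ in }\Omega,\qquad u|_{\partial\Omega}=0,\qquad u<0\ \text{ in }\Omega,$$ where $\Delta_g$ is the Laplace–Beltrami operator, with $\Delta=\partial_1^2+\partial_2^2$ in the flat case. Put $\Theta=\frac{1}{2\pi}\int_\Omega f^-\,d\mu$, where $f^-=\max(-f,0)$. Then $$4\pi\theta\,\mu(\Omega)-\kappa\,\mu(\Omega)^2\le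 4\pi(\theta+\Theta)\int_\Omega e^{2u}\,d\mu-\lambda\Big(\int_\Omega e^{2u}\,d\mu\Big)^2 .$$ In particular, if $\Theta=0$ and $\lambda=\kappa>0$, then $$\int_\Omega e^{2u}\,d\mu+\mu(\Omega)\ge\frac{4\pi\theta}{\lambda}.$$ -/

import Mathlib

open MeasureTheory Bundle
open scoped Manifold ContDiff

noncomputable section

namespace RiemannianSurface

/-- The model plane of a surface. -/
abbrev Plane : Type := EuclideanSpace ℝ (Fin 2)

/-- The partial derivative `∂ᵢ F (y)` of a function on the plane. -/
def pderiv (i : Fin 2) (F : Plane → ℝ) (y : Plane) : ℝ :=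
  fderiv ℝ F y (EuclideanSpace.single i 1)

section Charts

variable {M : Type*} [TopologicalSpace M] [ChartedSpace Plane M]

/-- The coordinate vector field `∂ᵢ` of the chart `e`, at the point with coordinates `y`. -/
def coordVector (e : OpenPartialHomeomorph M Plane) (y : Plane) (i : Fin 2) :
    TangentSpace (𝓡 2) (e.symm y) :=
  mfderiv (𝓡 2) (𝓡 2) e.symm y (EuclideanSpace.single i (1 : ℝ) : Plane)

/-- Compact smooth domains: compact sets `D` which near each of their boundary points are
the sublevel set `{ρ ≤ 0}` of a smooth function `ρ` with nonvanishing differential. -/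
def IsCompactSmoothDomain (D : Set M) : Prop :=
  IsCompact D ∧ ∀ p ∈ frontier D, ∃ U : Set M, IsOpen U ∧ p ∈ U ∧
    ∃ ρ : M → ℝ, ContMDiffOn (𝓡 2) 𝓘(ℝ, ℝ) ∞ ρ U ∧
      (∀ q ∈ U, mfderiv (𝓡 2) 𝓘(ℝ, ℝ) ρ q ≠ 0) ∧ D ∩ U = {q ∈ U | ρ q ≤ 0}

variable [RiemannianBundle (fun x : M ↦ TangentSpace (𝓡 2) x)]

/-- The matrix `(gᵢⱼ)` of the metric in the chart `e`, at the point with coordinates `y`. -/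
def metricMatrix (e : OpenPartialHomeomorph M Plane) (y : Plane) : Matrix (Fin 2) (Fin 2) ℝ :=
  Matrix.of fun i j ↦ inner ℝ (coordVector e y i) (coordVector e y j)

/-- The area density `√(det (gᵢⱼ))` in the chart `e`. -/
def areaDensity (e : OpenPartialHomeomorph M Plane) (y : Plane) : ℝ :=
  √(metricMatrix e y).det

/-- The Laplace–Beltrami operator with the sign convention `Δ = ∂₁² + ∂₂²` in the flat plane:
`Δ_g u = (1 / √(det g)) ∑ᵢ ∂ᵢ (√(det g) ∑ⱼ gⁱʲ ∂ⱼ u)`, computed at `x` in the chart at `x`. -/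
def laplaceBeltrami (u : M → ℝ) (x : M) : ℝ :=
  let e := chartAt Plane x
  (areaDensity e (e x))⁻¹ *
    ∑ i, pderiv i (fun y ↦ areaDensity e y *
      ∑ j, (metricMatrix e y)⁻¹ i j * pderiv j (fun z ↦ u (e.symm z)) y) (e x)

/-- The measure `√(det g) dy¹ dy²` of the chart `e`, carried to the domain of `e` in `M`
and extended by zero outside of it. -/
def chartArea [MeasurableSpace M] (e : OpenPartialHomeomorph M Plane) : Measure M :=
  ((volume.restrict e.target).withDensity fun y ↦ ENNReal.ofReal (areaDensity e y)).map e.symm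

variable (M) in
/-- The Riemannian area measure `μ`. The measures `√(det g) dy¹ dy²` of any two charts agree on
the intersection of their domains, and `μ` is the measure which restricts to each of them; it is
therefore their supremum in the lattice of measures. -/
def area [MeasurableSpace M] : Measure M :=
  ⨆ x : M, chartArea (chartAt Plane x)

end Charts

/-- The `(θ, κ)`-isoperimetric inequality `4πθ μ(D) - κ μ(D)² ≤ s(∂D)²`. Here `s` is the
one-dimensional Hausdorff measure of the Riemannian distance (the arc length on curves). -/
def IsoperimetricInequality (M : Type*) [EMetricSpace M] [ChartedSpace Plane M]
    [RiemannianBundle (fun x : M ↦ TangentSpace (𝓡 2) x)]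
    [MeasurableSpace M] [BorelSpace M] (θ κ : ℝ) : Prop :=
  ∀ D : Set M, IsCompactSmoothDomain D →
    4 * Real.pi * θ * (area M).real D - κ * (area M).real D ^ 2 ≤
      (Measure.hausdorffMeasure 1 : Measure M).real (frontier D) ^ 2

end RiemannianSurface

end

namespace RiemannianSurface

open scoped NNReal ENNReal Topology

set_option maxSynthPendingDepth 3
set_option linter.unusedSectionVars false

/-! Let `β(t)` and `α(t)` be the areas of `D_t = {u ≤ t}` for `μ` and `e²ᵘ μ`. Put `Q(β) = 4πθβ -
κβ²`, `p = ∫ f⁻` and `P = κβ - λα + p`. For `t < 0` the set `D_t` is compact, because `u` vanishes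
on the boundary of `Ω`; by Sard it is a smooth domain for almost every `t`. The divergence theorem
and the equation give `0 ≤ ∫_{∂D_t} |∇u| = ∫_{D_t} Δu ≤ P`. The coarea formula gives `∫_{∂D_t}
|∇u|⁻¹ ≤ β'`. Cauchy-Schwarz and the isoperimetric inequality then yield `Q(β) ≤ s(∂D_t)² ≤ β' P`.
Since `α' = e²ᵗ β'`, the function `Ψ = e²ᵗ Q(β) - (4πθ + 2p) α + λ α²` satisfies `Ψ' = 2 e²ᵗ (Q(β) -
β' P) ≤ 0`. It is zero below the minimum of `u`, so `Ψ ≤ 0` for `t < 0`, and `t → 0` gives the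
inequality because `2p = 4πΘ`.

That computation is only formal: `β` is merely monotone and might jump. The proof works with
increments over intervals instead. `sub_mul_le_of_isoperimetricInequality` is the increment form of
`Q ≤ β' P`, with an error proportional to `β b - β a`. `bol_of_increments` turns it into
monotonicity of `Ψ`, by means of the elementary criterion `le_of_increment_le`. The errors come from
a bound on `Δu` in `Ω`, which exists because `u` is smooth up to the boundary
(`exists_bound_laplaceBeltrami`).

No boundary integral is ever formed. The flux is `∫ Δu` over a sublevel set, and it is compared with
the energy by inserting functions of `u` in Green's formula (`setIntegral_comp_mul_gradInner_le`).
Of the coarea formula only a measurable majorant for the lengths of the level sets is needed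
(`exists_measurable_hausdorffMeasure_le`). It is Fubini's theorem in charts whose first coordinate
is `u`, and critical values are discarded by `volume_image_critical_eq_zero_of_contMDiffOn`. -/

/-- An outer measure which is locally dominated by a measure is dominated by it. -/
theorem outerMeasure_le_of_locally_le {X : Type*} [TopologicalSpace X] [SecondCountableTopology X]
    [MeasurableSpace X] [OpensMeasurableSpace X] (m : OuterMeasure X) (ν : Measure X)
    {S : Set X} (hS : MeasurableSet S)
    (h : ∀ x ∈ S, ∃ U, IsOpen U ∧ x ∈ U ∧ ∀ A ⊆ U ∩ S, MeasurableSet A → m A ≤ ν A) :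
    m S ≤ ν S := by
  rcases S.eq_empty_or_nonempty with rfl | hne
  · simp
  choose! U hUo hxU hU using h
  obtain ⟨t, htS, htc, hcov⟩ := TopologicalSpace.countable_cover_nhdsWithin
    (f := U) (s := S) fun x hx ↦ mem_nhdsWithin_of_mem_nhds ((hUo x hx).mem_nhds (hxU x hx))
  have htne : t.Nonempty := by
    rcases hne with ⟨x, hx⟩
    obtain ⟨y, hy, -⟩ := Set.mem_iUnion₂.1 (hcov hx)
    exact ⟨y, hy⟩
  obtain ⟨g, rfl⟩ := htc.exists_eq_range htne
  have hgS : ∀ n, g n ∈ S := fun n ↦ htS ⟨n, rfl⟩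
  let V : ℕ → Set X := fun n ↦ U (g n) ∩ S
  have hV : ∀ n, MeasurableSet (V n) := fun n ↦ (hUo _ (hgS n)).measurableSet.inter hS
  have hSV : S = ⋃ n, disjointed V n := by
    rw [iUnion_disjointed]
    apply subset_antisymm
    · intro x hx
      obtain ⟨y, ⟨n, rfl⟩, hy⟩ := Set.mem_iUnion₂.1 (hcov hx)
      exact Set.mem_iUnion.2 ⟨n, hy, hx⟩
    · exact Set.iUnion_subset fun n ↦ Set.inter_subset_right
  calc m S = m (⋃ n, disjointed V n) := by rw [← hSV]
    _ ≤ ∑' n, m (disjointed V n) := measure_iUnion_le _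
    _ ≤ ∑' n, ν (disjointed V n) := by
        refine ENNReal.tsum_le_tsum fun n ↦ hU _ (hgS n) _ (disjointed_subset V n) ?_
        exact MeasurableSet.disjointed hV n
    _ = ν (⋃ n, disjointed V n) :=
        (measure_iUnion (disjoint_disjointed V) fun n ↦ MeasurableSet.disjointed hV n).symm
    _ = ν S := by rw [← hSV]

/-! ### Sard's theorem for `C²` functions in dimension two. -/

section Sard

variable {E : Type*} [NormedAddCommGroup E] [NormedSpace ℝ E]

/-- The values of a `C²` function at critical points satisfy a Hölder estimate of exponent `2`. -/
theorem holderOnWith_two_of_fderiv_eq_zero {v : E → ℝ} {c : E} {r : ℝ} {K : ℝ≥0}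
    {A : Set E} (hv : ∀ y ∈ Metric.ball c r, DifferentiableAt ℝ v y)
    (hv' : ∀ y ∈ Metric.ball c r, DifferentiableAt ℝ (fderiv ℝ v) y)
    (hK : ∀ y ∈ Metric.ball c r, ‖fderiv ℝ (fderiv ℝ v) y‖ ≤ K)
    (hA : A ⊆ Metric.ball c r) (hA0 : ∀ y ∈ A, fderiv ℝ v y = 0) :
    HolderOnWith K 2 v A := by
  intro x hx y hy
  have h1 : ∀ z ∈ Metric.ball c r, ‖fderiv ℝ v z‖ ≤ K * dist z x := by
    intro z hz
    have := (convex_ball c r).norm_image_sub_le_of_norm_fderiv_le hv' hK (hA hx) hz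
    rwa [hA0 x hx, sub_zero, ← dist_eq_norm] at this
  -- Intersecting with the ball of radius `dist x y` about `x` keeps the set convex and turns the
  -- linear bound `h1` into the constant `K * dist x y`.
  have h2 : ‖v x - v y‖ ≤ K * dist x y * ‖x - y‖ := by
    refine Convex.norm_image_sub_le_of_norm_fderiv_le (𝕜 := ℝ)
      (s := Metric.ball c r ∩ Metric.closedBall x (dist x y)) (fun z hz ↦ hv z hz.1) (fun z hz ↦ ?_)
      ((convex_ball c r).inter (convex_closedBall x _)) ⟨hA hy, ?_⟩ ⟨hA hx, by simp⟩
    · exact (h1 z hz.1).trans (mul_le_mul_of_nonneg_left hz.2 K.2)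
    · rw [Metric.mem_closedBall, dist_comm]
  have h3 : dist (v x) (v y) ≤ K * dist x y ^ 2 := by
    rw [dist_eq_norm]; refine h2.trans_eq ?_; rw [← dist_eq_norm]; ring
  rw [edist_dist, edist_dist]
  refine (ENNReal.ofReal_le_ofReal h3).trans_eq ?_
  rw [ENNReal.ofReal_mul K.coe_nonneg, ENNReal.ofReal_pow dist_nonneg]
  simp

/-- Sard's theorem for `C²` functions on a domain of a normed plane. -/
theorem volume_image_critical_eq_zero [FiniteDimensional ℝ E] [MeasurableSpace E] [BorelSpace E]
    (hE : Module.finrank ℝ E = 2) {O : Set E} (hO : IsOpen O) {v : E → ℝ}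
    (hv : ContDiffOn ℝ 2 v O) : volume (v '' {y ∈ O | fderiv ℝ v y = 0}) = 0 := by
  have hHaar : (Measure.hausdorffMeasure 2 : Measure E).IsAddHaarMeasure := by
    have := MeasureTheory.isAddHaarMeasure_hausdorffMeasure (E := E)
    simpa [hE] using this
  set H : Measure E := Measure.hausdorffMeasure 2 with hH
  set C : Set E := {y ∈ O | fderiv ℝ v y = 0} with hC
  have hCm : MeasurableSet C :=
    hO.measurableSet.inter (measurable_fderiv ℝ v (measurableSet_singleton 0))
  have hd : ∀ y ∈ O, DifferentiableAt ℝ v y := fun y hy ↦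
    (hv.contDiffAt (hO.mem_nhds hy)).differentiableAt (by norm_num)
  have hd1 : ContDiffOn ℝ 1 (fderiv ℝ v) O := hv.fderiv_of_isOpen hO (by norm_num)
  have hd' : ∀ y ∈ O, DifferentiableAt ℝ (fderiv ℝ v) y := fun y hy ↦
    (hd1.contDiffAt (hO.mem_nhds hy)).differentiableAt (by norm_num)
  have hcont : ContinuousOn (fderiv ℝ (fderiv ℝ v)) O :=
    hd1.continuousOn_fderiv_of_isOpen hO le_rfl
  have key : ∀ y ∈ O, ∀ K : ℝ≥0, ‖fderiv ℝ (fderiv ℝ v) y‖ < K → ∃ U, IsOpen U ∧ y ∈ U ∧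
      ∀ A ⊆ U, A ⊆ C → volume (v '' A) ≤ K * H A := by
    intro y hy K hK
    have h1 : ∀ᶠ z in 𝓝 y, z ∈ O ∧ ‖fderiv ℝ (fderiv ℝ v) z‖ < K :=
      (hO.eventually_mem hy).and
        (((hcont.continuousAt (hO.mem_nhds hy)).norm).eventually (gt_mem_nhds hK))
    obtain ⟨r, hr, hball⟩ := Metric.eventually_nhds_iff_ball.1 h1
    refine ⟨Metric.ball y r, Metric.isOpen_ball, Metric.mem_ball_self hr, fun A hA hAC ↦ ?_⟩
    have hh := holderOnWith_two_of_fderiv_eq_zero (fun z hz ↦ hd z (hball z hz).1)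
      (fun z hz ↦ hd' z (hball z hz).1) (fun z hz ↦ (hball z hz).2.le) hA (fun z hz ↦ (hAC hz).2)
    have := hh.hausdorffMeasure_image_le (by norm_num) zero_le_one
    rw [hausdorffMeasure_real] at this
    simpa [hH] using this
  set m : OuterMeasure E := OuterMeasure.comap v (volume : Measure ℝ).toOuterMeasure with hm
  have hmA : ∀ A, m A = volume (v '' A) := fun A ↦ rfl
  set N : Set E := {y ∈ C | fderiv ℝ (fderiv ℝ v) y ≠ 0} with hN
  have hNm : MeasurableSet N :=
    hCm.inter (measurable_fderiv ℝ (fderiv ℝ v) isClosed_singleton.measurableSet).compl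
  -- The differential vanishes identically on `C`, so at almost every point of `C` (the density
  -- points) its own derivative vanishes too. The isomorphism `L` of the dual with `E` only serves
  -- to make the differential a map from `E` to itself.
  have hN0 : H N = 0 := by
    let L : (E →L[ℝ] ℝ) ≃L[ℝ] E := ContinuousLinearEquiv.ofFinrankEq <| by
      rw [← (LinearMap.toContinuousLinearMap (𝕜 := ℝ) (E := E) (F' := ℝ)).finrank_eq,
        Subspace.dual_finrank_eq]
    let L' : (E →L[ℝ] ℝ) →L[ℝ] E := L.toContinuousLinearMap
    have hL : ∀ x ∈ C, HasFDerivWithinAt (fun y ↦ L' (fderiv ℝ v y))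
        (L'.comp (fderiv ℝ (fderiv ℝ v) x)) C x := fun x hx ↦
      (L'.hasFDerivAt.comp x (hd' x hx.1).hasFDerivAt).hasFDerivWithinAt
    have happ : ApproximatesLinearOn (fun y ↦ L' (fderiv ℝ v y)) (0 : E →L[ℝ] E) C 0 := by
      intro x hx y hy
      simp [hx.2, hy.2]
    have hae := happ.norm_fderiv_sub_le H hCm _ hL
    rw [ae_restrict_iff' hCm] at hae
    refine measure_mono_null ?_ hae
    intro x hx hx'
    apply hx.2
    have h0 := hx' hx.1
    simp only [sub_zero, nonpos_iff_eq_zero, nnnorm_eq_zero] at h0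
    ext a b
    have h1 : L' (fderiv ℝ (fderiv ℝ v) x a) = 0 := congrArg (fun T ↦ T a) h0
    have h2 : fderiv ℝ (fderiv ℝ v) x a = 0 := L.injective
      (by rw [map_zero]; exact h1)
    simp [h2]
  have hmN : m N = 0 := by
    have : m N ≤ (0 : Measure E) N := by
      refine outerMeasure_le_of_locally_le m 0 hNm fun y hy ↦ ?_
      obtain ⟨U, hUo, hyU, hU⟩ := key y hy.1.1 (‖fderiv ℝ (fderiv ℝ v) y‖₊ + 1)
        (by simp)
      refine ⟨U, hUo, hyU, fun A hA _ ↦ ?_⟩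
      rw [hmA]
      refine (hU A (hA.trans Set.inter_subset_left)
        fun z hz ↦ (hA hz).2.1).trans ?_
      rw [measure_mono_null (hA.trans Set.inter_subset_right) hN0]
      simp
    simpa using this
  have hmC : ∀ n : ℕ, m ((C \ N) ∩ Metric.ball 0 n) = 0 := by
    intro n
    have hfin : H (Metric.ball 0 n) ≠ ⊤ := measure_ball_lt_top.ne
    -- Where the second derivative is zero, the local Hölder constant can be taken to be any `ε >
    -- 0`.
    have hle : ∀ ε : ℝ≥0, 0 < ε →
        m ((C \ N) ∩ Metric.ball 0 n) ≤ ε * H (Metric.ball 0 n) := by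
      intro ε hε
      refine (outerMeasure_le_of_locally_le m (ε • H)
        ((hCm.diff hNm).inter measurableSet_ball) fun y hy ↦ ?_).trans ?_
      · have h0 : fderiv ℝ (fderiv ℝ v) y = 0 := by
          by_contra hne
          exact hy.1.2 ⟨hy.1.1, hne⟩
        obtain ⟨U, hUo, hyU, hU⟩ := key y hy.1.1.1 ε
          (by rw [h0, norm_zero]; exact_mod_cast hε)
        refine ⟨U, hUo, hyU, fun A hA _ ↦ ?_⟩
        exact hU A (hA.trans Set.inter_subset_left) fun z hz ↦ (hA hz).2.1.1
      · exact mul_le_mul_right (measure_mono Set.inter_subset_right) _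
    by_contra hne
    obtain ⟨ε, hε, hε'⟩ := ENNReal.exists_nnreal_pos_mul_lt hfin hne
    exact absurd (hle ε hε) (not_le.2 hε')
  have hsub : C ⊆ N ∪ ⋃ n : ℕ, (C \ N) ∩ Metric.ball 0 n := by
    intro y hy
    by_cases hyN : y ∈ N
    · exact Or.inl hyN
    · obtain ⟨n, hn⟩ := exists_nat_gt (dist y 0)
      exact Or.inr (Set.mem_iUnion.2 ⟨n, ⟨hy, hyN⟩, hn⟩)
  rw [← hmA]
  refine measure_mono_null hsub ?_
  exact measure_union_null hmN (measure_iUnion_null hmC)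

end Sard

noncomputable section

/-! ### Smooth charts and the transformation of the metric. -/

section SmoothCharts

variable {M : Type*} [TopologicalSpace M] [ChartedSpace Plane M]

/-- Smooth charts: local homeomorphisms to the plane which are diffeomorphisms. -/
structure IsSmoothChart (e : OpenPartialHomeomorph M Plane) : Prop where
  contMDiffOn : ContMDiffOn (𝓡 2) (𝓡 2) ∞ e e.source
  contMDiffOn_symm : ContMDiffOn (𝓡 2) (𝓡 2) ∞ e.symm e.target

theorem isSmoothChart_chartAt [IsManifold (𝓡 2) ∞ M] (x : M) :
    IsSmoothChart (chartAt Plane x) :=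
  ⟨contMDiffOn_chart, contMDiffOn_chart_symm⟩

namespace IsSmoothChart

variable {e e' : OpenPartialHomeomorph M Plane}

/-- Produces charts outside the preferred atlas, in particular those straightening the level sets of
`u`. -/
theorem trans (he : IsSmoothChart e) {ψ : OpenPartialHomeomorph Plane Plane}
    (h : ContDiffOn ℝ ∞ ψ ψ.source) (h' : ContDiffOn ℝ ∞ ψ.symm ψ.target) :
    IsSmoothChart (e.trans ψ) := by
  constructor
  · refine h.contMDiffOn.comp (he.contMDiffOn.mono ?_) ?_
    · intro x hx; exact hx.1
    · intro x hx; exact hx.2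
  · refine he.contMDiffOn_symm.comp (h'.contMDiffOn.mono ?_) ?_
    · intro x hx; exact hx.1
    · intro x hx; exact hx.2

theorem contDiffOn_comp_symm (he : IsSmoothChart e) {s : Set M} {n : ℕ∞} {u : M → ℝ}
    (hu : ContMDiffOn (𝓡 2) 𝓘(ℝ, ℝ) n u s) :
    ContDiffOn ℝ n (fun y ↦ u (e.symm y)) (e.target ∩ e.symm ⁻¹' s) :=
  (hu.comp ((he.contMDiffOn_symm.of_le (by exact_mod_cast le_top)).mono Set.inter_subset_left)
    (fun _ hy ↦ hy.2)).contDiffOn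

theorem contDiffOn_transition (he : IsSmoothChart e) (he' : IsSmoothChart e') :
    ContDiffOn ℝ ∞ (fun y ↦ e' (e.symm y)) (e.target ∩ e.symm ⁻¹' e'.source) :=
  (he'.contMDiffOn.comp (he.contMDiffOn_symm.mono Set.inter_subset_left)
    (fun _ hy ↦ hy.2)).contDiffOn

theorem mdifferentiableAt_symm (he : IsSmoothChart e) {y : Plane} (hy : y ∈ e.target) :
    MDifferentiableAt (𝓡 2) (𝓡 2) e.symm y :=
  (he.contMDiffOn_symm.contMDiffAt (e.open_target.mem_nhds hy)).mdifferentiableAt (by simp)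

theorem mdifferentiableAt (he : IsSmoothChart e) {x : M} (hx : x ∈ e.source) :
    MDifferentiableAt (𝓡 2) (𝓡 2) e x :=
  (he.contMDiffOn.contMDiffAt (e.open_source.mem_nhds hx)).mdifferentiableAt (by simp)

end IsSmoothChart

theorem mdifferentiableAt_of_contMDiffOn {u : M → ℝ} {s : Set M} (hs : IsOpen s)
    (hu : ContMDiffOn (𝓡 2) 𝓘(ℝ, ℝ) ∞ u s) {x : M} (hx : x ∈ s) :
    MDifferentiableAt (𝓡 2) 𝓘(ℝ, ℝ) u x :=
  (hu.contMDiffAt (hs.mem_nhds hx)).mdifferentiableAt (by simp)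

/-- The differential of the inverse of a chart, as an endomorphism of the model plane. -/
def symmDeriv (e : OpenPartialHomeomorph M Plane) (y : Plane) : Plane →L[ℝ] Plane :=
  mfderiv (𝓡 2) (𝓡 2) e.symm y

theorem IsSmoothChart.symmDeriv_injective {e : OpenPartialHomeomorph M Plane}
    (he : IsSmoothChart e) {y : Plane} (hy : y ∈ e.target) :
    Function.Injective (symmDeriv e y) := by
  have h : mfderiv (𝓡 2) (𝓡 2) (e ∘ e.symm) y = ContinuousLinearMap.id ℝ Plane := by
    have h1 : (e ∘ e.symm) =ᶠ[𝓝 y] id := by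
      filter_upwards [e.open_target.mem_nhds hy] with z hz using e.right_inv hz
    rw [h1.mfderiv_eq]
    exact mfderiv_id
  rw [mfderiv_comp y (he.mdifferentiableAt (e.map_target hy)) (he.mdifferentiableAt_symm hy)] at h
  exact Function.LeftInverse.injective (g := mfderiv (𝓡 2) (𝓡 2) e (e.symm y))
    fun v ↦ congrArg (fun T : Plane →L[ℝ] Plane ↦ T v) h

theorem symmDeriv_eq_comp {e e' : OpenPartialHomeomorph M Plane}
    (he : IsSmoothChart e) (he' : IsSmoothChart e') {y : Plane} (hy : y ∈ e.target)
    (hy' : e.symm y ∈ e'.source) :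
    symmDeriv e y = (symmDeriv e' (e' (e.symm y))).comp (fderiv ℝ (fun z ↦ e' (e.symm z)) y) := by
  have h1 : e.symm =ᶠ[𝓝 y] (e'.symm ∘ fun z ↦ e' (e.symm z)) := by
    filter_upwards [(e.isOpen_inter_preimage_symm e'.open_source).mem_nhds ⟨hy, hy'⟩] with z hz
    exact (e'.left_inv hz.2).symm
  have hd : MDifferentiableAt (𝓡 2) (𝓡 2) (fun z ↦ e' (e.symm z)) y :=
    (he'.mdifferentiableAt hy').comp y (he.mdifferentiableAt_symm hy)
  have h2 := mfderiv_comp y (he'.mdifferentiableAt_symm (e'.map_source hy')) hd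
  unfold symmDeriv
  rw [h1.mfderiv_eq, h2, mfderiv_eq_fderiv]
  rfl

variable [RiemannianBundle (fun x : M ↦ TangentSpace (𝓡 2) x)]

/-- The metric at `p`, as a function of vectors of the model plane. -/
def metricForm (p : M) (a b : Plane) : ℝ :=
  inner ℝ (show TangentSpace (𝓡 2) p from a) (show TangentSpace (𝓡 2) p from b)

theorem metricMatrix_apply (e : OpenPartialHomeomorph M Plane) (y : Plane) (i j : Fin 2) :
    metricMatrix e y i j = metricForm (e.symm y) (symmDeriv e y (EuclideanSpace.single i 1))
      (symmDeriv e y (EuclideanSpace.single j 1)) := rfl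

theorem metricForm_add_left (p : M) (a b c : Plane) :
    metricForm p (a + b) c = metricForm p a c + metricForm p b c :=
  inner_add_left (𝕜 := ℝ) (E := TangentSpace (𝓡 2) p) a b c

theorem metricForm_smul_left (p : M) (r : ℝ) (a c : Plane) :
    metricForm p (r • a) c = r * metricForm p a c :=
  real_inner_smul_left (F := TangentSpace (𝓡 2) p) a c r

theorem metricForm_comm (p : M) (a b : Plane) : metricForm p a b = metricForm p b a :=
  real_inner_comm (F := TangentSpace (𝓡 2) p) b a

theorem metricForm_add_right (p : M) (a b c : Plane) :
    metricForm p a (b + c) = metricForm p a b + metricForm p a c := by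
  rw [metricForm_comm, metricForm_add_left, metricForm_comm p b, metricForm_comm p c]

theorem metricForm_smul_right (p : M) (r : ℝ) (a c : Plane) :
    metricForm p a (r • c) = r * metricForm p a c := by
  rw [metricForm_comm, metricForm_smul_left, metricForm_comm]

theorem metricForm_self_pos (p : M) {a : Plane} (ha : a ≠ 0) : 0 < metricForm p a a :=
  (real_inner_self_pos (F := TangentSpace (𝓡 2) p) (x := a)).2 ha

theorem metricForm_self_eq_norm_sq (p : M) (a : Plane) :
    metricForm p a a = ‖(show TangentSpace (𝓡 2) p from a)‖ ^ 2 :=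
  real_inner_self_eq_norm_sq (F := TangentSpace (𝓡 2) p) a

/-- The Jacobian matrix of a linear map of the plane. -/
def jacobian (L : Plane →L[ℝ] Plane) : Matrix (Fin 2) (Fin 2) ℝ :=
  Matrix.of fun k i ↦ L (EuclideanSpace.single i 1) k

theorem det_jacobian (L : Plane →L[ℝ] Plane) : (jacobian L).det = L.det := by
  have h : jacobian L = LinearMap.toMatrix (EuclideanSpace.basisFun (Fin 2) ℝ).toBasis
      (EuclideanSpace.basisFun (Fin 2) ℝ).toBasis (L : Plane →ₗ[ℝ] Plane) := by
    ext k i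
    simp [jacobian, LinearMap.toMatrix_apply]
  rw [h, LinearMap.det_toMatrix]

theorem plane_eq_sum_single (a : Plane) :
    a = a 0 • EuclideanSpace.single (0 : Fin 2) (1 : ℝ) +
      a 1 • EuclideanSpace.single (1 : Fin 2) 1 := by
  ext i
  fin_cases i <;> simp

theorem metricForm_apply_apply (p : M) (S : Plane →L[ℝ] Plane) (a b : Plane) :
    metricForm p (S a) (S b) = ∑ k, ∑ l, a k * b l *
      metricForm p (S (EuclideanSpace.single k 1)) (S (EuclideanSpace.single l 1)) := by
  conv_lhs => rw [plane_eq_sum_single a, plane_eq_sum_single b]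
  simp only [map_add, map_smul, metricForm_add_left, metricForm_add_right, metricForm_smul_left,
    metricForm_smul_right, Fin.sum_univ_two]
  ring

/-- The transformation rule of the metric under a change of charts. -/
theorem metricMatrix_eq_transpose_mul_mul {e e' : OpenPartialHomeomorph M Plane}
    (he : IsSmoothChart e) (he' : IsSmoothChart e') {y : Plane} (hy : y ∈ e.target)
    (hy' : e.symm y ∈ e'.source) :
    metricMatrix e y = (jacobian (fderiv ℝ (fun z ↦ e' (e.symm z)) y)).transpose *
      metricMatrix e' (e' (e.symm y)) * jacobian (fderiv ℝ (fun z ↦ e' (e.symm z)) y) := by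
  ext i j
  rw [metricMatrix_apply, symmDeriv_eq_comp he he' hy hy']
  simp only [ContinuousLinearMap.comp_apply]
  rw [metricForm_apply_apply]
  simp only [Matrix.mul_apply, Matrix.transpose_apply, metricMatrix_apply, e'.left_inv hy',
    jacobian, Matrix.of_apply, Fin.sum_univ_two]
  ring

theorem metricMatrix_isSymm (e : OpenPartialHomeomorph M Plane) (y : Plane) (i j : Fin 2) :
    metricMatrix e y i j = metricMatrix e y j i := metricForm_comm _ _ _

theorem IsSmoothChart.metricMatrix_posDef {e : OpenPartialHomeomorph M Plane}
    (he : IsSmoothChart e) {y : Plane} (hy : y ∈ e.target) : (metricMatrix e y).PosDef := by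
  refine Matrix.PosDef.of_dotProduct_mulVec_pos (Matrix.ext fun i j ↦ ?_) fun a ha ↦ ?_
  · simpa using metricMatrix_isSymm e y j i
  · have hne : symmDeriv e y (WithLp.toLp 2 a) ≠ 0 := by
      intro h
      apply ha
      have := he.symmDeriv_injective hy (h.trans (map_zero _).symm)
      simpa using this
    refine (metricForm_self_pos (e.symm y) hne).trans_eq ?_
    rw [metricForm_apply_apply]
    simp only [← metricMatrix_apply, dotProduct, Matrix.mulVec, Fin.sum_univ_two, star_trivial]
    ring

theorem IsSmoothChart.metricMatrix_det_pos {e : OpenPartialHomeomorph M Plane}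
    (he : IsSmoothChart e) {y : Plane} (hy : y ∈ e.target) : 0 < (metricMatrix e y).det :=
  (he.metricMatrix_posDef hy).det_pos

theorem IsSmoothChart.areaDensity_pos {e : OpenPartialHomeomorph M Plane}
    (he : IsSmoothChart e) {y : Plane} (hy : y ∈ e.target) : 0 < areaDensity e y :=
  Real.sqrt_pos.2 (he.metricMatrix_det_pos hy)

/-- Square root of the determinant of `G = Jᵀ G' J`. -/
theorem areaDensity_eq_abs_det_mul {e e' : OpenPartialHomeomorph M Plane}
    (he : IsSmoothChart e) (he' : IsSmoothChart e') {y : Plane} (hy : y ∈ e.target)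
    (hy' : e.symm y ∈ e'.source) :
    areaDensity e y =
      |(fderiv ℝ (fun z ↦ e' (e.symm z)) y).det| * areaDensity e' (e' (e.symm y)) := by
  rw [areaDensity, areaDensity, metricMatrix_eq_transpose_mul_mul he he' hy hy', Matrix.det_mul,
    Matrix.det_mul, Matrix.det_transpose, det_jacobian, ← Real.sqrt_sq_eq_abs,
    ← Real.sqrt_mul (sq_nonneg _)]
  congr 1
  ring

section Smooth

variable [IsManifold (𝓡 2) ∞ M]
  [IsContMDiffRiemannianBundle (𝓡 2) ∞ Plane (fun x : M ↦ TangentSpace (𝓡 2) x)]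

/-- Each coordinate field is the image of a constant section of the tangent bundle of the plane
under the tangent map of `e.symm`, hence smooth; the metric pairs smooth sections smoothly. -/
theorem IsSmoothChart.contDiffOn_metricMatrix {e : OpenPartialHomeomorph M Plane}
    (he : IsSmoothChart e) (i j : Fin 2) :
    ContDiffOn ℝ ∞ (fun y ↦ metricMatrix e y i j) e.target := by
  have h1 := he.contMDiffOn_symm.contMDiffOn_tangentMapWithin (m := ∞) (by simp)
    e.open_target.uniqueMDiffOn
  have h2 : ∀ k : Fin 2, ContMDiffOn (𝓡 2) (𝓡 2).tangent ∞
      (fun y ↦ (⟨e.symm y, coordVector e y k⟩ : TangentBundle (𝓡 2) M)) e.target := by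
    intro k
    have h3 : ContMDiffOn (𝓡 2) (𝓡 2).tangent ∞
        (fun y : Plane ↦ (⟨y, EuclideanSpace.single k (1 : ℝ)⟩ : TangentBundle (𝓡 2) Plane))
        e.target :=
      contMDiffOn_vectorSpace_iff_contDiffOn.2 contDiffOn_const
    refine (h1.comp h3 fun y hy ↦ hy).congr fun y hy ↦ ?_
    simp only [Function.comp, tangentMapWithin, mfderivWithin_of_isOpen e.open_target hy]
    rfl
  exact (ContMDiffOn.inner_bundle (h2 i) (h2 j)).contDiffOn

theorem IsSmoothChart.contDiffOn_det {e : OpenPartialHomeomorph M Plane}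
    (he : IsSmoothChart e) : ContDiffOn ℝ ∞ (fun y ↦ (metricMatrix e y).det) e.target := by
  simp only [Matrix.det_fin_two]
  exact ((he.contDiffOn_metricMatrix _ _).mul (he.contDiffOn_metricMatrix _ _)).sub
    ((he.contDiffOn_metricMatrix _ _).mul (he.contDiffOn_metricMatrix _ _))

theorem IsSmoothChart.contDiffOn_areaDensity {e : OpenPartialHomeomorph M Plane}
    (he : IsSmoothChart e) : ContDiffOn ℝ ∞ (areaDensity e) e.target :=
  he.contDiffOn_det.sqrt fun _ hy ↦ (he.metricMatrix_det_pos hy).ne'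

theorem IsSmoothChart.contDiffOn_metricMatrix_inv {e : OpenPartialHomeomorph M Plane}
    (he : IsSmoothChart e) (i j : Fin 2) :
    ContDiffOn ℝ ∞ (fun y ↦ (metricMatrix e y)⁻¹ i j) e.target := by
  simp only [Matrix.inv_def, Matrix.smul_apply, Ring.inverse_eq_inv', smul_eq_mul]
  refine (he.contDiffOn_det.inv fun _ hy ↦ (he.metricMatrix_det_pos hy).ne').mul ?_
  simp only [Matrix.adjugate_fin_two]
  fin_cases i <;> fin_cases j <;>
    simp only [Matrix.of_apply, Matrix.cons_val', Matrix.cons_val_zero, Matrix.cons_val_one,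
      Matrix.cons_val_fin_one, Fin.zero_eta, Fin.mk_one]
  exacts [he.contDiffOn_metricMatrix _ _, (he.contDiffOn_metricMatrix _ _).neg,
    (he.contDiffOn_metricMatrix _ _).neg, he.contDiffOn_metricMatrix _ _]

end Smooth

end SmoothCharts

end

/-! ### The area measure in charts. -/

section Area

variable {M : Type*} [TopologicalSpace M] [ChartedSpace Plane M] [IsManifold (𝓡 2) ∞ M]
  [RiemannianBundle (fun x : M ↦ TangentSpace (𝓡 2) x)]
  [IsContMDiffRiemannianBundle (𝓡 2) ∞ Plane (fun x : M ↦ TangentSpace (𝓡 2) x)]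
  {e e' : OpenPartialHomeomorph M Plane}

theorem IsSmoothChart.aemeasurable_areaDensity (he : IsSmoothChart e) :
    AEMeasurable (fun y ↦ ENNReal.ofReal (areaDensity e y)) (volume.restrict e.target) :=
  (he.contDiffOn_areaDensity.continuousOn.aemeasurable e.open_target.measurableSet).ennreal_ofReal

variable [MeasurableSpace M] [BorelSpace M]

/-- Outside `e.target` nothing is known about `e.symm`, so measurability has to be taken from
continuity on the subtype. -/
theorem measurableSet_target_inter_preimage_symm {X : Type*} [TopologicalSpace X]
    [MeasurableSpace X] [BorelSpace X] (e : OpenPartialHomeomorph X Plane) {A : Set X}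
    (hA : MeasurableSet A) : MeasurableSet (e.target ∩ e.symm ⁻¹' A) := by
  have h1 : Measurable (e.target.domRestrict e.symm) :=
    (continuousOn_iff_continuous_domRestrict.1 e.continuousOn_symm).measurable
  have h2 := (e.open_target.measurableSet).subtype_image (h1 hA)
  convert h2 using 1
  ext y
  simp [Set.domRestrict, and_comm]

theorem aemeasurable_symm {X : Type*} [TopologicalSpace X]
    [MeasurableSpace X] [BorelSpace X] (e : OpenPartialHomeomorph X Plane) (ρ : Plane → ℝ≥0∞) :
    AEMeasurable e.symm ((volume.restrict e.target).withDensity ρ) :=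
  (e.continuousOn_symm.aemeasurable e.open_target.measurableSet).mono_ac
    (withDensity_absolutelyContinuous _ _)

theorem IsSmoothChart.lintegral_chartArea (he : IsSmoothChart e) {F : M → ℝ≥0∞}
    (hF : AEMeasurable F (chartArea e)) :
    ∫⁻ x, F x ∂chartArea e =
      ∫⁻ y in e.target, ENNReal.ofReal (areaDensity e y) * F (e.symm y) := by
  rw [chartArea, lintegral_map' hF (aemeasurable_symm e _),
    lintegral_withDensity_eq_lintegral_mul₀' he.aemeasurable_areaDensity
      (g := fun y ↦ F (e.symm y)) (hF.comp_aemeasurable (aemeasurable_symm e _))]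
  rfl

theorem IsSmoothChart.integral_chartArea (he : IsSmoothChart e) {F : M → ℝ}
    (hF : AEStronglyMeasurable F (chartArea e)) :
    ∫ x, F x ∂chartArea e = ∫ y in e.target, areaDensity e y * F (e.symm y) := by
  rw [chartArea, integral_map (aemeasurable_symm e _) hF,
    integral_withDensity_eq_integral_toReal_smul₀ he.aemeasurable_areaDensity (by simp)]
  refine setIntegral_congr_fun e.open_target.measurableSet fun y hy ↦ ?_
  simp [ENNReal.toReal_ofReal (he.areaDensity_pos hy).le]

theorem IsSmoothChart.chartArea_apply (he : IsSmoothChart e) {A : Set M} (hA : MeasurableSet A) :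
    chartArea e A = ∫⁻ y in e.target ∩ e.symm ⁻¹' A, ENNReal.ofReal (areaDensity e y) := by
  rw [← lintegral_indicator_one hA,
    he.lintegral_chartArea (measurable_one.indicator hA).aemeasurable,
    ← lintegral_indicator e.open_target.measurableSet,
    ← lintegral_indicator (measurableSet_target_inter_preimage_symm e hA)]
  refine lintegral_congr fun y ↦ ?_
  by_cases hy : e.symm y ∈ A <;> by_cases hy' : y ∈ e.target <;> simp [hy, hy']

/-- Change of variables along the transition map: the Jacobian in the integral is exactly the factor
relating the two area densities. -/
theorem chartArea_congr (he : IsSmoothChart e) (he' : IsSmoothChart e') {A : Set M}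
    (hA : MeasurableSet A) (hAe : A ⊆ e.source) (hAe' : A ⊆ e'.source) :
    chartArea e A = chartArea e' A := by
  rw [he.chartArea_apply hA, he'.chartArea_apply hA]
  set S := e.target ∩ e.symm ⁻¹' A with hS
  have hSm : MeasurableSet S := measurableSet_target_inter_preimage_symm e hA
  have himg : e'.target ∩ e'.symm ⁻¹' A = (fun y ↦ e' (e.symm y)) '' S := by
    ext z
    constructor
    · rintro ⟨hz, hzA⟩
      refine ⟨e (e'.symm z), ⟨e.map_source (hAe hzA), ?_⟩, ?_⟩
      · simpa [e.left_inv (hAe hzA)] using hzA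
      · simp [e.left_inv (hAe hzA), e'.right_inv hz]
    · rintro ⟨y, ⟨hy, hyA⟩, rfl⟩
      refine ⟨e'.map_source (hAe' hyA), ?_⟩
      simpa [e'.left_inv (hAe' hyA)] using hyA
  have hinj : Set.InjOn (fun y ↦ e' (e.symm y)) S := by
    intro y hy z hz hyz
    exact e.symm.injOn hy.1 hz.1 (e'.injOn (hAe' hy.2) (hAe' hz.2) hyz)
  have hder : ∀ y ∈ S, HasFDerivWithinAt (fun y ↦ e' (e.symm y))
      (fderiv ℝ (fun z ↦ e' (e.symm z)) y) S y := fun y hy ↦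
    (((he.contDiffOn_transition he').contDiffAt
      ((e.isOpen_inter_preimage_symm e'.open_source).mem_nhds
        ⟨hy.1, hAe' hy.2⟩)).differentiableAt (by simp)).hasFDerivAt.hasFDerivWithinAt
  rw [himg, lintegral_image_eq_lintegral_abs_det_fderiv_mul volume hSm hder hinj]
  refine setLIntegral_congr_fun hSm fun y hy ↦ ?_
  rw [areaDensity_eq_abs_det_mul he he' hy.1 (hAe' hy.2), ENNReal.ofReal_mul (abs_nonneg _)]

theorem IsSmoothChart.chartArea_inter_source (he : IsSmoothChart e) {A : Set M}
    (hA : MeasurableSet A) : chartArea e (A ∩ e.source) = chartArea e A := by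
  rw [he.chartArea_apply hA, he.chartArea_apply (hA.inter e.open_source.measurableSet)]
  congr 2
  ext y
  constructor
  · exact fun h ↦ ⟨h.1, h.2.1⟩
  · exact fun h ↦ ⟨h.1, h.2, e.map_target h.1⟩

variable [SecondCountableTopology M]

/-- The area measure is given by the area density in every smooth chart. -/
theorem IsSmoothChart.area_apply (he : IsSmoothChart e) {A : Set M} (hA : MeasurableSet A)
    (hAe : A ⊆ e.source) : area M A = chartArea e A := by
  rcases isEmpty_or_nonempty M with hM | hM
  · simp [Set.eq_empty_of_isEmpty A]
  obtain ⟨s, hsc, hs⟩ := TopologicalSpace.countable_cover_nhds (α := M)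
    (f := fun x ↦ (chartAt Plane x).source) fun x ↦ chart_source_mem_nhds Plane x
  have hsne : s.Nonempty := by
    by_contra h
    rw [Set.not_nonempty_iff_eq_empty] at h
    simp only [h, Set.mem_empty_iff_false, Set.iUnion_of_empty, Set.iUnion_empty] at hs
    exact Set.empty_ne_univ hs
  obtain ⟨c, rfl⟩ := hsc.exists_eq_range hsne
  let S : ℕ → Set M := fun n ↦ (chartAt Plane (c n)).source
  let D : ℕ → Set M := disjointed S
  have hDm : ∀ n, MeasurableSet (D n) := fun n ↦
    MeasurableSet.disjointed (fun n ↦ (chartAt Plane (c n)).open_source.measurableSet) n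
  have hDS : ∀ n, D n ⊆ S n := disjointed_subset S
  have hDU : ⋃ n, D n = Set.univ := by
    rw [iUnion_disjointed]; simpa [S] using hs
  have hsum : ∀ (ν : Measure M) {B : Set M}, MeasurableSet B → ν B = ∑' n, ν (B ∩ D n) := by
    intro ν B hB
    rw [← measure_iUnion (fun i j hij ↦ ((disjoint_disjointed S) hij).mono
      Set.inter_subset_right Set.inter_subset_right) fun n ↦ hB.inter (hDm n),
      ← Set.inter_iUnion, hDU, Set.inter_univ]
  -- The glued measure, one chart on each piece of a countable partition. It agrees with every
  -- `chartArea` on the domain of the chart, so it bounds them all; conversely each of its pieces is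
  -- bounded by the supremum.
  let m : Measure M := Measure.sum fun n ↦ (chartArea (chartAt Plane (c n))).restrict (D n)
  have hm : ∀ {B : Set M}, MeasurableSet B →
      m B = ∑' n, chartArea (chartAt Plane (c n)) (B ∩ D n) := by
    intro B hB
    simp only [m, Measure.sum_apply _ hB, Measure.restrict_apply hB]
  have hme : ∀ {e : OpenPartialHomeomorph M Plane}, IsSmoothChart e → ∀ {B : Set M},
      MeasurableSet B → B ⊆ e.source → m B = chartArea e B := by
    intro e he B hB hBe
    rw [hm hB, hsum (chartArea e) hB]
    refine tsum_congr fun n ↦ ?_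
    exact chartArea_congr (isSmoothChart_chartAt _) he (hB.inter (hDm n))
      (Set.inter_subset_right.trans (hDS n)) (Set.inter_subset_left.trans hBe)
  have harea : area M = m := by
    apply le_antisymm
    · refine iSup_le fun x ↦ Measure.le_iff.2 fun B hB ↦ ?_
      have hx := isSmoothChart_chartAt (M := M) x
      rw [← hx.chartArea_inter_source hB,
        ← hme hx (hB.inter (chartAt Plane x).open_source.measurableSet) Set.inter_subset_right]
      exact measure_mono Set.inter_subset_left
    · refine Measure.le_iff.2 fun B hB ↦ ?_
      rw [hm hB, hsum (area M) hB]
      refine ENNReal.tsum_le_tsum fun n ↦ ?_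
      exact (le_iSup (fun x : M ↦ chartArea (chartAt Plane x)) (c n)) _
  rw [harea, hme he hA hAe]

theorem IsSmoothChart.restrict_area (he : IsSmoothChart e) :
    (area M).restrict e.source = chartArea e := by
  ext A hA
  rw [Measure.restrict_apply hA, he.area_apply (hA.inter e.open_source.measurableSet)
    Set.inter_subset_right, he.chartArea_inter_source hA]

theorem IsSmoothChart.setIntegral_area (he : IsSmoothChart e) {F : M → ℝ}
    (hF : AEStronglyMeasurable F ((area M).restrict e.source)) :
    ∫ x in e.source, F x ∂area M = ∫ y in e.target, areaDensity e y * F (e.symm y) := by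
  rw [he.restrict_area] at hF ⊢
  exact he.integral_chartArea hF

theorem IsSmoothChart.setLIntegral_area (he : IsSmoothChart e) {F : M → ℝ≥0∞}
    (hF : AEMeasurable F ((area M).restrict e.source)) :
    ∫⁻ x in e.source, F x ∂area M =
      ∫⁻ y in e.target, ENNReal.ofReal (areaDensity e y) * F (e.symm y) := by
  rw [he.restrict_area] at hF ⊢
  exact he.lintegral_chartArea hF

theorem isLocallyFiniteMeasure_area : IsLocallyFiniteMeasure (area M) := by
  refine ⟨fun x ↦ ?_⟩
  have he := isSmoothChart_chartAt (M := M) x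
  set e := chartAt Plane x with hedef
  have hx : x ∈ e.source := mem_chart_source Plane x
  obtain ⟨r, hr, hball⟩ := Metric.nhds_basis_closedBall.mem_iff.1
    (e.open_target.mem_nhds (e.map_source hx))
  have hopen : IsOpen (e.source ∩ e ⁻¹' Metric.ball (e x) r) :=
    e.isOpen_inter_preimage Metric.isOpen_ball
  refine ⟨e.source ∩ e ⁻¹' Metric.ball (e x) r,
    hopen.mem_nhds ⟨hx, Metric.mem_ball_self hr⟩, ?_⟩
  rw [he.area_apply hopen.measurableSet Set.inter_subset_left, he.chartArea_apply
    hopen.measurableSet]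
  have hsub : e.target ∩ e.symm ⁻¹' (e.source ∩ e ⁻¹' Metric.ball (e x) r) ⊆
      Metric.closedBall (e x) r := by
    rintro y ⟨hy, -, hy'⟩
    have : e (e.symm y) ∈ Metric.ball (e x) r := hy'
    rw [e.right_inv hy] at this
    exact Metric.ball_subset_closedBall this
  refine (lintegral_mono_set hsub).trans_lt ?_
  have hint : IntegrableOn (areaDensity e) (Metric.closedBall (e x) r) :=
    (he.contDiffOn_areaDensity.continuousOn.mono hball).integrableOn_compact
      (isCompact_closedBall _ _)
  exact hint.lintegral_lt_top

theorem area_pos_of_isOpen {U : Set M} (hU : IsOpen U) (hne : U.Nonempty) : 0 < area M U := by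
  obtain ⟨x, hx⟩ := hne
  have he := isSmoothChart_chartAt (M := M) x
  set e := chartAt Plane x with hedef
  have hxe : x ∈ e.source := mem_chart_source Plane x
  have hO : IsOpen (U ∩ e.source) := hU.inter e.open_source
  refine lt_of_lt_of_le ?_ (measure_mono (Set.inter_subset_left (s := U) (t := e.source)))
  rw [he.area_apply hO.measurableSet Set.inter_subset_right, he.chartArea_apply hO.measurableSet]
  have hopen := e.isOpen_inter_preimage_symm hO
  rw [pos_iff_ne_zero, Ne, setLIntegral_eq_zero_iff' hopen.measurableSet
    (he.aemeasurable_areaDensity.mono_set Set.inter_subset_left)]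
  intro h
  have hpos : 0 < volume (e.target ∩ e.symm ⁻¹' (U ∩ e.source)) :=
    hopen.measure_pos volume ⟨e x, e.map_source hxe, by simp [e.left_inv hxe, hx, hxe]⟩
  refine hpos.ne' (measure_mono_null ?_ h)
  intro y hy hy'
  exact ((he.areaDensity_pos hy.1).not_ge) (ENNReal.ofReal_eq_zero.1 (hy' hy))

end Area

/-! ### Gradients, the Laplacian in a chart, and integration by parts in the plane. -/

section Gradient

open Matrix

theorem fderiv_apply_eq_sum_pderiv (F : Plane → ℝ) (y a : Plane) :
    fderiv ℝ F y a = ∑ k, a k * pderiv k F y := by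
  conv_lhs => rw [plane_eq_sum_single a]
  simp [pderiv, Fin.sum_univ_two]

theorem pderiv_congr {F G : Plane → ℝ} {y : Plane} (h : F =ᶠ[𝓝 y] G) (i : Fin 2) :
    pderiv i F y = pderiv i G y := by
  rw [pderiv, pderiv, h.fderiv_eq]

theorem pderiv_comp {F : Plane → ℝ} {τ : Plane → Plane} {y : Plane}
    (hF : DifferentiableAt ℝ F (τ y)) (hτ : DifferentiableAt ℝ τ y) (i : Fin 2) :
    pderiv i (fun z ↦ F (τ z)) y = ∑ k, jacobian (fderiv ℝ τ y) k i * pderiv k F (τ y) := by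
  have h := fderiv_comp y hF hτ
  change fderiv ℝ (F ∘ τ) y _ = _
  rw [h, ContinuousLinearMap.comp_apply, fderiv_apply_eq_sum_pderiv]
  rfl

theorem contDiffOn_pderiv {F : Plane → ℝ} {O : Set Plane} (hO : IsOpen O)
    (hF : ContDiffOn ℝ ∞ F O) (i : Fin 2) : ContDiffOn ℝ ∞ (pderiv i F) O :=
  (hF.fderiv_of_isOpen hO (by simp)).clm_apply contDiffOn_const

variable {M : Type*} [TopologicalSpace M] [ChartedSpace Plane M]
  {e e' : OpenPartialHomeomorph M Plane}

theorem comp_symm_eventuallyEq {M : Type*} [TopologicalSpace M]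
    {e e' : OpenPartialHomeomorph M Plane} {u : M → ℝ} {y : Plane} (hy : y ∈ e.target)
    (hy' : e.symm y ∈ e'.source) :
    (fun z ↦ u (e.symm z)) =ᶠ[𝓝 y] fun z ↦ u (e'.symm (e' (e.symm z))) := by
  filter_upwards [(e.isOpen_inter_preimage_symm e'.open_source).mem_nhds ⟨hy, hy'⟩] with z hz
  rw [e'.left_inv hz.2]

theorem IsSmoothChart.differentiableAt_comp_symm (he : IsSmoothChart e) {u : M → ℝ} {x : M}
    (hx : x ∈ e.source) (hu : MDifferentiableAt (𝓡 2) 𝓘(ℝ, ℝ) u x) :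
    DifferentiableAt ℝ (fun z ↦ u (e.symm z)) (e x) := by
  have h1 := he.mdifferentiableAt_symm (e.map_source hx)
  have h2 : MDifferentiableAt (𝓡 2) 𝓘(ℝ, ℝ) u (e.symm (e x)) := by rwa [e.left_inv hx]
  exact (h2.comp (e x) h1).differentiableAt

variable [RiemannianBundle (fun x : M ↦ TangentSpace (𝓡 2) x)]

/-- The pairing `⟨∇u, ∇v⟩` computed in the chart `e`, at the point with coordinates `y`. -/
noncomputable def chartGradInner (e : OpenPartialHomeomorph M Plane) (u v : M → ℝ) (y : Plane) :
    ℝ :=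
  ∑ i, ∑ j, (metricMatrix e y)⁻¹ i j * pderiv i (fun z ↦ u (e.symm z)) y *
    pderiv j (fun z ↦ v (e.symm z)) y

/-- The `i`-th component of `√(det g) ∇u` in the chart `e`. -/
noncomputable def chartFlux (e : OpenPartialHomeomorph M Plane) (u : M → ℝ) (i : Fin 2)
    (y : Plane) : ℝ :=
  areaDensity e y * ∑ j, (metricMatrix e y)⁻¹ i j * pderiv j (fun z ↦ u (e.symm z)) y

/-- The Laplace–Beltrami operator computed in the chart `e`, at the point with coordinates `y`. -/
noncomputable def chartLaplacian (e : OpenPartialHomeomorph M Plane) (u : M → ℝ) (y : Plane) : ℝ :=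
  (areaDensity e y)⁻¹ * ∑ i, pderiv i (chartFlux e u i) y

/-- The pairing `⟨∇u, ∇v⟩`. -/
noncomputable def gradInner (u v : M → ℝ) (x : M) : ℝ :=
  chartGradInner (chartAt Plane x) u v (chartAt Plane x x)

theorem chartGradInner_eq_dotProduct (e : OpenPartialHomeomorph M Plane) (u v : M → ℝ) (y : Plane) :
    chartGradInner e u v y = (fun i ↦ pderiv i (fun z ↦ u (e.symm z)) y) ⬝ᵥ
      ((metricMatrix e y)⁻¹ *ᵥ fun i ↦ pderiv i (fun z ↦ v (e.symm z)) y) := by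
  simp only [chartGradInner, dotProduct, mulVec, Fin.sum_univ_two]
  ring

/-- Differentials transform by `Jᵀ` and the inverse metric by `J⁻¹ G⁻¹ J⁻ᵀ`, so the factors cancel.
-/
theorem dotProduct_inv_mulVec_of_congruent {J G : Matrix (Fin 2) (Fin 2) ℝ} (hJ : IsUnit J.det)
    (a b : Fin 2 → ℝ) :
    (Jᵀ *ᵥ a) ⬝ᵥ ((Jᵀ * G * J)⁻¹ *ᵥ (Jᵀ *ᵥ b)) = a ⬝ᵥ (G⁻¹ *ᵥ b) := by
  have hJt : IsUnit (Jᵀ).det := by rwa [det_transpose]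
  rw [Matrix.mul_inv_rev, Matrix.mul_inv_rev, mulVec_mulVec, Matrix.mul_assoc,
    Matrix.mul_assoc, nonsing_inv_mul _ hJt,
    Matrix.mul_one, mulVec_transpose, ← dotProduct_mulVec, mulVec_mulVec, ← Matrix.mul_assoc,
    mul_nonsing_inv _ hJ, Matrix.one_mul]

/-- The pairing of gradients does not depend on the chart. -/
theorem chartGradInner_congr (he : IsSmoothChart e) (he' : IsSmoothChart e') {u v : M → ℝ} {x : M}
    (hx : x ∈ e.source) (hx' : x ∈ e'.source) (hu : MDifferentiableAt (𝓡 2) 𝓘(ℝ, ℝ) u x)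
    (hv : MDifferentiableAt (𝓡 2) 𝓘(ℝ, ℝ) v x) :
    chartGradInner e u v (e x) = chartGradInner e' u v (e' x) := by
  have hy := e.map_source hx
  have hy' : e.symm (e x) ∈ e'.source := by rwa [e.left_inv hx]
  set τ : Plane → Plane := fun z ↦ e' (e.symm z) with hτdef
  have hτx : τ (e x) = e' x := by simp [τ, e.left_inv hx]
  have hτ : DifferentiableAt ℝ τ (e x) := ((he.contDiffOn_transition he').contDiffAt
      ((e.isOpen_inter_preimage_symm e'.open_source).mem_nhds ⟨hy, hy'⟩)).differentiableAt (by simp)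
  have key : ∀ w : M → ℝ, MDifferentiableAt (𝓡 2) 𝓘(ℝ, ℝ) w x →
      (fun i ↦ pderiv i (fun z ↦ w (e.symm z)) (e x)) =
        (jacobian (fderiv ℝ τ (e x)))ᵀ *ᵥ fun i ↦ pderiv i (fun z ↦ w (e'.symm z)) (e' x) := by
    intro w hw
    ext i
    have hd := he'.differentiableAt_comp_symm hx' hw
    rw [← hτx] at hd
    rw [pderiv_congr (comp_symm_eventuallyEq hy hy')]
    have := pderiv_comp (F := fun z ↦ w (e'.symm z)) hd hτ i
    rw [hτx] at this
    exact this
  have hG := metricMatrix_eq_transpose_mul_mul he he' hy hy'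
  have hdet : IsUnit (jacobian (fderiv ℝ τ (e x))).det := by
    have := (he.metricMatrix_det_pos hy).ne'
    rw [hG, det_mul] at this
    exact (right_ne_zero_of_mul this).isUnit
  rw [chartGradInner_eq_dotProduct, chartGradInner_eq_dotProduct, key u hu, key v hv, hG,
    dotProduct_inv_mulVec_of_congruent hdet]
  simp only [e.left_inv hx]

theorem gradInner_eq_chartGradInner [IsManifold (𝓡 2) ∞ M] (he : IsSmoothChart e) {u v : M → ℝ}
    {x : M} (hx : x ∈ e.source) (hu : MDifferentiableAt (𝓡 2) 𝓘(ℝ, ℝ) u x)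
    (hv : MDifferentiableAt (𝓡 2) 𝓘(ℝ, ℝ) v x) :
    gradInner u v x = chartGradInner e u v (e x) :=
  chartGradInner_congr (isSmoothChart_chartAt x) he (mem_chart_source _ x) hx hu hv

section Smooth

variable [IsManifold (𝓡 2) ∞ M]
  [IsContMDiffRiemannianBundle (𝓡 2) ∞ Plane (fun x : M ↦ TangentSpace (𝓡 2) x)]

theorem IsSmoothChart.contDiffOn_chartFlux (he : IsSmoothChart e) {u : M → ℝ} {O : Set Plane}
    (hO : IsOpen O) (hOe : O ⊆ e.target) (hu : ContDiffOn ℝ ∞ (fun z ↦ u (e.symm z)) O)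
    (i : Fin 2) : ContDiffOn ℝ ∞ (chartFlux e u i) O :=
  (he.contDiffOn_areaDensity.mono hOe).mul (ContDiffOn.sum fun j _ ↦
    ((he.contDiffOn_metricMatrix_inv i j).mono hOe).mul (contDiffOn_pderiv hO hu j))

theorem IsSmoothChart.contDiffOn_chartLaplacian (he : IsSmoothChart e) {u : M → ℝ}
    {O : Set Plane} (hO : IsOpen O) (hOe : O ⊆ e.target)
    (hu : ContDiffOn ℝ ∞ (fun z ↦ u (e.symm z)) O) : ContDiffOn ℝ ∞ (chartLaplacian e u) O :=
  ((he.contDiffOn_areaDensity.mono hOe).inv fun _ hy ↦ (he.areaDensity_pos (hOe hy)).ne').mul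
    (ContDiffOn.sum fun i _ ↦ contDiffOn_pderiv hO (he.contDiffOn_chartFlux hO hOe hu i) i)

theorem IsSmoothChart.contDiffOn_chartGradInner (he : IsSmoothChart e) {u v : M → ℝ}
    {O : Set Plane} (hO : IsOpen O) (hOe : O ⊆ e.target)
    (hu : ContDiffOn ℝ ∞ (fun z ↦ u (e.symm z)) O) (hv : ContDiffOn ℝ ∞ (fun z ↦ v (e.symm z)) O) :
    ContDiffOn ℝ ∞ (chartGradInner e u v) O :=
  ContDiffOn.sum fun i _ ↦ ContDiffOn.sum fun j _ ↦
    (((he.contDiffOn_metricMatrix_inv i j).mono hOe).mul (contDiffOn_pderiv hO hu i)).mul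
      (contDiffOn_pderiv hO hv j)

end Smooth

/-- The function `g`, later a component of the flux, is controlled only on `O`; the compact support
of `φ` inside `O` makes all the products continuous on the whole plane. -/
theorem integral_mul_pderiv_eq_neg {φ g : Plane → ℝ} {O : Set Plane} (hO : IsOpen O)
    (hφ : ContDiff ℝ ∞ φ) (hc : HasCompactSupport φ) (hsub : tsupport φ ⊆ O)
    (hg : ContDiffOn ℝ ∞ g O) (i : Fin 2) :
    Integrable (fun y ↦ φ y * pderiv i g y) ∧ Integrable (fun y ↦ pderiv i φ y * g y) ∧
    ∫ y, φ y * pderiv i g y = - ∫ y, pderiv i φ y * g y := by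
  have key : ∀ a b : Plane → ℝ, Continuous a → tsupport a ⊆ tsupport φ → ContinuousOn b O →
      Integrable (fun y ↦ a y * b y) := by
    intro a b ha hsupp hb
    have hts : tsupport (fun y ↦ a y * b y) ⊆ tsupport φ := tsupport_mul_subset_left.trans hsupp
    refine Continuous.integrable_of_hasCompactSupport (continuous_of_tsupport fun y hy ↦ ?_)
      (hc.of_isClosed_subset (isClosed_tsupport _) hts)
    exact ha.continuousAt.mul (hb.continuousAt (hO.mem_nhds (hsub (hts hy))))
  have h1 := key φ (pderiv i g) hφ.continuous subset_rfl (contDiffOn_pderiv hO hg i).continuousOn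
  have h2 := key (pderiv i φ) g
    ((hφ.continuous_fderiv (by simp)).clm_apply continuous_const)
    (closure_minimal (fun y hy ↦ ?_) (isClosed_tsupport φ)) hg.continuousOn
  swap
  · by_contra hn
    refine hy ?_
    rw [pderiv, image_eq_zero_of_notMem_tsupport
      (fun h ↦ hn (tsupport_fderiv_subset ℝ h))]
    rfl
  refine ⟨h1, h2, integral_mul_fderiv_eq_neg_fderiv_mul_of_integrable h2 h1
    (key φ g hφ.continuous subset_rfl hg.continuousOn)
    (fun y _ ↦ hφ.differentiable (by simp) y) fun y hy ↦ ?_⟩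
  exact (hg.contDiffAt (hO.mem_nhds (hsub hy))).differentiableAt (by simp)

end Gradient

/-! ### Green's formula in one chart and chart independence of the Laplacian. -/

section IntegrationByParts

variable {M : Type*} [TopologicalSpace M] [ChartedSpace Plane M] [IsManifold (𝓡 2) ∞ M]
  [RiemannianBundle (fun x : M ↦ TangentSpace (𝓡 2) x)]
  {e e' : OpenPartialHomeomorph M Plane} {u Φ : M → ℝ} {s : Set M}

theorem chartGradInner_eq_zero_of_notMem_tsupport {x : M} (hx : x ∈ e.source)
    (hx' : x ∉ tsupport Φ) (u : M → ℝ) : chartGradInner e Φ u (e x) = 0 := by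
  have h : (fun z ↦ Φ (e.symm z)) =ᶠ[𝓝 (e x)] fun _ ↦ 0 := by
    have h1 := notMem_tsupport_iff_eventuallyEq.1 hx'
    have h2 : Filter.Tendsto e.symm (𝓝 (e x)) (𝓝 x) := by
      have := e.continuousAt_symm (e.map_source hx)
      rwa [ContinuousAt, e.left_inv hx] at this
    exact h2.eventually h1
  simp only [chartGradInner, pderiv_congr h]
  simp [pderiv]

variable [IsContMDiffRiemannianBundle (𝓡 2) ∞ Plane (fun x : M ↦ TangentSpace (𝓡 2) x)]

theorem IsSmoothChart.continuousOn_chartLaplacian (he : IsSmoothChart e) (hs : IsOpen s)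
    (hu : ContMDiffOn (𝓡 2) 𝓘(ℝ, ℝ) ∞ u s) :
    ContinuousOn (fun x ↦ chartLaplacian e u (e x)) (e.source ∩ s) := by
  refine (he.contDiffOn_chartLaplacian (e.isOpen_inter_preimage_symm hs) Set.inter_subset_left
    (he.contDiffOn_comp_symm (n := ⊤) hu)).continuousOn.comp
    (e.continuousOn.mono Set.inter_subset_left) fun x hx ↦ ⟨e.map_source hx.1, ?_⟩
  simpa [e.left_inv hx.1] using hx.2

theorem IsSmoothChart.continuousOn_chartGradInner (he : IsSmoothChart e) (hs : IsOpen s)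
    (hΦ : ContMDiffOn (𝓡 2) 𝓘(ℝ, ℝ) ∞ Φ s) (hu : ContMDiffOn (𝓡 2) 𝓘(ℝ, ℝ) ∞ u s) :
    ContinuousOn (fun x ↦ chartGradInner e Φ u (e x)) (e.source ∩ s) := by
  refine (he.contDiffOn_chartGradInner (e.isOpen_inter_preimage_symm hs) Set.inter_subset_left
    (he.contDiffOn_comp_symm (n := ⊤) hΦ) (he.contDiffOn_comp_symm (n := ⊤) hu)).continuousOn.comp
    (e.continuousOn.mono Set.inter_subset_left) fun x hx ↦ ⟨e.map_source hx.1, ?_⟩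
  simpa [e.left_inv hx.1] using hx.2

theorem continuousOn_gradInner {v : M → ℝ} (hs : IsOpen s) (hu : ContMDiffOn (𝓡 2) 𝓘(ℝ, ℝ) ∞ u s)
    (hv : ContMDiffOn (𝓡 2) 𝓘(ℝ, ℝ) ∞ v s) : ContinuousOn (gradInner u v) s := by
  intro x hx
  have he := isSmoothChart_chartAt (M := M) x
  have hxe := mem_chart_source Plane x
  have hn := ((chartAt Plane x).open_source.inter hs).mem_nhds ⟨hxe, hx⟩
  refine (((he.continuousOn_chartGradInner hs hu hv).continuousAt hn).congr ?_).continuousWithinAt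
  filter_upwards [hn] with z hz
  exact (gradInner_eq_chartGradInner he hz.1 (mdifferentiableAt_of_contMDiffOn hs hu hz.2)
    (mdifferentiableAt_of_contMDiffOn hs hv hz.2)).symm

/-- Extension by zero: continuity is needed only near the closed set `K`, since `F` is locally zero
at the other points of `A`. -/
theorem continuousOn_of_eq_zero_off {X : Type*} [TopologicalSpace X] {F : X → ℝ} {A B K : Set X}
    (hA : IsOpen A) (hB : IsOpen B) (hF : ContinuousOn F (A ∩ B)) (hK : IsClosed K)
    (hKB : K ⊆ B) (h0 : ∀ x ∈ A, x ∉ K → F x = 0) : ContinuousOn F A := by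
  intro x hx
  apply ContinuousAt.continuousWithinAt
  by_cases hxK : x ∈ K
  · exact hF.continuousAt ((hA.inter hB).mem_nhds ⟨hx, hKB hxK⟩)
  · refine (continuousAt_const (y := (0 : ℝ))).congr ?_
    filter_upwards [hA.mem_nhds hx, hK.isOpen_compl.mem_nhds hxK] with z hz hz'
    exact (h0 z hz hz').symm

variable [MeasurableSpace M] [BorelSpace M] [SecondCountableTopology M] [T2Space M]

/-- In coordinates the area density cancels the factor `1/√(det g)` of the Laplacian. What is left
is the divergence of the flux against `φ`, and `∑ ∂ᵢφ · fluxᵢ` is the density times `⟨∇Φ, ∇u⟩`. -/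
theorem IsSmoothChart.integral_mul_chartLaplacian (he : IsSmoothChart e) (hs : IsOpen s)
    (hu : ContMDiffOn (𝓡 2) 𝓘(ℝ, ℝ) ∞ u s) (hΦ : ContMDiff (𝓡 2) 𝓘(ℝ, ℝ) ∞ Φ)
    (hc : HasCompactSupport Φ) (hsub : tsupport Φ ⊆ e.source ∩ s) :
    ∫ x in e.source, Φ x * chartLaplacian e u (e x) ∂area M =
      - ∫ x in e.source, chartGradInner e Φ u (e x) ∂area M := by
  set O := e.target ∩ e.symm ⁻¹' s with hOdef
  have hO : IsOpen O := e.isOpen_inter_preimage_symm hs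
  have hOe : O ⊆ e.target := Set.inter_subset_left
  have huO : ContDiffOn ℝ ∞ (fun y ↦ u (e.symm y)) O := he.contDiffOn_comp_symm (n := ⊤) hu
  set φ : Plane → ℝ := e.target.indicator fun y ↦ Φ (e.symm y) with hφdef
  have hφe : ∀ y ∈ e.target, φ =ᶠ[𝓝 y] fun z ↦ Φ (e.symm z) := fun y hy ↦ by
    filter_upwards [e.open_target.mem_nhds hy] with z hz
    simp [φ, hz]
  have hKc : IsCompact (e '' tsupport Φ) :=
    hc.isCompact.image_of_continuousOn (e.continuousOn.mono fun x hx ↦ (hsub hx).1)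
  have hKφ : tsupport φ ⊆ e '' tsupport Φ := by
    refine closure_minimal (fun y hy ↦ ?_) hKc.isClosed
    by_cases hyt : y ∈ e.target
    · refine ⟨e.symm y, subset_tsupport _ ?_, e.right_inv hyt⟩
      simpa [φ, hyt] using hy
    · simp [φ, hyt] at hy
  have hKO : e '' tsupport Φ ⊆ O := by
    rintro _ ⟨x, hx, rfl⟩
    refine ⟨e.map_source (hsub hx).1, ?_⟩
    simpa [e.left_inv (hsub hx).1] using (hsub hx).2
  have hφc : HasCompactSupport φ := hKc.of_isClosed_subset (isClosed_tsupport _) hKφ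
  have hφs : ContDiff ℝ ∞ φ := by
    rw [← contMDiff_iff_contDiff]
    refine contMDiff_of_tsupport fun y hy ↦ ?_
    have hyO := hKO (hKφ hy)
    have h1 : ContDiffAt ℝ ∞ (fun z ↦ Φ (e.symm z)) y :=
      (he.contDiffOn_comp_symm (n := ⊤) (hΦ.contMDiffOn (s := Set.univ))).contDiffAt
        ((e.isOpen_inter_preimage_symm isOpen_univ).mem_nhds ⟨hyO.1, trivial⟩)
    exact (h1.congr_of_eventuallyEq (hφe y hyO.1)).contMDiffAt
  have hibp := fun i ↦ integral_mul_pderiv_eq_neg hO hφs hφc (hKφ.trans hKO)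
    (he.contDiffOn_chartFlux hO hOe huO i) i
  have hm1 : AEStronglyMeasurable (fun x ↦ Φ x * chartLaplacian e u (e x))
      ((area M).restrict e.source) := by
    refine ContinuousOn.aestronglyMeasurable ?_ e.open_source.measurableSet
    refine continuousOn_of_eq_zero_off e.open_source hs
      (hΦ.continuous.continuousOn.mul (he.continuousOn_chartLaplacian hs hu))
      (isClosed_tsupport Φ) (fun x hx ↦ (hsub hx).2) fun x _ hx ↦ ?_
    rw [image_eq_zero_of_notMem_tsupport hx, zero_mul]
  have hm2 : AEStronglyMeasurable (fun x ↦ chartGradInner e Φ u (e x))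
      ((area M).restrict e.source) := by
    refine ContinuousOn.aestronglyMeasurable ?_ e.open_source.measurableSet
    exact continuousOn_of_eq_zero_off e.open_source hs
      (he.continuousOn_chartGradInner hs hΦ.contMDiffOn hu)
      (isClosed_tsupport Φ) (fun x hx ↦ (hsub hx).2)
      fun x hx hx' ↦ chartGradInner_eq_zero_of_notMem_tsupport hx hx' u
  rw [he.setIntegral_area hm1, he.setIntegral_area hm2]
  have e1 : ∫ y in e.target, areaDensity e y * (Φ (e.symm y) * chartLaplacian e u (e (e.symm y))) =
      ∫ y, ∑ i, φ y * pderiv i (chartFlux e u i) y := by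
    refine Eq.trans ?_ (setIntegral_eq_integral_of_forall_compl_eq_zero (s := e.target) ?_)
    · refine setIntegral_congr_fun e.open_target.measurableSet fun y hy ↦ ?_
      have hρ := (he.areaDensity_pos hy).ne'
      simp only [φ, Set.indicator_of_mem hy, e.right_inv hy, chartLaplacian, ← Finset.mul_sum]
      field_simp
    · intro y hy
      simp [φ, hy]
  have e2 : ∫ y in e.target, areaDensity e y * chartGradInner e Φ u (e (e.symm y)) =
      ∫ y, ∑ i, pderiv i φ y * chartFlux e u i y := by
    refine Eq.trans ?_ (setIntegral_eq_integral_of_forall_compl_eq_zero (s := e.target) ?_)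
    · refine setIntegral_congr_fun e.open_target.measurableSet fun y hy ↦ ?_
      simp only [e.right_inv hy, chartGradInner, chartFlux, pderiv_congr (hφe y hy),
        Fin.sum_univ_two]
      ring
    · intro y hy
      have h0 : φ =ᶠ[𝓝 y] 0 :=
        notMem_tsupport_iff_eventuallyEq.1 fun h ↦ hy (hKO (hKφ h)).1
      refine Finset.sum_eq_zero fun i _ ↦ ?_
      rw [pderiv_congr h0]
      simp [pderiv]
  rw [e1, e2, integral_finsetSum _ fun i _ ↦ (hibp i).1,
    integral_finsetSum _ fun i _ ↦ (hibp i).2.1, ← Finset.sum_neg_distrib]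
  exact Finset.sum_congr rfl fun i _ ↦ (hibp i).2.2

theorem setIntegral_source_eq_of_tsupport {F : M → ℝ} {U : Set M} (hU : U ⊆ e.source)
    (h0 : ∀ x ∈ e.source, x ∉ U → F x = 0) :
    ∫ x in e.source, F x ∂area M = ∫ x in U, F x ∂area M :=
  (setIntegral_eq_of_subset_of_forall_sdiff_eq_zero e.open_source.measurableSet hU
    fun x hx ↦ h0 x hx.1 hx.2)

/-- The Laplace–Beltrami operator does not depend on the chart. -/
theorem chartLaplacian_congr (he : IsSmoothChart e) (he' : IsSmoothChart e') (hs : IsOpen s)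
    (hu : ContMDiffOn (𝓡 2) 𝓘(ℝ, ℝ) ∞ u s) {x : M} (hx : x ∈ e.source) (hx' : x ∈ e'.source)
    (hxs : x ∈ s) : chartLaplacian e u (e x) = chartLaplacian e' u (e' x) := by
  have : LocallyCompactSpace M := ChartedSpace.locallyCompactSpace Plane M
  have := isLocallyFiniteMeasure_area (M := M)
  have : (area M).IsOpenPosMeasure := ⟨fun U hU hne ↦ (area_pos_of_isOpen hU hne).ne'⟩
  set U := (e.source ∩ e'.source) ∩ s with hUdef
  have hU : IsOpen U := (e.open_source.inter e'.open_source).inter hs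
  have hUe : U ⊆ e.source := fun z hz ↦ hz.1.1
  have hUe' : U ⊆ e'.source := fun z hz ↦ hz.1.2
  have hUs : U ⊆ s := fun z hz ↦ hz.2
  have hc1 : ContinuousOn (fun x ↦ chartLaplacian e u (e x)) U :=
    (he.continuousOn_chartLaplacian hs hu).mono fun z hz ↦ ⟨hUe hz, hUs hz⟩
  have hc2 : ContinuousOn (fun x ↦ chartLaplacian e' u (e' x)) U :=
    (he'.continuousOn_chartLaplacian hs hu).mono fun z hz ↦ ⟨hUe' hz, hUs hz⟩
  -- The transformation rule for second derivatives is bypassed. Against test functions supported in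
  -- the overlap both Laplacians give the same Dirichlet integral, whose integrand is known to be
  -- invariant. They therefore agree almost everywhere, and everywhere by continuity because `area`
  -- charges nonempty open sets.
  have hae : ∀ᵐ z ∂area M, z ∈ U →
      chartLaplacian e u (e z) - chartLaplacian e' u (e' z) = 0 := by
    refine hU.ae_eq_zero_of_integral_contMDiff_smul_eq_zero (𝓡 2)
      ((hc1.sub hc2).locallyIntegrableOn hU.measurableSet) fun Φ hΦ hc hsub ↦ ?_
    have key : ∀ {e₁ : OpenPartialHomeomorph M Plane}, IsSmoothChart e₁ → U ⊆ e₁.source →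
        ContinuousOn (fun x ↦ chartLaplacian e₁ u (e₁ x)) U →
        Integrable (fun z ↦ Φ z * chartLaplacian e₁ u (e₁ z)) (area M) ∧
        ∫ z, Φ z * chartLaplacian e₁ u (e₁ z) ∂area M =
          - ∫ z in U, chartGradInner e₁ Φ u (e₁ z) ∂area M := by
      intro e₁ he₁ hUe₁ hcont
      have hts : tsupport (fun z ↦ Φ z * chartLaplacian e₁ u (e₁ z)) ⊆ tsupport Φ :=
        tsupport_mul_subset_left
      constructor
      · refine Continuous.integrable_of_hasCompactSupport ?_
          (hc.isCompact.of_isClosed_subset (isClosed_tsupport _) hts)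
        exact (hΦ.continuous.continuousOn.mul hcont).continuous_of_tsupport_subset hU
          (hts.trans hsub)
      · have h := he₁.integral_mul_chartLaplacian hs hu hΦ hc
          (hsub.trans fun z hz ↦ ⟨hUe₁ hz, hUs hz⟩)
        rw [setIntegral_source_eq_of_tsupport hUe₁ fun z hz hzU ↦
          chartGradInner_eq_zero_of_notMem_tsupport hz (fun h ↦ hzU (hsub h)) u] at h
        rw [← h, setIntegral_eq_integral_of_forall_compl_eq_zero]
        intro z hz
        rw [image_eq_zero_of_notMem_tsupport (fun h ↦ hz (hUe₁ (hsub h))), zero_mul]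
    obtain ⟨i1, h1⟩ := key he hUe hc1
    obtain ⟨i2, h2⟩ := key he' hUe' hc2
    simp only [smul_eq_mul, mul_sub]
    rw [integral_sub i1 i2, h1, h2, sub_eq_zero]
    congr 1
    refine setIntegral_congr_fun hU.measurableSet fun z hz ↦ ?_
    exact chartGradInner_congr he he' (hUe hz) (hUe' hz)
      (mdifferentiableAt_of_contMDiffOn isOpen_univ hΦ.contMDiffOn trivial)
      (mdifferentiableAt_of_contMDiffOn hs hu (hUs hz))
  refine Measure.eqOn_open_of_ae_eq (μ := area M) ?_ hU hc1 hc2 ⟨⟨hx, hx'⟩, hxs⟩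
  rw [Filter.EventuallyEq, ae_restrict_iff' hU.measurableSet]
  filter_upwards [hae] with z hz hzU using sub_eq_zero.1 (hz hzU)

theorem IsSmoothChart.laplaceBeltrami_eq (he : IsSmoothChart e) (hs : IsOpen s)
    (hu : ContMDiffOn (𝓡 2) 𝓘(ℝ, ℝ) ∞ u s) {x : M} (hx : x ∈ e.source) (hxs : x ∈ s) :
    laplaceBeltrami u x = chartLaplacian e u (e x) :=
  chartLaplacian_congr (isSmoothChart_chartAt x) he hs hu (mem_chart_source _ x) hx hxs

theorem continuousOn_laplaceBeltrami (hs : IsOpen s) (hu : ContMDiffOn (𝓡 2) 𝓘(ℝ, ℝ) ∞ u s) :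
    ContinuousOn (laplaceBeltrami u) s := by
  intro x hx
  have he := isSmoothChart_chartAt (M := M) x
  have hxe := mem_chart_source Plane x
  have hn := ((chartAt Plane x).open_source.inter hs).mem_nhds ⟨hxe, hx⟩
  refine (((he.continuousOn_chartLaplacian hs hu).continuousAt hn).congr ?_).continuousWithinAt
  filter_upwards [hn] with z hz
  exact (he.laplaceBeltrami_eq hs hu hz.1 hz.2).symm

end IntegrationByParts

/-! ### Green's formula on the surface. -/

section GreenFormula

variable {M : Type*} [TopologicalSpace M] [ChartedSpace Plane M] [IsManifold (𝓡 2) ∞ M]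
  [RiemannianBundle (fun x : M ↦ TangentSpace (𝓡 2) x)]
  {e : OpenPartialHomeomorph M Plane} {u Φ : M → ℝ} {s : Set M}

theorem gradInner_eq_zero_of_notMem_tsupport {x : M} (hx : x ∉ tsupport Φ) (u : M → ℝ) :
    gradInner Φ u x = 0 :=
  chartGradInner_eq_zero_of_notMem_tsupport (mem_chart_source _ x) hx u

/-- Reassembles the pieces of a partition of unity. Their sum is the test function itself, so
derivatives of the cut-offs never have to be computed. -/
theorem gradInner_sum {ι : Type*} (F : Finset ι) {φ : ι → M → ℝ} {x : M}
    (hφ : ∀ k ∈ F, MDifferentiableAt (𝓡 2) 𝓘(ℝ, ℝ) (φ k) x) (u : M → ℝ) :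
    gradInner (fun z ↦ ∑ k ∈ F, φ k z) u x = ∑ k ∈ F, gradInner (φ k) u x := by
  have h : ∀ i, pderiv i (fun z ↦ ∑ k ∈ F, φ k ((chartAt Plane x).symm z)) (chartAt Plane x x) =
      ∑ k ∈ F, pderiv i (fun z ↦ φ k ((chartAt Plane x).symm z)) (chartAt Plane x x) := by
    intro i
    simp only [pderiv]
    rw [fderiv_fun_sum fun k hk ↦ (isSmoothChart_chartAt x).differentiableAt_comp_symm
      (mem_chart_source _ x) (hφ k hk), sum_apply]
  simp only [gradInner, chartGradInner, h, Finset.mul_sum, Finset.sum_mul, Fin.sum_univ_two,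
    ← Finset.sum_add_distrib]

theorem gradInner_comp {T : ℝ → ℝ} {x : M} (hu : MDifferentiableAt (𝓡 2) 𝓘(ℝ, ℝ) u x)
    (hT : DifferentiableAt ℝ T (u x)) (v : M → ℝ) :
    gradInner (fun z ↦ T (u z)) v x = deriv T (u x) * gradInner u v x := by
  have hxe := mem_chart_source Plane x
  have h : ∀ i, pderiv i (fun z ↦ T (u ((chartAt Plane x).symm z))) (chartAt Plane x x) =
      deriv T (u x) * pderiv i (fun z ↦ u ((chartAt Plane x).symm z)) (chartAt Plane x x) := by
    intro i
    have h1 := ((isSmoothChart_chartAt x).differentiableAt_comp_symm hxe hu).hasFDerivAt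
    have h2 : HasDerivAt T (deriv T (u x)) (u ((chartAt Plane x).symm (chartAt Plane x x))) := by
      rw [(chartAt Plane x).left_inv hxe]; exact hT.hasDerivAt
    have h3 := HasDerivAt.comp_hasFDerivAt
      (f := fun z ↦ u ((chartAt Plane x).symm z)) (chartAt Plane x x) h2 h1
    simp only [pderiv]
    rw [show (fun z ↦ T (u ((chartAt Plane x).symm z))) =
      T ∘ fun z ↦ u ((chartAt Plane x).symm z) from rfl, h3.fderiv]
    rfl
  simp only [gradInner, chartGradInner, h, Fin.sum_univ_two]
  ring

theorem gradInner_congr {Ψ : M → ℝ} {x : M} (h : Φ =ᶠ[𝓝 x] Ψ) (u : M → ℝ) :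
    gradInner Φ u x = gradInner Ψ u x := by
  have h2 : Filter.Tendsto (chartAt Plane x).symm (𝓝 (chartAt Plane x x)) (𝓝 x) := by
    have := (chartAt Plane x).continuousAt_symm (mem_chart_target Plane x)
    rwa [ContinuousAt, (chartAt Plane x).left_inv (mem_chart_source _ x)] at this
  simp only [gradInner, chartGradInner]
  have h3 : (fun z ↦ Φ ((chartAt Plane x).symm z)) =ᶠ[𝓝 (chartAt Plane x x)]
    fun z ↦ Ψ ((chartAt Plane x).symm z) := h2.eventually h
  simp only [pderiv_congr h3]

variable [IsContMDiffRiemannianBundle (𝓡 2) ∞ Plane (fun x : M ↦ TangentSpace (𝓡 2) x)]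

theorem gradInner_self_nonneg (u : M → ℝ) (x : M) : 0 ≤ gradInner u u x := by
  rw [gradInner, chartGradInner_eq_dotProduct]
  have h := (((isSmoothChart_chartAt x).metricMatrix_posDef
    (mem_chart_target Plane x)).inv.posSemidef).dotProduct_mulVec_nonneg
    (fun i ↦ pderiv i (fun z ↦ u ((chartAt Plane x).symm z)) (chartAt Plane x x))
  simpa using h

variable [MeasurableSpace M] [BorelSpace M] [SecondCountableTopology M] [T2Space M]

theorem integrableOn_of_continuousOn_of_eq_zero_off {F : M → ℝ} {K : Set M} (hs : IsOpen s)
    (hF : ContinuousOn F s) (hK : IsCompact K) (hKs : K ⊆ s) (h0 : ∀ x ∈ s, x ∉ K → F x = 0) :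
    IntegrableOn F s (area M) := by
  have := isLocallyFiniteMeasure_area (M := M)
  exact ((hF.mono hKs).integrableOn_compact hK).of_forall_sdiff_eq_zero hs.measurableSet
    fun x hx ↦ h0 x hx.1 hx.2

/-- Green's formula for a test function supported in a chart. -/
theorem IsSmoothChart.setIntegral_mul_laplaceBeltrami (he : IsSmoothChart e) (hs : IsOpen s)
    (hu : ContMDiffOn (𝓡 2) 𝓘(ℝ, ℝ) ∞ u s) (hΦ : ContMDiff (𝓡 2) 𝓘(ℝ, ℝ) ∞ Φ)
    (hc : HasCompactSupport Φ) (hsub : tsupport Φ ⊆ e.source ∩ s) :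
    ∫ x in s, Φ x * laplaceBeltrami u x ∂area M = - ∫ x in s, gradInner Φ u x ∂area M := by
  have hU : MeasurableSet (e.source ∩ s) := (e.open_source.inter hs).measurableSet
  have h1 : ∫ x in s, Φ x * laplaceBeltrami u x ∂area M =
      ∫ x in e.source, Φ x * chartLaplacian e u (e x) ∂area M := by
    rw [setIntegral_eq_of_subset_of_forall_sdiff_eq_zero (s := e.source ∩ s) hs.measurableSet
        Set.inter_subset_right,
      setIntegral_eq_of_subset_of_forall_sdiff_eq_zero (s := e.source ∩ s)
        e.open_source.measurableSet Set.inter_subset_left]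
    · refine setIntegral_congr_fun hU fun x hx ↦ ?_
      simp only [he.laplaceBeltrami_eq hs hu hx.1 hx.2]
    all_goals
      intro x hx
      rw [image_eq_zero_of_notMem_tsupport fun h ↦ hx.2 (hsub h), zero_mul]
  have h2 : ∫ x in s, gradInner Φ u x ∂area M =
      ∫ x in e.source, chartGradInner e Φ u (e x) ∂area M := by
    rw [setIntegral_eq_of_subset_of_forall_sdiff_eq_zero (s := e.source ∩ s) hs.measurableSet
        Set.inter_subset_right,
      setIntegral_eq_of_subset_of_forall_sdiff_eq_zero (s := e.source ∩ s)
        e.open_source.measurableSet Set.inter_subset_left]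
    · refine setIntegral_congr_fun hU fun x hx ↦ ?_
      exact gradInner_eq_chartGradInner he hx.1
        (mdifferentiableAt_of_contMDiffOn isOpen_univ hΦ.contMDiffOn trivial)
        (mdifferentiableAt_of_contMDiffOn hs hu hx.2)
    · intro x hx
      exact chartGradInner_eq_zero_of_notMem_tsupport hx.1 (fun h ↦ hx.2 (hsub h)) u
    · intro x hx
      exact gradInner_eq_zero_of_notMem_tsupport (fun h ↦ hx.2 (hsub h)) u
  rw [h1, h2, he.integral_mul_chartLaplacian hs hu hΦ hc hsub]

/-- Green's formula for a compactly supported test function. -/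
theorem setIntegral_mul_laplaceBeltrami (hs : IsOpen s)
    (hu : ContMDiffOn (𝓡 2) 𝓘(ℝ, ℝ) ∞ u s) (hΦ : ContMDiff (𝓡 2) 𝓘(ℝ, ℝ) ∞ Φ)
    (hc : HasCompactSupport Φ) (hsub : tsupport Φ ⊆ s) :
    ∫ x in s, Φ x * laplaceBeltrami u x ∂area M = - ∫ x in s, gradInner Φ u x ∂area M := by
  have : LocallyCompactSpace M := ChartedSpace.locallyCompactSpace Plane M
  obtain ⟨ζ, hζ⟩ := SmoothPartitionOfUnity.exists_isSubordinate_chartAt_source (𝓡 2) M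
  -- Only finitely many `ζ k` meet the support of `Φ`, so the sums below are finite.
  have hfin := ζ.locallyFinite.finite_nonempty_inter_compact hc.isCompact
  set F := hfin.toFinset with hF
  have hsupp : ∀ k, tsupport (fun x ↦ ζ k x * Φ x) ⊆ tsupport Φ := fun k ↦
    tsupport_mul_subset_right
  have hsupp' : ∀ k, tsupport (fun x ↦ ζ k x * Φ x) ⊆ (chartAt Plane k).source ∩ s := fun k ↦
    Set.subset_inter (tsupport_mul_subset_left.trans (hζ k)) ((hsupp k).trans hsub)
  have hcomp : ∀ k, HasCompactSupport (fun x ↦ ζ k x * Φ x) := fun k ↦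
    hc.isCompact.of_isClosed_subset (isClosed_tsupport _) (hsupp k)
  have hsm : ∀ k, ContMDiff (𝓡 2) 𝓘(ℝ, ℝ) ∞ (fun x ↦ ζ k x * Φ x) := fun k ↦
    (ζ k).contMDiff.mul hΦ
  have hsum : ∀ x, ∑ k ∈ F, ζ k x * Φ x = Φ x := by
    intro x
    by_cases hx : x ∈ tsupport Φ
    · have h1 : ∑ k ∈ F, ζ k x = 1 := by
        rw [← ζ.sum_eq_one (Set.mem_univ x), finsum_eq_sum_of_support_subset]
        intro k hk
        rw [hF, Set.Finite.coe_toFinset]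
        exact ⟨x, hk, hx⟩
      rw [← Finset.sum_mul, h1, one_mul]
    · simp [image_eq_zero_of_notMem_tsupport hx]
  have e1 : ∫ x in s, Φ x * laplaceBeltrami u x ∂area M =
      ∑ k ∈ F, ∫ x in s, (ζ k x * Φ x) * laplaceBeltrami u x ∂area M := by
    rw [← integral_finsetSum]
    · simp only [← Finset.sum_mul, hsum]
    · intro k _
      refine integrableOn_of_continuousOn_of_eq_zero_off hs
        ((hsm k).continuous.continuousOn.mul (continuousOn_laplaceBeltrami hs hu)) hc.isCompact
        hsub fun x _ hx ↦ ?_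
      rw [image_eq_zero_of_notMem_tsupport hx, mul_zero, zero_mul]
  have e2 : ∫ x in s, gradInner Φ u x ∂area M =
      ∑ k ∈ F, ∫ x in s, gradInner (fun x ↦ ζ k x * Φ x) u x ∂area M := by
    rw [← integral_finsetSum]
    · refine integral_congr_ae (Filter.Eventually.of_forall fun x ↦ ?_)
      simp only
      rw [← gradInner_sum F fun k _ ↦
        mdifferentiableAt_of_contMDiffOn isOpen_univ (hsm k).contMDiffOn trivial]
      simp only [hsum]
    · intro k _
      exact integrableOn_of_continuousOn_of_eq_zero_off hs
        (continuousOn_gradInner hs (hsm k).contMDiffOn hu) hc.isCompact hsub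
        fun x _ hx ↦ gradInner_eq_zero_of_notMem_tsupport (fun h ↦ hx (hsupp k h)) u
  rw [e1, e2, ← Finset.sum_neg_distrib]
  exact Finset.sum_congr rfl fun k _ ↦
    (isSmoothChart_chartAt k).setIntegral_mul_laplaceBeltrami hs hu (hsm k) (hcomp k) (hsupp' k)

end GreenFormula

/-! ### The coarea inequality in a straightened chart. -/

section Coarea

theorem measurePreserving_toPlane :
    MeasurePreserving (fun p : ℝ × ℝ ↦ (!₂[p.1, p.2] : Plane)) volume volume :=
  (PiLp.volume_preserving_toLp (Fin 2)).comp ((volume_preserving_finTwoArrow ℝ).symm _)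

theorem toPlane_eq_add_smul (t : ℝ) : (fun y : ℝ ↦ (!₂[t, y] : Plane)) =
    fun y ↦ !₂[t, 0] + y • (EuclideanSpace.single 1 1 : Plane) := by
  ext y i
  fin_cases i <;> simp

theorem hasDerivAt_toPlane (t y : ℝ) :
    HasDerivAt (fun y : ℝ ↦ (!₂[t, y] : Plane)) (EuclideanSpace.single 1 1) y := by
  rw [toPlane_eq_add_smul]
  have := ((hasDerivAt_id y).smul_const (EuclideanSpace.single 1 1 : Plane)).const_add !₂[t, 0]
  rw [one_smul] at this
  exact this

theorem contDiff_toPlane (t : ℝ) : ContDiff ℝ ∞ (fun y : ℝ ↦ (!₂[t, y] : Plane)) := by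
  rw [toPlane_eq_add_smul]
  exact contDiff_const.add (contDiff_id.smul contDiff_const)

variable {M : Type*} [EMetricSpace M] [ChartedSpace Plane M] [IsManifold (𝓡 2) ∞ M]
  [RiemannianBundle (fun x : M ↦ TangentSpace (𝓡 2) x)]
  [IsContMDiffRiemannianBundle (𝓡 2) ∞ Plane (fun x : M ↦ TangentSpace (𝓡 2) x)]
  [IsRiemannianManifold (𝓡 2) M] {e : OpenPartialHomeomorph M Plane}

/-- The coordinate lines of a chart are Lipschitz with constant any bound for `√g₁₁`. -/
theorem IsSmoothChart.lipschitzOnWith_coordLine (he : IsSmoothChart e) {t : ℝ} {J : Set ℝ}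
    (hJ : J.OrdConnected) {c : ℝ≥0} (hJe : ∀ y ∈ J, (!₂[t, y] : Plane) ∈ e.target)
    (hc : ∀ y ∈ J, √(metricMatrix e !₂[t, y] 1 1) ≤ c) :
    LipschitzOnWith c (fun y : ℝ ↦ e.symm !₂[t, y]) J := by
  have key : ∀ a ∈ J, ∀ b ∈ J, a ≤ b →
      edist (e.symm !₂[t, a]) (e.symm !₂[t, b]) ≤ c * edist a b := by
    intro a ha b hb hab
    have hsub : Set.Icc a b ⊆ J := hJ.out ha hb
    have hsm : ContMDiffOn 𝓘(ℝ, ℝ) (𝓡 2) 1 (fun y : ℝ ↦ e.symm !₂[t, y]) (Set.Icc a b) :=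
      (he.contMDiffOn_symm.of_le (by simp)).comp
        ((contDiff_toPlane t).of_le (by simp)).contMDiff.contMDiffOn fun y hy ↦ hJe y (hsub hy)
    rw [IsRiemannianManifold.out (I := 𝓡 2)]
    refine (Manifold.riemannianEDist_le_pathELength hsm rfl rfl hab).trans ?_
    rw [Manifold.pathELength_eq_lintegral_mfderiv_Icc]
    calc _ ≤ ∫⁻ _ in Set.Icc a b, (c : ℝ≥0∞) := by
          refine setLIntegral_mono measurable_const fun y hy ↦ ?_
          have hd : MDifferentiableAt 𝓘(ℝ, ℝ) (𝓡 2) (fun y : ℝ ↦ (!₂[t, y] : Plane)) y :=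
            (hasDerivAt_toPlane t y).differentiableAt.mdifferentiableAt
          have h1 : mfderiv 𝓘(ℝ, ℝ) (𝓡 2) (fun y : ℝ ↦ e.symm !₂[t, y]) y (1 : ℝ) =
              coordVector e !₂[t, y] 1 := by
            have h2 := mfderiv_comp_apply y (he.mdifferentiableAt_symm (hJe y (hsub hy))) hd
              (1 : ℝ)
            refine h2.trans ?_
            have h3 : mfderiv 𝓘(ℝ, ℝ) (𝓡 2) (fun y : ℝ ↦ (!₂[t, y] : Plane)) y (1 : ℝ) =
                (EuclideanSpace.single 1 1 : Plane) := by
              rw [mfderiv_eq_fderiv]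
              exact (hasDerivAt_toPlane t y).deriv
            rw [h3]
            rfl
          refine (congrArg (fun w : TangentSpace (𝓡 2) (e.symm !₂[t, y]) ↦ ‖w‖ₑ) h1).trans_le ?_
          have h4 : √(metricMatrix e !₂[t, y] 1 1) = ‖coordVector e !₂[t, y] 1‖ := by
            rw [metricMatrix_apply, metricForm_self_eq_norm_sq, Real.sqrt_sq (norm_nonneg _)]
            rfl
          have h5 := hc y (hsub hy)
          rw [h4] at h5
          exact enorm_le_coe.2 h5
      _ = c * edist a b := by
          rw [setLIntegral_const, Real.volume_Icc, edist_dist, Real.dist_eq, abs_sub_comm,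
            abs_of_nonneg (sub_nonneg.2 hab)]
  intro a ha b hb
  rcases le_total a b with h | h
  · exact key a ha b hb h
  · rw [edist_comm, edist_comm a b]
    exact key b hb a ha h

variable [MeasurableSpace M] [BorelSpace M]

/-- The length of a coordinate line is at most the integral of `√g₁₁`. -/
theorem IsSmoothChart.hausdorffMeasure_coordLine_le (he : IsSmoothChart e) (t : ℝ) {K : Set ℝ}
    (hK : MeasurableSet K) (hKe : ∀ y ∈ K, (!₂[t, y] : Plane) ∈ e.target) :
    (Measure.hausdorffMeasure 1 : Measure M) ((fun y : ℝ ↦ e.symm !₂[t, y]) '' K) ≤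
      ∫⁻ y in K, ENNReal.ofReal √(metricMatrix e !₂[t, y] 1 1) := by
  set γ : ℝ → M := fun y ↦ e.symm !₂[t, y] with hγ
  set g : ℝ → ℝ := fun y ↦ √(metricMatrix e !₂[t, y] 1 1) with hg
  have hJo : IsOpen {y : ℝ | (!₂[t, y] : Plane) ∈ e.target} :=
    e.open_target.preimage (contDiff_toPlane t).continuous
  have hgc : ContinuousOn g {y : ℝ | (!₂[t, y] : Plane) ∈ e.target} :=
    Real.continuous_sqrt.comp_continuousOn ((he.contDiffOn_metricMatrix 1 1).continuousOn.comp
      (contDiff_toPlane t).continuous.continuousOn fun y hy ↦ hy)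
  set m : OuterMeasure ℝ := OuterMeasure.comap γ
    (Measure.hausdorffMeasure 1 : Measure M).toOuterMeasure with hm
  set ν : Measure ℝ := volume.withDensity fun y ↦ ENNReal.ofReal (g y) with hν
  have hνA : ∀ A, MeasurableSet A → ν A = ∫⁻ y in A, ENNReal.ofReal (g y) := fun A hA ↦
    withDensity_apply _ hA
  have hloc : ∀ A, MeasurableSet A → A ⊆ K → volume A ≠ ⊤ → m A ≤ ν A := by
    intro A hA hAK hfin
    -- Near `y` the curve is Lipschitz with constant `g y + ε / 2`, and `g y + ε / 2 ≤ g + ε` there.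
    -- This compares the image measure with `(g + ε) dy` locally.
    have hle : ∀ ε : ℝ≥0, 0 < ε → m A ≤ ν A + ε * volume A := by
      intro ε hε
      refine outerMeasure_le_of_locally_le m (ν + ε • volume) hA fun y hy ↦ ?_
      have hyJ := hKe y (hAK hy)
      have hε2 : (0 : ℝ) < ε / 2 := by positivity
      have hev : ∀ᶠ z in 𝓝 y, (!₂[t, z] : Plane) ∈ e.target ∧ |g z - g y| < ε / 2 := by
        refine (hJo.eventually_mem hyJ).and ?_
        have := Metric.tendsto_nhds.1 (hgc.continuousAt (hJo.mem_nhds hyJ)) _ hε2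
        simpa [Real.dist_eq] using this
      obtain ⟨r, hr, hball⟩ := Metric.eventually_nhds_iff_ball.1 hev
      have hc0 : 0 ≤ g y + ε / 2 := add_nonneg (Real.sqrt_nonneg _) hε2.le
      refine ⟨Metric.ball y r, Metric.isOpen_ball, Metric.mem_ball_self hr, fun B hB hBm ↦ ?_⟩
      have hlip : LipschitzOnWith (g y + ε / 2).toNNReal γ (Metric.ball y r) := by
        refine he.lipschitzOnWith_coordLine ?_ (fun z hz ↦ (hball z hz).1) fun z hz ↦ ?_
        · rw [Real.ball_eq_Ioo]; exact Set.ordConnected_Ioo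
        · have := (abs_lt.1 (hball z hz).2).2
          rw [Real.coe_toNNReal _ hc0]
          change g z ≤ g y + ε / 2
          linarith
      have h1 := (hlip.mono (hB.trans Set.inter_subset_left)).hausdorffMeasure_image_le
        zero_le_one
      rw [hausdorffMeasure_real, ENNReal.rpow_one] at h1
      refine h1.trans ?_
      rw [Measure.add_apply, hνA B hBm, Measure.smul_apply, ← setLIntegral_const,
        ENNReal.smul_def, smul_eq_mul, ← setLIntegral_const, ← lintegral_add_right _
        measurable_const]
      refine setLIntegral_mono' hBm fun z hz ↦ ?_
      rw [← ENNReal.ofReal_coe_nnreal (p := ε),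
        ← ENNReal.ofReal_add (Real.sqrt_nonneg _) ε.coe_nonneg]
      refine ENNReal.ofReal_le_ofReal ?_
      have := (abs_lt.1 (hball z (hB hz).1).2).1
      change g y + ε / 2 ≤ g z + ε
      linarith
    refine ENNReal.le_of_forall_pos_le_add fun δ hδ _ ↦ ?_
    obtain ⟨ε, hε, hε'⟩ := ENNReal.exists_nnreal_pos_mul_lt hfin
      (ENNReal.coe_ne_zero.2 hδ.ne')
    exact (hle ε hε).trans (by gcongr)
  rw [← hνA K hK]
  change m K ≤ ν K
  -- The error `ε * volume A` can be sent to zero only on sets of finite length, whence a second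
  -- localisation to unit balls.
  refine outerMeasure_le_of_locally_le m ν hK fun y hy ↦
    ⟨Metric.ball y 1, Metric.isOpen_ball, Metric.mem_ball_self one_pos, fun A hA hAm ↦ ?_⟩
  exact hloc A hAm (hA.trans Set.inter_subset_right)
    (measure_lt_top_of_subset (hA.trans Set.inter_subset_left) measure_ball_lt_top.ne).ne

variable [SecondCountableTopology M] {u : M → ℝ} {s : Set M}

/-- Here `|∇u|² = g⁰⁰ = g₁₁ / det g`. So `|∇u|` times the area element is the length element `√g₁₁`
of the level lines times `dy⁰ dy¹`, and the coarea formula becomes Fubini's theorem. -/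
theorem IsSmoothChart.areaDensity_mul_sqrt_chartGradInner (he : IsSmoothChart e)
    (hue : ∀ y ∈ e.target, u (e.symm y) = y 0) {y : Plane} (hy : y ∈ e.target) :
    areaDensity e y * √(chartGradInner e u u y) = √(metricMatrix e y 1 1) := by
  have h : (fun z ↦ u (e.symm z)) =ᶠ[𝓝 y] fun z ↦ z 0 := by
    filter_upwards [e.open_target.mem_nhds hy] with z hz using hue z hz
  have hp : ∀ i, pderiv i (fun z : Plane ↦ z 0) y = if i = 0 then 1 else 0 := by
    intro i
    let L : Plane →L[ℝ] ℝ := EuclideanSpace.proj (0 : Fin 2)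
    have h2 : fderiv ℝ (fun z : Plane ↦ z 0) y = L := L.hasFDerivAt.fderiv
    rw [pderiv, h2]
    change (EuclideanSpace.single i (1 : ℝ) : Plane) 0 = _
    fin_cases i <;> simp
  have hdet := he.metricMatrix_det_pos hy
  have hg : chartGradInner e u u y = metricMatrix e y 1 1 / (metricMatrix e y).det := by
    simp only [chartGradInner, pderiv_congr h, hp, Fin.sum_univ_two]
    simp [Matrix.inv_def, Matrix.adjugate_fin_two]
    ring
  rw [hg, areaDensity, ← Real.sqrt_mul hdet.le, mul_div_cancel₀ _ hdet.ne']

/-- The coarea inequality in a chart whose first coordinate is the function `u`. -/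
theorem IsSmoothChart.exists_measurable_hausdorffMeasure_le (he : IsSmoothChart e)
    (hue : ∀ y ∈ e.target, u (e.symm y) = y 0) (hu : ContMDiffOn (𝓡 2) 𝓘(ℝ, ℝ) ∞ u e.source)
    {B : Set M} (hB : MeasurableSet B) (hBe : B ⊆ e.source) :
    ∃ h : ℝ → ℝ≥0∞, Measurable h ∧
      (∀ t, (Measure.hausdorffMeasure 1 : Measure M) {x ∈ B | u x = t} ≤ h t) ∧
      ∫⁻ t, h t = ∫⁻ x in B, ENNReal.ofReal √(gradInner u u x) ∂area M := by
  classical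
  set S : Set Plane := e.target ∩ e.symm ⁻¹' B with hS
  have hSm : MeasurableSet S := measurableSet_target_inter_preimage_symm e hB
  set g : Plane → ℝ := fun y ↦ √(metricMatrix e y 1 1) with hg
  have hgc : ContinuousOn g e.target :=
    Real.continuous_sqrt.comp_continuousOn (he.contDiffOn_metricMatrix 1 1).continuousOn
  set k : Plane → ℝ≥0∞ := S.indicator fun y ↦ ENNReal.ofReal (g y) with hk
  have hkm : Measurable k := by
    have h1 : Measurable (e.target.piecewise g 0) :=
      hgc.measurable_piecewise continuous_zero.continuousOn e.open_target.measurableSet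
    have h2 : k = S.indicator fun y ↦ ENNReal.ofReal (e.target.piecewise g 0 y) := by
      ext y
      by_cases hy : y ∈ S
      · simp [k, hy, hy.1]
      · simp [k, hy]
    rw [h2]
    exact h1.ennreal_ofReal.indicator hSm
  have hkp : Measurable fun p : ℝ × ℝ ↦ k !₂[p.1, p.2] :=
    hkm.comp measurePreserving_toPlane.measurable
  -- The majorant is the integral of `√g₁₁` along the coordinate line. It is measurable in `t` by
  -- Tonelli, which avoids any question about the measurability of the Hausdorff measures of the
  -- slices.
  refine ⟨fun t ↦ ∫⁻ y, k !₂[t, y], hkp.lintegral_prod_right', fun t ↦ ?_, ?_⟩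
  · have hKm : MeasurableSet {y : ℝ | (!₂[t, y] : Plane) ∈ S} :=
      (contDiff_toPlane t).continuous.measurable hSm
    have himg : {x ∈ B | u x = t} ⊆ (fun y : ℝ ↦ e.symm !₂[t, y]) '' {y | !₂[t, y] ∈ S} := by
      rintro x ⟨hxB, hxt⟩
      have hxe := hBe hxB
      have hpt : (!₂[t, (e x) 1] : Plane) = e x := by
        have h0 : (e x) 0 = t := by
          rw [← hue _ (e.map_source hxe), e.left_inv hxe, hxt]
        ext i
        fin_cases i
        · simp [h0]
        · simp
      refine ⟨(e x) 1, ?_, ?_⟩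
      · simp only [Set.mem_ofPred_eq, hpt]
        exact ⟨e.map_source hxe, by simpa [e.left_inv hxe] using hxB⟩
      · simp only [hpt, e.left_inv hxe]
    refine (measure_mono himg).trans ((he.hausdorffMeasure_coordLine_le t hKm
      fun y hy ↦ hy.1).trans_eq ?_)
    rw [← lintegral_indicator hKm]
    refine lintegral_congr fun y ↦ ?_
    simp only [k, Set.indicator_apply, Set.mem_ofPred_eq]
    rfl
  · have e1 : ∫⁻ t, ∫⁻ y, k !₂[t, y] = ∫⁻ z, k z := by
      rw [← measurePreserving_toPlane.lintegral_comp hkm, Measure.volume_eq_prod,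
        lintegral_prod _ hkp.aemeasurable]
    have hgm : ContinuousOn (fun x ↦ ENNReal.ofReal √(gradInner u u x)) e.source :=
      ENNReal.continuous_ofReal.comp_continuousOn (Real.continuous_sqrt.comp_continuousOn
        (continuousOn_gradInner e.open_source hu hu))
    have hmB : AEMeasurable (B.indicator fun x ↦ ENNReal.ofReal √(gradInner u u x))
        ((area M).restrict e.source) :=
      (hgm.aemeasurable e.open_source.measurableSet).indicator hB
    have e2 : ∫⁻ x in B, ENNReal.ofReal √(gradInner u u x) ∂area M = ∫⁻ z, k z := by
      rw [← lintegral_indicator hB, ← setLIntegral_eq_of_support_subset (s := e.source),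
        he.setLIntegral_area hmB, ← lintegral_indicator e.open_target.measurableSet]
      · refine lintegral_congr fun y ↦ ?_
        by_cases hy : y ∈ e.target
        · by_cases hyB : e.symm y ∈ B
          · have hyS : y ∈ S := ⟨hy, hyB⟩
            have hd := mdifferentiableAt_of_contMDiffOn e.open_source hu (e.map_target hy)
            simp only [k, Set.indicator_of_mem hy, Set.indicator_of_mem hyB,
              Set.indicator_of_mem hyS]
            rw [gradInner_eq_chartGradInner he (e.map_target hy) hd hd, e.right_inv hy,
              ← ENNReal.ofReal_mul (he.areaDensity_pos hy).le,
              he.areaDensity_mul_sqrt_chartGradInner hue hy]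
          · have hyS : y ∉ S := fun h ↦ hyB h.2
            simp [k, hyS, hyB]
        · have hyS : y ∉ S := fun h ↦ hy h.1
          simp [k, hyS, hy]
      · exact Set.support_indicator_subset.trans hBe
    rw [e1, e2]

end Coarea

/-! ### Charts adapted to a function, and Sard's theorem on the surface. -/

section Straightening

/-- A smooth function of the plane with a nonvanishing partial derivative can be taken as the first
coordinate of a local diffeomorphism. -/
theorem exists_openPartialHomeomorph_coord {v : Plane → ℝ} {O : Set Plane} (hO : IsOpen O)
    (hv : ContDiffOn ℝ ∞ v O) {y₀ : Plane} (hy₀ : y₀ ∈ O) (hne : fderiv ℝ v y₀ ≠ 0) :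
    ∃ ψ : OpenPartialHomeomorph Plane Plane, y₀ ∈ ψ.source ∧ ψ.source ⊆ O ∧
      ContDiffOn ℝ ∞ ψ ψ.source ∧ ContDiffOn ℝ ∞ ψ.symm ψ.target ∧
      ∀ y ∈ ψ.source, ψ y 0 = v y := by
  obtain ⟨i, hi⟩ : ∃ i, pderiv i v y₀ ≠ 0 := by
    by_contra! h
    refine hne (ContinuousLinearMap.ext fun a ↦ ?_)
    rw [fderiv_apply_eq_sum_pderiv]
    simp [h]
  let P : Fin 2 → Plane →L[ℝ] ℝ := fun j ↦ EuclideanSpace.proj j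
  -- With `∂ᵢ v ≠ 0`, keeping the other coordinate `1 - i` makes the differential injective: a
  -- vector in its kernel has zero component `1 - i`, and then `∂ᵢ v` kills the remaining one.
  set f : Plane → Plane := fun y ↦ !₂[v y, y (1 - i)] with hf
  set N : Set Plane := O ∩ {y | pderiv i v y ≠ 0} with hN
  have hNo : IsOpen N :=
    (contDiffOn_pderiv hO hv i).continuousOn.isOpen_inter_preimage hO isOpen_ne
  have hfs : ContDiffOn ℝ ∞ f N := by
    rw [contDiffOn_euclidean]
    intro j
    fin_cases j
    · exact hv.mono Set.inter_subset_left
    · exact (P (1 - i)).contDiff.contDiffOn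
  have hder : ∀ y ∈ N, ∃ L : Plane ≃L[ℝ] Plane, HasFDerivAt f (L : Plane →L[ℝ] Plane) y := by
    intro y hy
    have hd : HasFDerivAt f (fderiv ℝ f y) y :=
      ((hfs.contDiffAt (hNo.mem_nhds hy)).differentiableAt (by simp)).hasFDerivAt
    have hd0 : (P 0).comp (fderiv ℝ f y) = fderiv ℝ v y :=
      (HasFDerivAt.fderiv ((P 0).hasFDerivAt.comp y hd)).symm
    have hd1 : (P 1).comp (fderiv ℝ f y) = P (1 - i) :=
      ((P 1).hasFDerivAt.comp y hd).unique (P (1 - i)).hasFDerivAt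
    have hinj : Function.Injective (fderiv ℝ f y : Plane →ₗ[ℝ] Plane) := by
      rw [injective_iff_map_eq_zero]
      intro a ha
      have ha' : fderiv ℝ f y a = 0 := ha
      have h0 : fderiv ℝ v y a = 0 := by
        rw [← hd0, ContinuousLinearMap.comp_apply, ha', map_zero]
      have h1 : a (1 - i) = 0 := by
        change P (1 - i) a = 0
        rw [← hd1, ContinuousLinearMap.comp_apply, ha', map_zero]
      have hiy : pderiv i v y ≠ 0 := hy.2
      have h2 : a i = 0 := by
        rw [fderiv_apply_eq_sum_pderiv, Fin.sum_univ_two] at h0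
        revert h0 h1 hiy
        fin_cases i
        · intro h0 h1 hiy
          have h1' : a 1 = 0 := h1
          rw [h1', zero_mul, add_zero] at h0
          exact (mul_eq_zero.1 h0).resolve_right hiy
        · intro h0 h1 hiy
          have h1' : a 0 = 0 := h1
          rw [h1', zero_mul, zero_add] at h0
          exact (mul_eq_zero.1 h0).resolve_right hiy
      ext j
      by_cases hj : j = i
      · rw [hj, h2]; rfl
      · have : j = 1 - i := by omega
        rw [this, h1]; rfl
    let L := (LinearEquiv.ofInjectiveEndo _ hinj).toContinuousLinearEquiv
    refine ⟨L, ?_⟩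
    convert hd using 1
    exact ContinuousLinearMap.ext fun a ↦ rfl
  have hy₀N : y₀ ∈ N := ⟨hy₀, hi⟩
  obtain ⟨L, hL⟩ := hder y₀ hy₀N
  have hc := hfs.contDiffAt (hNo.mem_nhds hy₀N)
  set Ψ := hc.toOpenPartialHomeomorph f hL (by simp) with hΨ
  have hΨf : ∀ y, Ψ y = f y := fun y ↦ rfl
  -- The restriction to `N` makes the differential invertible at every point of the source, so that
  -- the inverse is smooth on the whole target and not just near the image of `y₀`.
  refine ⟨Ψ.restrOpen N hNo, ⟨hc.mem_toOpenPartialHomeomorph_source hL (by simp), hy₀N⟩,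
    fun y hy ↦ hy.2.1, hfs.mono Set.inter_subset_right, ?_, fun y hy ↦ ?_⟩
  · intro z hz
    have hzt : z ∈ Ψ.target := hz.1
    have hzN : Ψ.symm z ∈ N := hz.2
    obtain ⟨L', hL'⟩ := hder _ hzN
    exact (Ψ.contDiffAt_symm hzt hL' (hfs.contDiffAt (hNo.mem_nhds hzN))).contDiffWithinAt
  · change f y 0 = v y
    simp [f]

variable {M : Type*} [TopologicalSpace M] [ChartedSpace Plane M] [IsManifold (𝓡 2) ∞ M]
  {e : OpenPartialHomeomorph M Plane} {u : M → ℝ} {s : Set M}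

theorem IsSmoothChart.mfderiv_eq_zero_iff (he : IsSmoothChart e) {x : M} (hx : x ∈ e.source)
    (hu : MDifferentiableAt (𝓡 2) 𝓘(ℝ, ℝ) u x) :
    mfderiv (𝓡 2) 𝓘(ℝ, ℝ) u x = 0 ↔ fderiv ℝ (fun z ↦ u (e.symm z)) (e x) = 0 := by
  have hd := he.differentiableAt_comp_symm hx hu
  have hu' : MDifferentiableAt (𝓡 2) 𝓘(ℝ, ℝ) u (e.symm (e x)) := by rwa [e.left_inv hx]
  constructor
  · intro h
    have h1 := mfderiv_comp (e x) hu' (he.mdifferentiableAt_symm (e.map_source hx))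
    have h2 : mfderiv (𝓡 2) 𝓘(ℝ, ℝ) u (e.symm (e x)) = 0 := by
      rw [e.left_inv hx]; exact h
    rw [h2] at h1
    rw [← mfderiv_eq_fderiv]
    refine h1.trans ?_
    ext a
    rfl
  · intro h
    have h1 : u =ᶠ[𝓝 x] ((fun z ↦ u (e.symm z)) ∘ e) := by
      filter_upwards [e.open_source.mem_nhds hx] with z hz
      simp [e.left_inv hz]
    have h2 := mfderiv_comp (I' := 𝓡 2) (I'' := 𝓘(ℝ, ℝ)) x
      (g := fun z ↦ u (e.symm z)) hd.mdifferentiableAt (he.mdifferentiableAt hx)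
    rw [mfderiv_eq_fderiv, h] at h2
    rw [h1.mfderiv_eq]
    refine h2.trans ?_
    ext a
    rfl

/-- Near a regular point, a smooth function is the first coordinate of a chart. -/
theorem exists_isSmoothChart_coord (hs : IsOpen s) (hu : ContMDiffOn (𝓡 2) 𝓘(ℝ, ℝ) ∞ u s)
    {x : M} (hx : x ∈ s) (hne : mfderiv (𝓡 2) 𝓘(ℝ, ℝ) u x ≠ 0) :
    ∃ e : OpenPartialHomeomorph M Plane, IsSmoothChart e ∧ x ∈ e.source ∧ e.source ⊆ s ∧
      ∀ y ∈ e.target, u (e.symm y) = y 0 := by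
  have he := isSmoothChart_chartAt (M := M) x
  set e := chartAt Plane x with hedef
  have hxe : x ∈ e.source := mem_chart_source Plane x
  have hd := mdifferentiableAt_of_contMDiffOn hs hu hx
  obtain ⟨ψ, hxψ, hψO, hψ, hψ', hψ0⟩ := exists_openPartialHomeomorph_coord
    (e.isOpen_inter_preimage_symm hs) (he.contDiffOn_comp_symm (n := ⊤) hu)
    (y₀ := e x) ⟨e.map_source hxe, by simpa [e.left_inv hxe] using hx⟩
    ((he.mfderiv_eq_zero_iff hxe hd).not.1 hne)
  refine ⟨e.trans ψ, he.trans hψ hψ', ⟨hxe, hxψ⟩, fun z hz ↦ ?_, fun y hy ↦ ?_⟩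
  · have := (hψO hz.2).2
    have hl : e.symm (e z) = z := e.left_inv hz.1
    exact hl ▸ this
  · have h1 := hψ0 _ (ψ.map_target hy.1)
    rw [ψ.right_inv hy.1] at h1
    exact h1.symm

theorem isOpen_regular (hs : IsOpen s) (hu : ContMDiffOn (𝓡 2) 𝓘(ℝ, ℝ) ∞ u s) :
    IsOpen {x ∈ s | mfderiv (𝓡 2) 𝓘(ℝ, ℝ) u x ≠ 0} := by
  rw [isOpen_iff_mem_nhds]
  rintro x ⟨hxs, hx⟩
  have he := isSmoothChart_chartAt (M := M) x
  set e := chartAt Plane x with hedef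
  have hxe : x ∈ e.source := mem_chart_source Plane x
  have hO := e.isOpen_inter_preimage_symm hs
  have hc : ContinuousOn (fun z ↦ fderiv ℝ (fun y ↦ u (e.symm y)) (e z)) (e.source ∩ s) := by
    refine ((he.contDiffOn_comp_symm (n := ⊤) hu).continuousOn_fderiv_of_isOpen hO (by simp)).comp
      (e.continuousOn.mono Set.inter_subset_left) fun z hz ↦ ⟨e.map_source hz.1, ?_⟩
    simpa [e.left_inv hz.1] using hz.2
  have hn := (e.open_source.inter hs).mem_nhds ⟨hxe, hxs⟩
  have hne := (he.mfderiv_eq_zero_iff hxe (mdifferentiableAt_of_contMDiffOn hs hu hxs)).not.1 hx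
  filter_upwards [hn, (hc.continuousAt hn).eventually_ne hne] with z hz hz'
  exact ⟨hz.2, (he.mfderiv_eq_zero_iff hz.1
    (mdifferentiableAt_of_contMDiffOn hs hu hz.2)).not.2 hz'⟩

/-- Sard's theorem for smooth functions on a surface. -/
theorem volume_image_critical_eq_zero_of_contMDiffOn [SecondCountableTopology M] (hs : IsOpen s)
    (hu : ContMDiffOn (𝓡 2) 𝓘(ℝ, ℝ) ∞ u s) :
    volume (u '' {x ∈ s | mfderiv (𝓡 2) 𝓘(ℝ, ℝ) u x = 0}) = 0 := by
  obtain ⟨c, hcc, hc⟩ := TopologicalSpace.countable_cover_nhds (α := M)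
    (f := fun x ↦ (chartAt Plane x).source) fun x ↦ chart_source_mem_nhds Plane x
  have hsub : u '' {x ∈ s | mfderiv (𝓡 2) 𝓘(ℝ, ℝ) u x = 0} ⊆
      ⋃ k ∈ c, (fun y ↦ u ((chartAt Plane k).symm y)) ''
        {y ∈ (chartAt Plane k).target ∩ (chartAt Plane k).symm ⁻¹' s |
          fderiv ℝ (fun y ↦ u ((chartAt Plane k).symm y)) y = 0} := by
    rintro _ ⟨x, ⟨hxs, hx⟩, rfl⟩
    have hxu : x ∈ ⋃ k ∈ c, (chartAt Plane k).source := by rw [hc]; trivial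
    obtain ⟨k, hk, hxk⟩ := Set.mem_iUnion₂.1 hxu
    have hl := (chartAt Plane k).left_inv hxk
    refine Set.mem_iUnion₂.2 ⟨k, hk, chartAt Plane k x,
      ⟨⟨(chartAt Plane k).map_source hxk, by simpa [hl] using hxs⟩, ?_⟩, by simp [hl]⟩
    exact ((isSmoothChart_chartAt k).mfderiv_eq_zero_iff hxk
      (mdifferentiableAt_of_contMDiffOn hs hu hxs)).1 hx
  refine measure_mono_null hsub ((measure_biUnion_null_iff hcc).2 fun k _ ↦ ?_)
  exact volume_image_critical_eq_zero (by simp)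
    ((chartAt Plane k).isOpen_inter_preimage_symm hs)
    (((isSmoothChart_chartAt k).contDiffOn_comp_symm (n := ⊤) hu).of_le ENat.LEInfty.out)

end Straightening

/-! ### The coarea inequality on the regular set. -/

section Coarea

variable {M : Type*} [EMetricSpace M] [ChartedSpace Plane M] [IsManifold (𝓡 2) ∞ M]
  [RiemannianBundle (fun x : M ↦ TangentSpace (𝓡 2) x)]
  [IsContMDiffRiemannianBundle (𝓡 2) ∞ Plane (fun x : M ↦ TangentSpace (𝓡 2) x)]
  [IsRiemannianManifold (𝓡 2) M] [MeasurableSpace M] [BorelSpace M] [SecondCountableTopology M]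
  {u : M → ℝ} {s : Set M}

/-- The coarea inequality on the set of regular points. -/
theorem exists_measurable_hausdorffMeasure_le (hs : IsOpen s)
    (hu : ContMDiffOn (𝓡 2) 𝓘(ℝ, ℝ) ∞ u s) {B : Set M} (hB : MeasurableSet B) (hBs : B ⊆ s)
    (hreg : ∀ x ∈ B, mfderiv (𝓡 2) 𝓘(ℝ, ℝ) u x ≠ 0) :
    ∃ h : ℝ → ℝ≥0∞, Measurable h ∧
      (∀ t, (Measure.hausdorffMeasure 1 : Measure M) {x ∈ B | u x = t} ≤ h t) ∧
      ∫⁻ t, h t = ∫⁻ x in B, ENNReal.ofReal √(gradInner u u x) ∂area M := by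
  rcases B.eq_empty_or_nonempty with rfl | hBne
  · exact ⟨0, measurable_zero, by simp, by simp⟩
  have : Nonempty (OpenPartialHomeomorph M Plane) := ⟨chartAt Plane hBne.some⟩
  choose! e he hxe hes hue using fun x (hx : x ∈ B) ↦
    exists_isSmoothChart_coord hs hu (hBs hx) (hreg x hx)
  obtain ⟨c, hcB, hcc, hcov⟩ := TopologicalSpace.countable_cover_nhdsWithin
    (f := fun x ↦ (e x).source) (s := B) fun x hx ↦
      mem_nhdsWithin_of_mem_nhds ((e x).open_source.mem_nhds (hxe x hx))
  have hcne : c.Nonempty := by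
    obtain ⟨x, hx⟩ := hBne
    obtain ⟨y, hy, -⟩ := Set.mem_iUnion₂.1 (hcov hx)
    exact ⟨y, hy⟩
  obtain ⟨k, rfl⟩ := hcc.exists_eq_range hcne
  have hkB : ∀ n, k n ∈ B := fun n ↦ hcB ⟨n, rfl⟩
  set V : ℕ → Set M := fun n ↦ B ∩ (e (k n)).source with hV
  have hVm : ∀ n, MeasurableSet (disjointed V n) := fun n ↦
    MeasurableSet.disjointed (fun n ↦ hB.inter (e (k n)).open_source.measurableSet) n
  have hBV : B = ⋃ n, disjointed V n := by
    rw [iUnion_disjointed]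
    apply subset_antisymm
    · intro x hx
      obtain ⟨y, ⟨n, rfl⟩, hy⟩ := Set.mem_iUnion₂.1 (hcov hx)
      exact Set.mem_iUnion.2 ⟨n, hx, hy⟩
    · exact Set.iUnion_subset fun n ↦ Set.inter_subset_left
  choose h hm hle hint using fun n ↦
    (he _ (hkB n)).exists_measurable_hausdorffMeasure_le (hue _ (hkB n))
      (hu.mono (hes _ (hkB n))) (hVm n) ((disjointed_subset V n).trans Set.inter_subset_right)
  refine ⟨fun t ↦ ∑' n, h n t, Measurable.tsum hm, fun t ↦ ?_, ?_⟩
  · have hsub : {x ∈ B | u x = t} ⊆ ⋃ n, {x ∈ disjointed V n | u x = t} := by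
      rintro x ⟨hx, hxt⟩
      rw [hBV] at hx
      obtain ⟨n, hn⟩ := Set.mem_iUnion.1 hx
      exact Set.mem_iUnion.2 ⟨n, hn, hxt⟩
    exact (measure_mono hsub).trans ((measure_iUnion_le _).trans
      (ENNReal.tsum_le_tsum fun n ↦ hle n t))
  · rw [lintegral_tsum fun n ↦ (hm n).aemeasurable]
    conv_rhs => rw [hBV, lintegral_iUnion hVm (disjoint_disjointed V)]
    exact tsum_congr hint

end Coarea

/-! ### Boundedness of the Laplacian up to the boundary. -/

section Bound

open Asymptotics

/-- A function which is `C²` on a set containing the open set `O`, up to a point `y₀`, has bounded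
first and second derivatives in `O` near `y₀`. -/
theorem isBigO_one_fderiv_of_contDiffWithinAt {E : Type*} [NormedAddCommGroup E] [NormedSpace ℝ E]
    {v : E → ℝ} {D O : Set E} {y₀ : E} (hO : IsOpen O) (hOD : O ⊆ D) (hy₀ : y₀ ∈ D)
    (hv : ContDiffWithinAt ℝ 2 v D y₀) :
    (fderiv ℝ v) =O[𝓝[O] y₀] (fun _ ↦ (1 : ℝ)) ∧
      (fderiv ℝ (fderiv ℝ v)) =O[𝓝[O] y₀] (fun _ ↦ (1 : ℝ)) := by
  obtain ⟨w, hw, q, hq⟩ := (contDiffWithinAt_nat (n := 2)).1 hv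
  rw [Set.insert_eq_of_mem hy₀] at hw
  obtain ⟨N, hN, hyN, hNw⟩ := mem_nhdsWithin.1 hw
  have hsub : N ∩ O ⊆ w := fun z hz ↦ hNw ⟨hz.1, hOD hz.2⟩
  have hNO : IsOpen (N ∩ O) := hN.inter hO
  have hq' := hq.mono hsub
  have hmem : N ∩ O ∈ 𝓝[O] y₀ :=
    Filter.inter_mem (mem_nhdsWithin_of_mem_nhds (hN.mem_nhds hyN)) self_mem_nhdsWithin
  have hwO : w ∈ 𝓝[O] y₀ := Filter.mem_of_superset hmem hsub
  have hyw : y₀ ∈ w := hNw ⟨hyN, hy₀⟩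
  -- Derivatives within `D` may fail to be unique at `y₀`. The Taylor series `q` is continuous there
  -- regardless, and on the open set `N ∩ O` its terms are forced to be the iterated derivatives of
  -- `v`.
  have key : ∀ k : ℕ, k ≤ 2 → (fun y ↦ iteratedFDeriv ℝ k v y) =O[𝓝[O] y₀] (fun _ ↦ (1 : ℝ)) := by
    intro k hk
    have hk' : ((k : ℕ∞) : WithTop ℕ∞) ≤ ((2 : ℕ) : WithTop ℕ∞) :=
      WithTop.coe_le_coe.2 (Nat.cast_le.2 hk)
    have hc : Filter.Tendsto (fun y ↦ q y k) (𝓝[O] y₀) (𝓝 (q y₀ k)) :=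
      ((hq.cont k hk') y₀ hyw).tendsto.mono_left
        (le_inf nhdsWithin_le_nhds (Filter.le_principal_iff.2 hwO))
    refine (hc.isBigO_one ℝ).congr' ?_ Filter.EventuallyEq.rfl
    filter_upwards [hmem] with y hy
    rw [hq'.eq_iteratedFDerivWithin_of_uniqueDiffOn hk' hNO.uniqueDiffOn hy,
      iteratedFDerivWithin_of_isOpen k hNO hy]
  refine ⟨IsBigO.congr_left (IsBigO.of_norm_left ?_) fun _ ↦ rfl,
    IsBigO.congr_left (IsBigO.of_norm_left ?_) fun _ ↦ rfl⟩
  · simpa only [norm_iteratedFDeriv_one] using (key 1 (by norm_num)).norm_left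
  · simpa only [← norm_iteratedFDeriv_one, norm_iteratedFDeriv_fderiv] using
      (key 2 le_rfl).norm_left

variable {M : Type*} [TopologicalSpace M] [ChartedSpace Plane M] [IsManifold (𝓡 2) ∞ M]
  [RiemannianBundle (fun x : M ↦ TangentSpace (𝓡 2) x)]
  [IsContMDiffRiemannianBundle (𝓡 2) ∞ Plane (fun x : M ↦ TangentSpace (𝓡 2) x)]
  {e : OpenPartialHomeomorph M Plane} {u : M → ℝ} {s : Set M}

theorem isBigO_one_of_contDiffOn {F : Plane → ℝ} {U O : Set Plane} (hU : IsOpen U)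
    (hF : ContDiffOn ℝ ∞ F U) {y₀ : Plane} (hy : y₀ ∈ U) :
    F =O[𝓝[O] y₀] (fun _ ↦ (1 : ℝ)) :=
  ((hF.continuousOn.continuousAt (hU.mem_nhds hy)).tendsto.mono_left
    nhdsWithin_le_nhds).isBigO_one ℝ

/-- After expanding the divergence, the coefficients are smooth on all of `e.target`, hence bounded
near `y₀`; only the first two derivatives of `u` need the assumed bounds. -/
theorem IsSmoothChart.isBigO_one_chartLaplacian (he : IsSmoothChart e) {O : Set Plane}
    (hO : IsOpen O) (hOe : O ⊆ e.target) (hu : ContDiffOn ℝ ∞ (fun z ↦ u (e.symm z)) O)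
    {y₀ : Plane} (hy₀ : y₀ ∈ e.target)
    (h1 : (fderiv ℝ fun z ↦ u (e.symm z)) =O[𝓝[O] y₀] (fun _ ↦ (1 : ℝ)))
    (h2 : (fderiv ℝ (fderiv ℝ fun z ↦ u (e.symm z))) =O[𝓝[O] y₀] (fun _ ↦ (1 : ℝ))) :
    chartLaplacian e u =O[𝓝[O] y₀] (fun _ ↦ (1 : ℝ)) := by
  set v : Plane → ℝ := fun z ↦ u (e.symm z) with hv
  set a : Fin 2 → Fin 2 → Plane → ℝ := fun i j y ↦ areaDensity e y * (metricMatrix e y)⁻¹ i j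
    with ha
  have hac : ∀ i j, ContDiffOn ℝ ∞ (a i j) e.target := fun i j ↦
    he.contDiffOn_areaDensity.mul (he.contDiffOn_metricMatrix_inv i j)
  have hv1 : ∀ j, pderiv j v =O[𝓝[O] y₀] (fun _ ↦ (1 : ℝ)) := by
    intro j
    refine (IsBigO.of_bound 1 (Filter.Eventually.of_forall fun y ↦ ?_)).trans h1
    rw [pderiv, one_mul]
    exact ((fderiv ℝ v y).le_opNorm _).trans_eq (by simp)
  have hpp : ∀ i j, ∀ y ∈ O, pderiv i (pderiv j v) y =
      fderiv ℝ (fderiv ℝ v) y (EuclideanSpace.single i 1) (EuclideanSpace.single j 1) := by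
    intro i j y hy
    have hd : DifferentiableAt ℝ (fderiv ℝ v) y :=
      ((hu.fderiv_of_isOpen hO (m := ∞) (by simp)).contDiffAt (hO.mem_nhds hy)).differentiableAt
        (by simp)
    have := (hd.hasFDerivAt.clm_apply
      (hasFDerivAt_const (EuclideanSpace.single j (1 : ℝ) : Plane) y)).fderiv
    change fderiv ℝ (fun z ↦ fderiv ℝ v z (EuclideanSpace.single j 1)) y _ = _
    rw [this]
    simp
  have hv2 : ∀ i j, pderiv i (pderiv j v) =O[𝓝[O] y₀] (fun _ ↦ (1 : ℝ)) := by
    intro i j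
    refine (IsBigO.of_bound 1 ?_).trans h2
    filter_upwards [self_mem_nhdsWithin] with y hy
    rw [hpp i j y hy, one_mul]
    exact (ContinuousLinearMap.le_opNorm₂ _ _ _).trans_eq (by simp)
  have hform : ∀ y ∈ O, chartLaplacian e u y = (areaDensity e y)⁻¹ * ∑ i, ∑ j,
      (a i j y * pderiv i (pderiv j v) y + pderiv j v y * pderiv i (a i j) y) := by
    intro y hy
    rw [chartLaplacian]
    congr 1
    refine Finset.sum_congr rfl fun i _ ↦ ?_
    have hfl : chartFlux e u i = fun z ↦ ∑ j, a i j z * pderiv j v z := by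
      ext z
      simp only [chartFlux, a, Finset.mul_sum, mul_assoc]
      rfl
    have hda : ∀ j, DifferentiableAt ℝ (a i j) y := fun j ↦
      ((hac i j).contDiffAt (e.open_target.mem_nhds (hOe hy))).differentiableAt (by simp)
    have hdv : ∀ j, DifferentiableAt ℝ (pderiv j v) y := fun j ↦
      ((contDiffOn_pderiv hO hu j).contDiffAt (hO.mem_nhds hy)).differentiableAt (by simp)
    rw [hfl, pderiv, fderiv_fun_sum fun j _ ↦ (hda j).fun_mul (hdv j),
      sum_apply]
    refine Finset.sum_congr rfl fun j _ ↦ ?_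
    rw [fderiv_fun_mul (hda j) (hdv j)]
    rfl
  have hinv : (fun y ↦ (areaDensity e y)⁻¹) =O[𝓝[O] y₀] (fun _ ↦ (1 : ℝ)) :=
    isBigO_one_of_contDiffOn e.open_target
      (he.contDiffOn_areaDensity.inv fun _ hy ↦ (he.areaDensity_pos hy).ne') hy₀
  have hmul : ∀ {f g : Plane → ℝ}, f =O[𝓝[O] y₀] (fun _ ↦ (1 : ℝ)) →
      g =O[𝓝[O] y₀] (fun _ ↦ (1 : ℝ)) → (fun y ↦ f y * g y) =O[𝓝[O] y₀] (fun _ ↦ (1 : ℝ)) := by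
    intro f g hf hg
    simpa using hf.mul hg
  have hmain := hmul hinv (IsBigO.sum (s := Finset.univ) fun i _ ↦
    IsBigO.sum (s := Finset.univ) fun j _ ↦
      (hmul (isBigO_one_of_contDiffOn e.open_target (hac i j) hy₀) (hv2 i j)).add
      (hmul (hv1 j) (isBigO_one_of_contDiffOn e.open_target
        (contDiffOn_pderiv e.open_target (hac i j) i) hy₀)))
  refine hmain.congr' ?_ Filter.EventuallyEq.rfl
  filter_upwards [self_mem_nhdsWithin] with y hy using (hform y hy).symm

variable [MeasurableSpace M] [BorelSpace M] [SecondCountableTopology M] [T2Space M]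

/-- The Laplacian of a function which is smooth up to the boundary of a relatively compact open
set is bounded. -/
theorem exists_bound_laplaceBeltrami {Ω : Set M} (hΩ : IsOpen Ω) (hΩc : IsCompact (closure Ω))
    (hu : ContMDiffOn (𝓡 2) 𝓘(ℝ, ℝ) ∞ u (closure Ω)) :
    ∃ C, ∀ x ∈ Ω, |laplaceBeltrami u x| ≤ C := by
  have huΩ := hu.mono subset_closure
  suffices h : ∃ C, ∀ x ∈ closure Ω ∩ Ω, |laplaceBeltrami u x| ≤ C by
    obtain ⟨C, hC⟩ := h
    exact ⟨C, fun x hx ↦ hC x ⟨subset_closure hx, hx⟩⟩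
  refine hΩc.induction_on (p := fun S ↦ ∃ C, ∀ x ∈ S ∩ Ω, |laplaceBeltrami u x| ≤ C)
    ⟨0, by simp⟩ (fun S T hST ⟨C, hC⟩ ↦ ⟨C, fun x hx ↦ hC x ⟨hST hx.1, hx.2⟩⟩) ?_ ?_
  · rintro S T ⟨C, hC⟩ ⟨C', hC'⟩
    refine ⟨max C C', fun x hx ↦ ?_⟩
    rcases hx.1 with h | h
    · exact (hC x ⟨h, hx.2⟩).trans (le_max_left _ _)
    · exact (hC' x ⟨h, hx.2⟩).trans (le_max_right _ _)
  · intro p hp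
    have he := isSmoothChart_chartAt (M := M) p
    set e := chartAt Plane p with hedef
    have hpe : p ∈ e.source := mem_chart_source Plane p
    set O := e.target ∩ e.symm ⁻¹' Ω with hOdef
    have hO : IsOpen O := e.isOpen_inter_preimage_symm hΩ
    have hpD : e p ∈ e.target ∩ e.symm ⁻¹' closure Ω :=
      ⟨e.map_source hpe, by simpa [e.left_inv hpe] using hp⟩
    have hcd : ContDiffWithinAt ℝ 2 (fun z ↦ u (e.symm z)) (e.target ∩ e.symm ⁻¹' closure Ω)
        (e p) := ((he.contDiffOn_comp_symm (n := ⊤) hu) _ hpD).of_le ENat.LEInfty.out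
    obtain ⟨h1, h2⟩ := isBigO_one_fderiv_of_contDiffWithinAt hO
      (Set.inter_subset_inter_right _ (Set.preimage_mono subset_closure)) hpD hcd
    obtain ⟨C, hC⟩ := (he.isBigO_one_chartLaplacian hO Set.inter_subset_left
      (he.contDiffOn_comp_symm (n := ⊤) huΩ) hpD.1 h1 h2).bound
    rw [eventually_nhdsWithin_iff] at hC
    have hev := (e.continuousAt hpe).eventually hC
    refine ⟨{x | x ∈ e.source ∧ (e x ∈ O → ‖chartLaplacian e u (e x)‖ ≤ C * ‖(1 : ℝ)‖)},
      mem_nhdsWithin_of_mem_nhds ((e.open_source.eventually_mem hpe).and hev), C, ?_⟩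
    rintro x ⟨⟨hxe, hx⟩, hxΩ⟩
    rw [he.laplaceBeltrami_eq hΩ huΩ hxe hxΩ]
    simpa using hx ⟨e.map_source hxe, by simpa [e.left_inv hxe] using hxΩ⟩

end Bound

/-! ### Monotonicity from increments, and the differential inequality. -/

section DistributionFunction

/-- A function whose increment over each interval of length `h` is bounded both by `C₁ h` and by
`C₂ (h + Δβ)²`, for some bounded function `β`, does not increase. -/
theorem le_of_increment_le {Ψ β : ℝ → ℝ} {A B C₁ C₂ : ℝ} (hAB : A < B) (hC₁ : 0 ≤ C₁)
    (hC₂ : 0 ≤ C₂) (hmono : ∀ a b, A ≤ a → a < b → b ≤ B → β a ≤ β b)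
    (h₁ : ∀ a b, A ≤ a → a < b → b ≤ B → Ψ b - Ψ a ≤ C₁ * (b - a))
    (h₂ : ∀ a b, A ≤ a → a < b → b ≤ B → Ψ b - Ψ a ≤ C₂ * (b - a + (β b - β a)) ^ 2) :
    Ψ B ≤ Ψ A := by
  -- Geometric mean of the two bounds: linear in `h + Δβ`, hence summable by telescoping, with a
  -- prefactor tending to zero with the mesh. The quadratic bound alone would not suffice if `β` had
  -- jumps.
  have hinc : ∀ a b, A ≤ a → a < b → b ≤ B →
      Ψ b - Ψ a ≤ √(C₁ * C₂ * (b - a)) * (b - a + (β b - β a)) := by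
    intro a b ha hab hb
    have hx : 0 ≤ β b - β a := sub_nonneg.2 (hmono a b ha hab hb)
    have hh : 0 < b - a := sub_pos.2 hab
    rcases le_total (Ψ b - Ψ a) 0 with h | h
    · exact h.trans (by positivity)
    · refine le_of_sq_le_sq ?_ (by positivity)
      rw [mul_pow, Real.sq_sqrt (by positivity), sq]
      calc (Ψ b - Ψ a) * (Ψ b - Ψ a)
          ≤ (C₁ * (b - a)) * (C₂ * (b - a + (β b - β a)) ^ 2) :=
            mul_le_mul (h₁ a b ha hab hb) (h₂ a b ha hab hb) h (by positivity)
        _ = _ := by ring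
  set L := B - A with hL
  have hL0 : 0 < L := sub_pos.2 hAB
  -- Sum over the partition into `n + 1` equal intervals; the increments of `t + β t` telescope.
  have hN : ∀ n : ℕ, Ψ B - Ψ A ≤ √(C₁ * C₂ * (L / (n + 1))) * (L + (β B - β A)) := by
    intro n
    have hn : (0 : ℝ) < n + 1 := by positivity
    set τ : ℕ → ℝ := fun i ↦ A + i * (L / (n + 1)) with hτ
    have hτs : ∀ i, τ (i + 1) - τ i = L / (n + 1) := fun i ↦ by simp only [hτ]; push_cast; ring
    have hτ0 : τ 0 = A := by simp [hτ]
    have hτN : τ (n + 1) = B := by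
      simp only [hτ, hL]; push_cast; field_simp; ring
    have hτA : ∀ i, A ≤ τ i := fun i ↦ by
      simp only [hτ]
      linarith [show 0 ≤ i * (L / (n + 1)) by positivity]
    have hτB : ∀ i, i ≤ n + 1 → τ i ≤ B := by
      intro i hi
      rw [← hτN]
      simp only [hτ]
      gcongr
    have h1 := Finset.sum_range_sub (fun i ↦ Ψ (τ i)) (n + 1)
    have h2 := Finset.sum_range_sub (fun i ↦ τ i + β (τ i)) (n + 1)
    rw [hτ0, hτN] at h1 h2
    rw [← h1]
    calc ∑ i ∈ Finset.range (n + 1), (Ψ (τ (i + 1)) - Ψ (τ i))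
        ≤ ∑ i ∈ Finset.range (n + 1), √(C₁ * C₂ * (L / (n + 1))) *
          (τ (i + 1) + β (τ (i + 1)) - (τ i + β (τ i))) := by
          refine Finset.sum_le_sum fun i hi ↦ ?_
          have hi' := Finset.mem_range.1 hi
          have hlt : τ i < τ (i + 1) := by
            have := hτs i
            have : 0 < L / (n + 1) := by positivity
            linarith
          have := hinc (τ i) (τ (i + 1)) (hτA i) hlt (hτB _ hi')
          rw [hτs i] at this
          refine this.trans_eq ?_
          rw [← hτs i]; ring
      _ = √(C₁ * C₂ * (L / (n + 1))) * (L + (β B - β A)) := by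
          rw [← Finset.mul_sum, h2, hL]; ring
  have hlim : Filter.Tendsto (fun n : ℕ ↦ √(C₁ * C₂ * (L / (n + 1))) * (L + (β B - β A)))
      Filter.atTop (𝓝 (√(C₁ * C₂ * (L * 0)) * (L + (β B - β A)))) := by
    refine Filter.Tendsto.mul_const _ (Filter.Tendsto.sqrt (Filter.Tendsto.const_mul _ ?_))
    simp only [div_eq_mul_inv]
    refine Filter.Tendsto.const_mul _ ?_
    simpa using tendsto_one_div_add_atTop_nhds_zero_nat (𝕜 := ℝ)
  have := ge_of_tendsto' hlim hN
  simp at this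
  exact this

set_option maxHeartbeats 1000000 in
/-- The differential inequality for distribution functions, in integrated form. The functions
`β` and `α` play the roles of the areas of the sublevel sets of `u` with respect to the measures
`μ` and `e²ᵘ μ`. -/
theorem bol_of_increments {β α : ℝ → ℝ} {c κ lam p m C A B : ℝ} (hc : 0 ≤ c) (hC : 0 ≤ C)
    (hAB : A < B) (hB : B < 0) (hβ : ∀ t ≤ B, 0 ≤ β t ∧ β t ≤ m)
    (hα : ∀ t ≤ B, 0 ≤ α t ∧ α t ≤ m)
    (hmono : ∀ a b, a < b → b ≤ B → β a ≤ β b)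
    (hαl : ∀ a b, a < b → b ≤ B → Real.exp (2 * a) * (β b - β a) ≤ α b - α a)
    (hαr : ∀ a b, a < b → b ≤ B → α b - α a ≤ Real.exp (2 * b) * (β b - β a))
    (hP : ∀ t ≤ B, 0 ≤ κ * β t - lam * α t + p)
    (hkey : ∀ a b, a < b → b ≤ B →
      (b - a) * (c * β b - κ * β b ^ 2 - C * (β b - β a)) ≤
        (β b - β a) * (κ * β a - lam * α a + p + C * (β b - β a))) :
    Real.exp (2 * B) * (c * β B - κ * β B ^ 2) - (c + 2 * p) * α B + lam * α B ^ 2 ≤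
      Real.exp (2 * A) * (c * β A - κ * β A ^ 2) - (c + 2 * p) * α A + lam * α A ^ 2 := by
  have hm : 0 ≤ m := (hβ B le_rfl).1.trans (hβ B le_rfl).2
  set K := c + 2 * |κ| * m with hK
  set P := |κ| * m + |lam| * m + |p| with hPdef
  have hK0 : 0 ≤ K := by positivity
  have hP0 : 0 ≤ P := by positivity
  have hexp : ∀ a b : ℝ, Real.exp (2 * b) - Real.exp (2 * a) ≤ 2 * (b - a) * Real.exp (2 * b) := by
    intro a b
    have h1 := Real.add_one_le_exp (2 * a - 2 * b)
    have h2 : Real.exp (2 * a) = Real.exp (2 * a - 2 * b) * Real.exp (2 * b) := by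
      rw [← Real.exp_add]; ring_nf
    have h3 := Real.exp_pos (2 * b)
    rw [h2]
    nlinarith
  have hbnd : ∀ t ≤ B, ∀ s ≤ B, |c - κ * (β s + β t)| ≤ K := by
    intro t ht s hs
    have h1 : |κ * (β s + β t)| ≤ |κ| * (2 * m) := by
      rw [abs_mul]
      refine mul_le_mul_of_nonneg_left ?_ (abs_nonneg _)
      rw [abs_of_nonneg (add_nonneg (hβ s hs).1 (hβ t ht).1)]
      linarith [(hβ s hs).2, (hβ t ht).2]
    calc |c - κ * (β s + β t)| ≤ |c| + |κ * (β s + β t)| := abs_sub _ _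
      _ ≤ K := by rw [abs_of_nonneg hc, hK]; linarith
  -- Discrete form of `Ψ' = (e²ᵗ)' Q - 2 P α'`. The terms `e²ᵗ β' (c - 2κβ)` and `α' (c - 2κβ)`
  -- cancel in the limit; here their difference is the error `2K (b - a)(β b - β a)`.
  have hmain : ∀ a b, a < b → b ≤ B →
      (Real.exp (2 * b) * (c * β b - κ * β b ^ 2) - (c + 2 * p) * α b + lam * α b ^ 2) -
        (Real.exp (2 * a) * (c * β a - κ * β a ^ 2) - (c + 2 * p) * α a + lam * α a ^ 2) ≤
      (Real.exp (2 * b) - Real.exp (2 * a)) * (c * β b - κ * β b ^ 2) -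
        ((κ * β a - lam * α a + p) + (κ * β b - lam * α b + p)) * (α b - α a) +
        2 * K * ((b - a) * (β b - β a)) := by
    intro a b hab hb
    have hx : 0 ≤ β b - β a := sub_nonneg.2 (hmono a b hab hb)
    have heb : Real.exp (2 * b) ≤ 1 := Real.exp_le_one_iff.2 (by linarith)
    have h1 : |Real.exp (2 * a) * (β b - β a) - (α b - α a)| ≤ 2 * ((b - a) * (β b - β a)) := by
      rw [abs_of_nonpos (by linarith [hαl a b hab hb])]
      have h2 : (Real.exp (2 * b) - Real.exp (2 * a)) * (β b - β a) ≤
          2 * (b - a) * (β b - β a) :=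
        mul_le_mul_of_nonneg_right ((hexp a b).trans (by nlinarith)) hx
      linarith [hαr a b hab hb]
    have h3 : (Real.exp (2 * a) * (β b - β a) - (α b - α a)) * (c - κ * (β a + β b)) ≤
        2 * ((b - a) * (β b - β a)) * K := by
      refine (le_abs_self _).trans ?_
      rw [abs_mul]
      exact mul_le_mul h1 (hbnd b hb a (by linarith)) (abs_nonneg _)
        (mul_nonneg two_pos.le (mul_nonneg (by linarith) hx))
    linarith
  have hQle : ∀ t ≤ B, c * β t - κ * β t ^ 2 ≤ K * m := by
    intro t ht
    obtain ⟨h1, h2⟩ := hβ t ht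
    have h3 : -κ * β t ^ 2 ≤ |κ| * m ^ 2 :=
      mul_le_mul (neg_le_abs κ) (pow_le_pow_left₀ h1 h2 2) (by positivity) (abs_nonneg _)
    have h4 : c * β t ≤ c * m := mul_le_mul_of_nonneg_left h2 hc
    have h5 : 0 ≤ |κ| * m ^ 2 := by positivity
    rw [hK]
    linarith
  refine le_of_increment_le (β := β) (C₁ := 4 * K * m)
    (C₂ := 2 * K + 2 * C + (|κ| + |lam|) + 4 * P)
    (Ψ := fun t ↦ Real.exp (2 * t) * (c * β t - κ * β t ^ 2) - (c + 2 * p) * α t + lam * α t ^ 2)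
    hAB (by positivity) (by positivity) (fun a b _ ↦ hmono a b) ?_ ?_
  -- The bound linear in `b - a` drops the terms with `P`, which are nonnegative by `hP`, and does
  -- not use `hkey`.
  · intro a b _ hab hb
    refine (hmain a b hab hb).trans ?_
    have hx : 0 ≤ β b - β a := sub_nonneg.2 (hmono a b hab hb)
    have heb : Real.exp (2 * b) ≤ 1 := Real.exp_le_one_iff.2 (by linarith)
    have hpos : 0 ≤ Real.exp (2 * b) - Real.exp (2 * a) :=
      sub_nonneg.2 (Real.exp_le_exp.2 (by linarith))
    have h1 : (Real.exp (2 * b) - Real.exp (2 * a)) * (c * β b - κ * β b ^ 2) ≤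
        2 * (b - a) * (K * m) :=
      mul_le_mul_of_nonneg_left (hQle b hb) hpos |>.trans
        (mul_le_mul_of_nonneg_right ((hexp a b).trans (by nlinarith)) (by positivity))
    have h2 : 0 ≤ ((κ * β a - lam * α a + p) + (κ * β b - lam * α b + p)) * (α b - α a) :=
      mul_nonneg (add_nonneg (hP a (by linarith)) (hP b hb))
        ((mul_nonneg (Real.exp_pos _).le hx).trans (hαl a b hab hb))
    have h3 : (b - a) * (β b - β a) ≤ (b - a) * m :=
      mul_le_mul_of_nonneg_left (by linarith [(hβ b hb).2, (hβ a (by linarith)).1]) (by linarith)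
    have h4 := mul_le_mul_of_nonneg_left h3 hK0
    linarith
  · intro a b _ hab hb
    refine (hmain a b hab hb).trans ?_
    set x := β b - β a with hxdef
    set y := α b - α a with hydef
    set h := b - a with hhdef
    have hh : 0 < h := sub_pos.2 hab
    have hx : 0 ≤ x := sub_nonneg.2 (hmono a b hab hb)
    have heb : Real.exp (2 * b) ≤ 1 := Real.exp_le_one_iff.2 (by linarith)
    have hpos : 0 ≤ Real.exp (2 * b) - Real.exp (2 * a) :=
      sub_nonneg.2 (Real.exp_le_exp.2 (by linarith))
    have hPa := hP a (by linarith)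
    have hPb := hP b hb
    have hyl := hαl a b hab hb
    have hyr := hαr a b hab hb
    have hy0 : 0 ≤ y := (mul_nonneg (Real.exp_pos _).le hx).trans hyl
    have hyx : y ≤ x := hyr.trans (mul_le_of_le_one_left hx heb)
    have hhx : h * x ≤ (h + x) ^ 2 := by nlinarith [sq_nonneg h, sq_nonneg x]
    have hxx : x ^ 2 ≤ (h + x) ^ 2 := pow_le_pow_left₀ hx (by linarith) 2
    have hxh : x ^ 2 + h * x ≤ (h + x) ^ 2 := by nlinarith [mul_nonneg hh.le hx]
    have hS : 0 ≤ (h + x) ^ 2 := sq_nonneg _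
    have hKx : 2 * K * (h * x) ≤ 2 * K * (h + x) ^ 2 :=
      mul_le_mul_of_nonneg_left hhx (by positivity)
    -- The quadratic bound. If `Q ≤ 0`, the main terms already have the right sign; otherwise `hkey`
    -- trades `h Q` for `x Pa`, which cancels against `2 y Pa` up to terms quadratic in `h + x`.
    rcases le_total (c * β b - κ * β b ^ 2) 0 with hQ | hQ
    · have h1 := mul_nonpos_of_nonneg_of_nonpos hpos hQ
      have h2 := mul_nonneg (add_nonneg hPa hPb) hy0
      have h3 : 0 ≤ (2 * C + (|κ| + |lam|) + 4 * P) * (h + x) ^ 2 := by positivity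
      linarith
    · have hPaP : κ * β a - lam * α a + p ≤ P := by
        obtain ⟨ha1, ha2⟩ := hβ a (by linarith)
        obtain ⟨ha3, ha4⟩ := hα a (by linarith)
        have h1 : κ * β a ≤ |κ| * m := mul_le_mul (le_abs_self _) ha2 ha1 (abs_nonneg _)
        have h2 : -lam * α a ≤ |lam| * m := mul_le_mul (neg_le_abs _) ha4 ha3 (abs_nonneg _)
        have h3 := le_abs_self p
        rw [hPdef]; linarith
      set Pa := κ * β a - lam * α a + p with hPadef
      have hPbPa : κ * β b - lam * α b + p = Pa + (κ * x - lam * y) := by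
        rw [hPadef, hxdef, hydef]; ring
      have hdiff : -(κ * x - lam * y) * y ≤ (|κ| + |lam|) * x ^ 2 := by
        have h1 : -κ * (x * y) ≤ |κ| * x ^ 2 :=
          mul_le_mul (neg_le_abs _) (by nlinarith) (by positivity) (abs_nonneg _)
        have h2 : lam * y ^ 2 ≤ |lam| * x ^ 2 :=
          mul_le_mul (le_abs_self _) (pow_le_pow_left₀ hy0 hyx 2) (by positivity) (abs_nonneg _)
        linarith
      have hk := hkey a b hab hb
      have h1 : (Real.exp (2 * b) - Real.exp (2 * a)) * (c * β b - κ * β b ^ 2) ≤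
          2 * Real.exp (2 * b) * (h * (c * β b - κ * β b ^ 2)) :=
        (mul_le_mul_of_nonneg_right (hexp a b) hQ).trans_eq (by ring)
      have h2 : 2 * Real.exp (2 * b) * (h * (c * β b - κ * β b ^ 2)) ≤
          2 * Real.exp (2 * b) * (x * Pa) + 2 * C * (x ^ 2 + h * x) := by
        have h3 : h * (c * β b - κ * β b ^ 2) ≤ x * Pa + C * (x ^ 2 + h * x) := by linarith
        have h4 : 2 * Real.exp (2 * b) * (C * (x ^ 2 + h * x)) ≤ 2 * 1 * (C * (x ^ 2 + h * x)) :=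
          mul_le_mul_of_nonneg_right (by linarith) (by positivity)
        have h5 := mul_le_mul_of_nonneg_left h3
          (show 0 ≤ 2 * Real.exp (2 * b) by positivity)
        linarith
      have h3 : Real.exp (2 * a) * x * Pa ≤ y * Pa := mul_le_mul_of_nonneg_right hyl hPa
      have h4 : (Real.exp (2 * b) - Real.exp (2 * a)) * (x * Pa) ≤ 2 * h * (x * P) :=
        mul_le_mul ((hexp a b).trans (by rw [← hhdef]; nlinarith))
          (mul_le_mul_of_nonneg_left hPaP hx) (mul_nonneg hx hPa) (by positivity)
      have h5 : 4 * P * (h * x) ≤ 4 * P * (h + x) ^ 2 :=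
        mul_le_mul_of_nonneg_left hhx (by positivity)
      have h6 : (|κ| + |lam|) * x ^ 2 ≤ (|κ| + |lam|) * (h + x) ^ 2 :=
        mul_le_mul_of_nonneg_left hxx (by positivity)
      have h7 : 2 * C * (x ^ 2 + h * x) ≤ 2 * C * (h + x) ^ 2 :=
        mul_le_mul_of_nonneg_left hxh (by positivity)
      rw [hPbPa]
      linarith

end DistributionFunction

/-! ### Sublevel sets as compact smooth domains. -/

section Sublevel

variable {M : Type*} [TopologicalSpace M] [ChartedSpace Plane M] [IsManifold (𝓡 2) ∞ M]
  {u : M → ℝ} {Ω : Set M}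

/-- A negative level cannot reach the boundary, where `u` is zero; so intersecting with `closure Ω`
instead of `Ω` changes nothing. -/
theorem isCompact_sublevel (hΩ : IsOpen Ω) (hΩc : IsCompact (closure Ω))
    (hu : ContinuousOn u (closure Ω)) (hbd : ∀ x ∈ frontier Ω, u x = 0) {t : ℝ} (ht : t < 0) :
    IsCompact {x ∈ Ω | u x ≤ t} := by
  have h : {x ∈ Ω | u x ≤ t} = closure Ω ∩ u ⁻¹' Set.Iic t := by
    ext x
    refine ⟨fun hx ↦ ⟨subset_closure hx.1, hx.2⟩, fun hx ↦ ⟨?_, hx.2⟩⟩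
    by_contra hxΩ
    have h0 : u x = 0 := hbd x (by rw [hΩ.frontier_eq]; exact ⟨hx.1, hxΩ⟩)
    have h1 : u x ≤ t := hx.2
    linarith
  rw [h]
  exact hΩc.of_isClosed_subset (hu.preimage_isClosed_of_isClosed isClosed_closure isClosed_Iic)
    Set.inter_subset_left

theorem frontier_sublevel_subset (hΩ : IsOpen Ω) (hu : ContinuousOn u Ω) {t : ℝ}
    (hcl : IsClosed {x ∈ Ω | u x ≤ t}) :
    frontier {x ∈ Ω | u x ≤ t} ⊆ {x ∈ Ω | u x = t} := by
  intro x hx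
  rw [hcl.frontier_eq] at hx
  refine ⟨hx.1.1, le_antisymm hx.1.2 (not_lt.1 fun hlt ↦ hx.2 ?_)⟩
  refine mem_interior.2 ⟨Ω ∩ u ⁻¹' Set.Iio t, fun y hy ↦ ⟨hy.1, le_of_lt hy.2⟩,
    hu.isOpen_inter_preimage hΩ isOpen_Iio, hx.1.1, hlt⟩

/-- The sublevel sets of regular values are compact smooth domains. -/
theorem isCompactSmoothDomain_sublevel (hΩ : IsOpen Ω)
    (hu : ContMDiffOn (𝓡 2) 𝓘(ℝ, ℝ) ∞ u Ω) {t : ℝ} [T2Space M]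
    (hc : IsCompact {x ∈ Ω | u x ≤ t})
    (ht : t ∉ u '' {x ∈ Ω | mfderiv (𝓡 2) 𝓘(ℝ, ℝ) u x = 0}) :
    IsCompactSmoothDomain {x ∈ Ω | u x ≤ t} := by
  refine ⟨hc, fun p hp ↦ ?_⟩
  obtain ⟨hpΩ, hpt⟩ := frontier_sublevel_subset hΩ hu.continuousOn hc.isClosed hp
  have hmf : ∀ q ∈ Ω, mfderiv (𝓡 2) 𝓘(ℝ, ℝ) (fun x ↦ u x - t) q = mfderiv (𝓡 2) 𝓘(ℝ, ℝ) u q := by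
    intro q hq
    have h1 := (mdifferentiableAt_of_contMDiffOn hΩ hu hq).hasMFDerivAt
    have h2 := h1.sub (hasMFDerivAt_const t q)
    exact h2.mfderiv.trans (sub_zero _)
  refine ⟨{x ∈ Ω | mfderiv (𝓡 2) 𝓘(ℝ, ℝ) u x ≠ 0}, isOpen_regular hΩ hu,
    ⟨hpΩ, fun h0 ↦ ht ⟨p, ⟨hpΩ, h0⟩, hpt⟩⟩, fun x ↦ u x - t, ?_, ?_, ?_⟩
  · exact (hu.mono fun x hx ↦ hx.1).sub contMDiffOn_const
  · intro q hq
    rw [hmf q hq.1]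
    exact hq.2
  · ext q
    simp only [Set.mem_inter_iff, Set.mem_ofPred_eq, sub_nonpos]
    tauto

end Sublevel

/-! ### The energy of `u` between two levels. -/

section Energy

variable {M : Type*} [TopologicalSpace M] [ChartedSpace Plane M] [IsManifold (𝓡 2) ∞ M]
  [RiemannianBundle (fun x : M ↦ TangentSpace (𝓡 2) x)]
  [IsContMDiffRiemannianBundle (𝓡 2) ∞ Plane (fun x : M ↦ TangentSpace (𝓡 2) x)]
  [MeasurableSpace M] [BorelSpace M] [SecondCountableTopology M] [T2Space M]
  {u : M → ℝ} {Ω : Set M}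

/-- Green's formula for a compactly supported function of `u`. -/
theorem setIntegral_comp_mul_laplaceBeltrami (hΩ : IsOpen Ω)
    (hu : ContMDiffOn (𝓡 2) 𝓘(ℝ, ℝ) ∞ u Ω) {b : ℝ} (hc : IsCompact {x ∈ Ω | u x ≤ b})
    {T : ℝ → ℝ} (hT : ContDiff ℝ ∞ T) (hT0 : ∀ s, b < s → T s = 0) :
    ∫ x in Ω, T (u x) * laplaceBeltrami u x ∂area M =
      - ∫ x in Ω, deriv T (u x) * gradInner u u x ∂area M := by
  set Φ : M → ℝ := Ω.indicator fun x ↦ T (u x) with hΦdef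
  have heq : ∀ x ∈ Ω, Φ =ᶠ[𝓝 x] fun z ↦ T (u z) := fun x hx ↦ by
    filter_upwards [hΩ.mem_nhds hx] with z hz using Set.indicator_of_mem hz _
  have hzero : ∀ x, x ∉ {x ∈ Ω | u x ≤ b} → Φ x = 0 := by
    intro x hx
    by_cases hxΩ : x ∈ Ω
    · rw [hΦdef, Set.indicator_of_mem hxΩ]
      exact hT0 _ (not_le.1 fun h ↦ hx ⟨hxΩ, h⟩)
    · exact Set.indicator_of_notMem hxΩ _
  have hsupp : tsupport Φ ⊆ {x ∈ Ω | u x ≤ b} :=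
    closure_minimal (fun x hx ↦ by_contra fun h ↦ hx (hzero x h)) hc.isClosed
  have hΦ : ContMDiff (𝓡 2) 𝓘(ℝ, ℝ) ∞ Φ := by
    intro x
    by_cases hx : x ∈ Ω
    · refine ContMDiffAt.congr_of_eventuallyEq ?_ (heq x hx)
      exact (hT.contMDiff.contMDiffAt).comp x (hu.contMDiffAt (hΩ.mem_nhds hx))
    · refine ContMDiffAt.congr_of_eventuallyEq (contMDiffAt_const (c := (0 : ℝ))) ?_
      filter_upwards [hc.isClosed.isOpen_compl.mem_nhds (fun h : x ∈ {x ∈ Ω | u x ≤ b} ↦ hx h.1)]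
        with z hz using hzero z hz
  have hg := setIntegral_mul_laplaceBeltrami hΩ hu hΦ
    (hc.of_isClosed_subset (isClosed_tsupport _) hsupp) (hsupp.trans fun x hx ↦ hx.1)
  rw [setIntegral_congr_fun hΩ.measurableSet fun x hx ↦ (by
      rw [hΦdef, Set.indicator_of_mem hx] :
      Φ x * laplaceBeltrami u x = T (u x) * laplaceBeltrami u x)] at hg
  rw [hg]
  congr 1
  refine setIntegral_congr_fun hΩ.measurableSet fun x hx ↦ ?_
  rw [gradInner_congr (heq x hx), gradInner_comp (mdifferentiableAt_of_contMDiffOn hΩ hu hx)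
    (hT.differentiable (by simp) _)]

theorem integrableOn_of_continuousOn_of_bound {F : M → ℝ} {C : ℝ} (hΩ : IsOpen Ω)
    (hfin : area M Ω ≠ ⊤) (hF : ContinuousOn F Ω) (hC : ∀ x ∈ Ω, |F x| ≤ C) :
    IntegrableOn F Ω (area M) :=
  IntegrableOn.of_bound hfin.lt_top (hF.aestronglyMeasurable hΩ.measurableSet) C
    ((ae_restrict_iff' hΩ.measurableSet).2 (Filter.Eventually.of_forall hC))

theorem measurableSet_sublevel (hΩ : IsOpen Ω) (hu : ContinuousOn u Ω) (t : ℝ) :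
    MeasurableSet {x ∈ Ω | u x ≤ t} := by
  have h1 := hu.isOpen_inter_preimage hΩ (isOpen_Ioi (a := t))
  have h2 : {x ∈ Ω | u x ≤ t} = Ω \ (Ω ∩ u ⁻¹' Set.Ioi t) := by
    ext x; simp
  rw [h2]
  exact hΩ.measurableSet.diff h1.measurableSet

/-- The energy of `u` between the levels `a` and `b`. -/
theorem setIntegral_comp_mul_gradInner_le (hΩ : IsOpen Ω) (hfin : area M Ω ≠ ⊤)
    (hu : ContMDiffOn (𝓡 2) 𝓘(ℝ, ℝ) ∞ u Ω) {a b C : ℝ} (hab : a < b)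
    (hc : IsCompact {x ∈ Ω | u x ≤ b}) (hC : ∀ x ∈ Ω, |laplaceBeltrami u x| ≤ C)
    {ψ : ℝ → ℝ} (hψ : ContDiff ℝ ∞ ψ) (hψ0 : ∀ s, 0 ≤ ψ s) (hψs : ∀ s, s ∉ Set.Ioo a b → ψ s = 0) :
    IntegrableOn (fun x ↦ ψ (u x) * gradInner u u x) Ω (area M) ∧
    ∫ x in Ω, ψ (u x) * gradInner u u x ∂area M ≤
      (∫ s in a..b, ψ s) * (∫ x in {x ∈ Ω | u x ≤ a}, laplaceBeltrami u x ∂area M +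
        C * ((area M).real {x ∈ Ω | u x ≤ b} - (area M).real {x ∈ Ω | u x ≤ a})) := by
  have hψc := hψ.continuous
  have hint : ∀ c d, IntervalIntegrable ψ volume c d := fun c d ↦ hψc.intervalIntegrable c d
  set I := ∫ s in a..b, ψ s with hI
  -- This is the primitive `∫_s^b ψ`. As a function of `u` it equals the constant `I` on `{u ≤ a}`
  -- and vanishes above `b`, so Green's formula yields `I` times the flux plus a contribution of the
  -- strip, where only `|Δu| ≤ C` is used.
  set T : ℝ → ℝ := fun s ↦ I - ∫ r in a..s, ψ r with hTdef
  have hTd : ∀ s, HasDerivAt T (-ψ s) s := fun s ↦ by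
    simpa using (intervalIntegral.integral_hasDerivAt_right (hint a s)
      (hψc.stronglyMeasurableAtFilter _ _) hψc.continuousAt).const_sub I
  have hTderiv : deriv T = fun s ↦ -ψ s := funext fun s ↦ (hTd s).deriv
  have hT : ContDiff ℝ ∞ T := by
    rw [contDiff_infty_iff_deriv]
    refine ⟨fun s ↦ (hTd s).differentiableAt, ?_⟩
    rw [hTderiv]
    exact hψ.neg
  have hTb : ∀ s, T s = ∫ r in s..b, ψ r := fun s ↦ by
    simp only [hTdef, hI]
    rw [← intervalIntegral.integral_add_adjacent_intervals (hint a s) (hint s b)]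
    ring
  have hTzero : ∀ s, b < s → T s = 0 := fun s hs ↦ by
    rw [hTb, intervalIntegral.integral_symm, neg_eq_zero]
    refine intervalIntegral.integral_zero_ae (Filter.Eventually.of_forall fun r hr ↦ hψs r ?_)
    rw [Set.uIoc_of_le hs.le] at hr
    exact fun h ↦ absurd h.2 (not_lt.2 hr.1.le)
  have hTa : ∀ s, s ≤ a → T s = I := fun s hs ↦ by
    simp only [hTdef, sub_eq_self]
    rw [intervalIntegral.integral_symm, neg_eq_zero]
    refine intervalIntegral.integral_zero_ae (Filter.Eventually.of_forall fun r hr ↦ hψs r ?_)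
    rw [Set.uIoc_of_le hs] at hr
    exact fun h ↦ absurd h.1 (not_lt.2 hr.2)
  have hTanti : Antitone T := antitone_of_deriv_nonpos (fun s ↦ (hTd s).differentiableAt)
    fun s ↦ by rw [hTderiv]; simpa using hψ0 s
  have hTnn : ∀ s, 0 ≤ T s := fun s ↦ by
    have := hTanti (le_max_left s (b + 1))
    rwa [hTzero _ (lt_of_lt_of_le (by linarith) (le_max_right s (b + 1)))] at this
  have hTI : ∀ s, T s ≤ I := fun s ↦ by
    have := hTanti (min_le_left s a)
    rwa [hTa _ (min_le_right s a)] at this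
  have hI0 : 0 ≤ I := (hTnn 0).trans (hTI 0)
  have hgc := continuousOn_gradInner hΩ hu hu
  have hLc := continuousOn_laplaceBeltrami hΩ hu
  have hLint : IntegrableOn (laplaceBeltrami u) Ω (area M) :=
    integrableOn_of_continuousOn_of_bound hΩ hfin hLc hC
  have hmeas := fun t ↦ measurableSet_sublevel hΩ hu.continuousOn t
  have hsub : ∀ t, {x ∈ Ω | u x ≤ t} ⊆ Ω := fun t x hx ↦ hx.1
  have hgreen := setIntegral_comp_mul_laplaceBeltrami hΩ hu hc hT hTzero
  simp only [hTderiv, neg_mul, integral_neg, neg_neg] at hgreen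
  refine ⟨integrableOn_of_continuousOn_of_eq_zero_off hΩ
    ((hψc.comp_continuousOn hu.continuousOn).mul hgc) hc (hsub b) ?_, ?_⟩
  · intro x hx hxb
    rw [hψs _ fun h ↦ hxb ⟨hx, h.2.le⟩, zero_mul]
  rw [← hgreen]
  have hDab : {x ∈ Ω | u x ≤ a} ⊆ {x ∈ Ω | u x ≤ b} := fun x hx ↦ ⟨hx.1, hx.2.trans hab.le⟩
  have hfinD : ∀ t, area M {x ∈ Ω | u x ≤ t} ≠ ⊤ := fun t ↦ measure_ne_top_of_subset (hsub t) hfin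
  have hpt : ∀ x ∈ Ω, T (u x) * laplaceBeltrami u x ≤
      {x ∈ Ω | u x ≤ a}.indicator (fun x ↦ I * laplaceBeltrami u x) x +
      ({x ∈ Ω | u x ≤ b} \ {x ∈ Ω | u x ≤ a}).indicator (fun _ ↦ I * C) x := by
    intro x hx
    have hCx := hC x hx
    by_cases h1 : u x ≤ a
    · rw [Set.indicator_of_mem (by exact ⟨hx, h1⟩), Set.indicator_of_notMem (fun h ↦ h.2 ⟨hx, h1⟩),
        hTa _ h1, add_zero]
    · rw [Set.indicator_of_notMem (fun h ↦ h1 h.2), zero_add]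
      by_cases h2 : u x ≤ b
      · rw [Set.indicator_of_mem (by exact ⟨⟨hx, h2⟩, fun h ↦ h1 h.2⟩)]
        calc T (u x) * laplaceBeltrami u x ≤ T (u x) * C :=
              mul_le_mul_of_nonneg_left ((le_abs_self _).trans hCx) (hTnn _)
          _ ≤ I * C := mul_le_mul_of_nonneg_right (hTI _) ((abs_nonneg _).trans hCx)
      · rw [Set.indicator_of_notMem (fun h ↦ h2 h.1.2), hTzero _ (not_le.1 h2), zero_mul]
  have hTint : IntegrableOn (fun x ↦ T (u x) * laplaceBeltrami u x) Ω (area M) := by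
    refine integrableOn_of_continuousOn_of_bound (C := I * C) hΩ hfin
      ((hT.continuous.comp_continuousOn hu.continuousOn).mul hLc) fun x hx ↦ ?_
    rw [abs_mul, abs_of_nonneg (hTnn _)]
    exact mul_le_mul (hTI _) (hC x hx) (abs_nonneg _) hI0
  have hi1 : IntegrableOn ({x ∈ Ω | u x ≤ a}.indicator fun x ↦ I * laplaceBeltrami u x) Ω
      (area M) := (hLint.const_mul I).indicator (hmeas a)
  have hmd := (hmeas b).diff (hmeas a)
  have hi2 : IntegrableOn (({x ∈ Ω | u x ≤ b} \ {x ∈ Ω | u x ≤ a}).indicator fun _ ↦ I * C) Ω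
      (area M) := (integrableOn_const hfin).indicator hmd
  refine (setIntegral_mono_on hTint (hi1.add hi2) hΩ.measurableSet hpt).trans_eq ?_
  simp only [Pi.add_apply]
  rw [integral_add hi1 hi2, setIntegral_indicator (hmeas a), setIntegral_indicator hmd,
    Set.inter_eq_self_of_subset_right (hsub a),
    Set.inter_eq_self_of_subset_right (Set.sdiff_subset.trans (hsub b)), integral_const_mul,
    setIntegral_const, measureReal_sdiff hDab (hmeas a) (hfinD b), smul_eq_mul]
  ring

end Energy

/-! ### Cut-offs and the sign of the flux. -/

section LengthArea

/-- Positivity on the whole interval makes the integral of `ψ` nonzero, which gives the sign of the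
flux; the plateau costs only `ε` at each end in the length-area estimate. -/
theorem exists_contDiff_cutoff {a b ε : ℝ} (hε : 0 < ε) (hεb : 2 * ε < b - a) :
    ∃ ψ : ℝ → ℝ, ContDiff ℝ ∞ ψ ∧ (∀ s, 0 ≤ ψ s) ∧ (∀ s, ψ s ≤ 1) ∧
      (∀ s, s ∉ Set.Ioo a b → ψ s = 0) ∧ (∀ s ∈ Set.Ioo a b, 0 < ψ s) ∧
      ∀ s ∈ Set.Ioo (a + ε) (b - ε), ψ s = 1 := by
  let φ : ContDiffBump ((a + b) / 2) := ⟨(b - a) / 2 - ε, (b - a) / 2, by linarith, by linarith⟩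
  have hsupp : Function.support φ = Set.Ioo a b := by
    rw [φ.support_eq, Real.ball_eq_Ioo]
    congr 1 <;> simp only [φ] <;> ring
  refine ⟨φ, φ.contDiff, fun s ↦ φ.nonneg, fun s ↦ φ.le_one,
    fun s hs ↦ Function.notMem_support.1 (hsupp ▸ hs), fun s hs ↦ ?_, fun s hs ↦ ?_⟩
  · exact lt_of_le_of_ne φ.nonneg (Ne.symm (Function.mem_support.1 (hsupp ▸ hs)))
  · refine φ.one_of_mem_closedBall ?_
    rw [Real.closedBall_eq_Icc]
    simp only [φ]
    exact ⟨by linarith [hs.1], by linarith [hs.2]⟩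

variable {M : Type*} [TopologicalSpace M] [ChartedSpace Plane M] [IsManifold (𝓡 2) ∞ M]
  [RiemannianBundle (fun x : M ↦ TangentSpace (𝓡 2) x)]
  [IsContMDiffRiemannianBundle (𝓡 2) ∞ Plane (fun x : M ↦ TangentSpace (𝓡 2) x)]
  [MeasurableSpace M] [BorelSpace M] [SecondCountableTopology M] [T2Space M]
  {u : M → ℝ} {Ω : Set M}

/-- The energy is nonnegative, and the factor `∫ ψ` in its upper bound is positive and can be
divided out. -/
theorem setIntegral_laplaceBeltrami_add_nonneg (hΩ : IsOpen Ω) (hfin : area M Ω ≠ ⊤)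
    (hu : ContMDiffOn (𝓡 2) 𝓘(ℝ, ℝ) ∞ u Ω) {a b C : ℝ} (hab : a < b)
    (hc : IsCompact {x ∈ Ω | u x ≤ b}) (hC : ∀ x ∈ Ω, |laplaceBeltrami u x| ≤ C) :
    0 ≤ ∫ x in {x ∈ Ω | u x ≤ a}, laplaceBeltrami u x ∂area M +
        C * ((area M).real {x ∈ Ω | u x ≤ b} - (area M).real {x ∈ Ω | u x ≤ a}) := by
  obtain ⟨ψ, hψ, hψ0, -, hψs, hψp, -⟩ := exists_contDiff_cutoff (a := a) (b := b)
    (ε := (b - a) / 4) (by linarith) (by linarith)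
  obtain ⟨-, h⟩ := setIntegral_comp_mul_gradInner_le hΩ hfin hu hab hc hC hψ hψ0 hψs
  have hI : 0 < ∫ s in a..b, ψ s := intervalIntegral.intervalIntegral_pos_of_pos_on
    (hψ.continuous.intervalIntegrable _ _) hψp hab
  refine nonneg_of_mul_nonneg_right (le_trans ?_ h) hI
  exact setIntegral_nonneg hΩ.measurableSet fun x _ ↦
    mul_nonneg (hψ0 _) (gradInner_self_nonneg u x)

/-- The integral of the laplacian over a sublevel set, the flux of the gradient through its
boundary, is nonnegative. -/
theorem setIntegral_laplaceBeltrami_sublevel_nonneg (hΩ : IsOpen Ω) (hfin : area M Ω ≠ ⊤)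
    (hu : ContMDiffOn (𝓡 2) 𝓘(ℝ, ℝ) ∞ u Ω) {a b₀ C : ℝ} (hab : a < b₀)
    (hc : ∀ b < b₀, IsCompact {x ∈ Ω | u x ≤ b}) (hC : ∀ x ∈ Ω, |laplaceBeltrami u x| ≤ C) :
    0 ≤ ∫ x in {x ∈ Ω | u x ≤ a}, laplaceBeltrami u x ∂area M := by
  have hfinD : ∀ t, area M {x ∈ Ω | u x ≤ t} ≠ ⊤ := fun t ↦
    measure_ne_top_of_subset (fun x hx ↦ hx.1) hfin
  -- Closed sublevel sets make the area right-continuous in the level, so the strip term disappears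
  -- as `b` decreases to `a`, even if the level `a` itself has positive area.
  have hlim : Filter.Tendsto (fun t ↦ (area M).real {x ∈ Ω | u x ≤ t}) (𝓝[>] a)
      (𝓝 ((area M).real {x ∈ Ω | u x ≤ a})) := by
    have h := tendsto_measure_biInter_gt (μ := area M) (s := fun t ↦ {x ∈ Ω | u x ≤ t}) (a := a)
      (fun r _ ↦ (measurableSet_sublevel hΩ hu.continuousOn r).nullMeasurableSet)
      (fun i j _ hij x hx ↦ ⟨hx.1, hx.2.trans hij⟩) ⟨a + 1, by simp, hfinD _⟩
    have hI : ⋂ r > a, {x ∈ Ω | u x ≤ r} = {x ∈ Ω | u x ≤ a} := by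
      ext x
      simp only [Set.mem_iInter]
      refine ⟨fun hx ↦ ⟨(hx (a + 1) (by simp)).1, le_of_forall_gt_imp_ge_of_dense fun r hr ↦
        (hx r hr).2⟩, fun hx r hr ↦ ⟨hx.1, hx.2.trans (le_of_lt hr)⟩⟩
    rw [hI] at h
    exact (ENNReal.tendsto_toReal (hfinD a)).comp h
  have hlim2 := ((hlim.sub_const ((area M).real {x ∈ Ω | u x ≤ a})).const_mul C).const_add
    (∫ x in {x ∈ Ω | u x ≤ a}, laplaceBeltrami u x ∂area M)
  rw [sub_self, mul_zero, add_zero] at hlim2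
  refine ge_of_tendsto hlim2 ?_
  filter_upwards [Ioo_mem_nhdsGT hab] with b hb using
    setIntegral_laplaceBeltrami_add_nonneg hΩ hfin hu hb.1 (hc b hb.2) hC

end LengthArea

/-! ### The length-area estimate. -/

section Isoperimetric

variable {M : Type*} [EMetricSpace M] [ChartedSpace Plane M] [IsManifold (𝓡 2) ∞ M]
  [RiemannianBundle (fun x : M ↦ TangentSpace (𝓡 2) x)]
  [IsContMDiffRiemannianBundle (𝓡 2) ∞ Plane (fun x : M ↦ TangentSpace (𝓡 2) x)]
  [IsRiemannianManifold (𝓡 2) M] [MeasurableSpace M] [BorelSpace M] [SecondCountableTopology M]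
  {u : M → ℝ} {Ω : Set M}

/-- The coarea inequality between two levels, for a lower bound on the lengths of the boundaries of
the sublevel sets. -/
theorem mul_sqrt_le_lintegral_sqrt_gradInner {θ κ : ℝ} (hM : IsoperimetricInequality M θ κ)
    (hΩ : IsOpen Ω) (hu : ContMDiffOn (𝓡 2) 𝓘(ℝ, ℝ) ∞ u Ω) {a b q : ℝ}
    (hc : ∀ t ∈ Set.Ioo a b, IsCompact {x ∈ Ω | u x ≤ t})
    (hq : ∀ t ∈ Set.Ioo a b, q ≤ 4 * Real.pi * θ * (area M).real {x ∈ Ω | u x ≤ t} -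
      κ * (area M).real {x ∈ Ω | u x ≤ t} ^ 2) {B : Set M} (hB : MeasurableSet B)
    (hBdef : B = {x ∈ Ω | mfderiv (𝓡 2) 𝓘(ℝ, ℝ) u x ≠ 0} ∩ u ⁻¹' Set.Ioo a b) :
    ENNReal.ofReal √q * ENNReal.ofReal (b - a) ≤
      ∫⁻ x in B, ENNReal.ofReal √(gradInner u u x) ∂area M := by
  obtain ⟨h, -, hle, hint⟩ := exists_measurable_hausdorffMeasure_le hΩ hu hB
    (hBdef ▸ fun x hx ↦ hx.1.1) (hBdef ▸ fun x hx ↦ hx.1.2)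
  rw [← hint]
  have hae : ∀ᵐ t, t ∈ Set.Ioo a b → ENNReal.ofReal √q ≤ h t := by
    have hsard := volume_image_critical_eq_zero_of_contMDiffOn hΩ hu
    filter_upwards [measure_eq_zero_iff_ae_notMem.1 hsard] with t ht htab
    have hD := isCompactSmoothDomain_sublevel hΩ hu (hc t htab) ht
    have h1 := (hq t htab).trans (hM _ hD)
    have h2 := Real.sqrt_le_left (measureReal_nonneg) |>.2 h1
    -- If the length of the frontier is infinite, its `.real` value is `0`; passing back to `ℝ≥0∞`
    -- can only increase the right side, so the bound stays valid.
    refine (ENNReal.ofReal_le_ofReal h2).trans (ENNReal.ofReal_toReal_le.trans ?_)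
    refine (measure_mono fun x hx ↦ ?_).trans (hle t)
    obtain ⟨hxΩ, hxt⟩ := frontier_sublevel_subset hΩ hu.continuousOn (hc t htab).isClosed hx
    refine ⟨?_, hxt⟩
    rw [hBdef]
    refine ⟨⟨hxΩ, fun h0 ↦ ht ⟨x, ⟨hxΩ, h0⟩, hxt⟩⟩, ?_⟩
    rw [Set.mem_preimage, hxt]
    exact htab
  calc ENNReal.ofReal √q * ENNReal.ofReal (b - a)
      = ∫⁻ _ in Set.Ioo a b, ENNReal.ofReal √q := by rw [setLIntegral_const, Real.volume_Ioo]
    _ ≤ ∫⁻ t in Set.Ioo a b, h t := lintegral_mono_ae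
        ((ae_restrict_iff' measurableSet_Ioo).2 hae)
    _ ≤ ∫⁻ t, h t := setLIntegral_le_lintegral _ _

/-- The length-area estimate between two levels of `u`. -/
theorem sub_mul_le_of_isoperimetricInequality {θ κ : ℝ} (hM : IsoperimetricInequality M θ κ)
    (hΩ : IsOpen Ω) (hfin : area M Ω ≠ ⊤) (hu : ContMDiffOn (𝓡 2) 𝓘(ℝ, ℝ) ∞ u Ω) {a b q C : ℝ}
    (hab : a < b) (hc : ∀ t ≤ b, IsCompact {x ∈ Ω | u x ≤ t})
    (hC : ∀ x ∈ Ω, |laplaceBeltrami u x| ≤ C) (hq0 : 0 ≤ q)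
    (hq : ∀ t ∈ Set.Ioo a b, q ≤ 4 * Real.pi * θ * (area M).real {x ∈ Ω | u x ≤ t} -
      κ * (area M).real {x ∈ Ω | u x ≤ t} ^ 2) :
    (b - a) * q ≤ ((area M).real {x ∈ Ω | u x ≤ b} - (area M).real {x ∈ Ω | u x ≤ a}) *
      (∫ x in {x ∈ Ω | u x ≤ a}, laplaceBeltrami u x ∂area M +
        C * ((area M).real {x ∈ Ω | u x ≤ b} - (area M).real {x ∈ Ω | u x ≤ a})) := by
  have hEnn := setIntegral_laplaceBeltrami_add_nonneg hΩ hfin hu hab (hc b le_rfl) hC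
  set m := (area M).real {x ∈ Ω | u x ≤ b} - (area M).real {x ∈ Ω | u x ≤ a} with hm
  set E := ∫ x in {x ∈ Ω | u x ≤ a}, laplaceBeltrami u x ∂area M + C * m with hE
  -- Cauchy-Schwarz on the regular points with `u` in `(a + ε, b - ε)`: `√q (b - a - 2ε) ≤ ∫ |∇u|`,
  -- the area is at most `m`, and the energy is at most `(b - a) E`. One factor `b - a` is divided
  -- out after `ε → 0`.
  have hstep : ∀ ε ∈ Set.Ioo 0 ((b - a) / 2), (b - a - 2 * ε) ^ 2 * q ≤ (b - a) * E * m := by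
    intro ε hε
    obtain ⟨ψ, hψ, hψ0, hψ1, hψs, hψp, hψe⟩ := exists_contDiff_cutoff (a := a) (b := b)
      (ε := ε) hε.1 (by linarith [hε.2])
    obtain ⟨hint, hen⟩ := setIntegral_comp_mul_gradInner_le hΩ hfin hu hab (hc b le_rfl) hC hψ hψ0
      hψs
    have hI : ∫ s in a..b, ψ s ≤ b - a := by
      have := intervalIntegral.integral_mono_on (μ := volume) hab.le
        (hψ.continuous.intervalIntegrable a b)
        (intervalIntegrable_const (c := (1 : ℝ))) fun s _ ↦ hψ1 s
      simpa using this
    set B : Set M := {x ∈ Ω | mfderiv (𝓡 2) 𝓘(ℝ, ℝ) u x ≠ 0} ∩ u ⁻¹' Set.Ioo (a + ε) (b - ε)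
      with hBdef
    have hBΩ : B ⊆ Ω := fun x hx ↦ hx.1.1
    have hBo : IsOpen B := (hu.continuousOn.mono fun x hx ↦ hx.1).isOpen_inter_preimage
      (isOpen_regular hΩ hu) isOpen_Ioo
    have hBfin : area M B ≠ ⊤ := measure_ne_top_of_subset hBΩ hfin
    have hlen := mul_sqrt_le_lintegral_sqrt_gradInner hM hΩ hu (a := a + ε) (b := b - ε) (q := q)
      (fun t ht ↦ hc t (by linarith [ht.2, hε.1]))
      (fun t ht ↦ hq t ⟨by linarith [ht.1, hε.1], by linarith [ht.2, hε.1]⟩) hBo.measurableSet hBdef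
    have hgB : IntegrableOn (fun x ↦ gradInner u u x) B (area M) := by
      refine (hint.mono_set hBΩ).congr_fun (fun x hx ↦ ?_) hBo.measurableSet
      simp only
      rw [hψe _ hx.2, one_mul]
    have hEB : ∫ x in B, gradInner u u x ∂area M ≤ (b - a) * E := by
      calc ∫ x in B, gradInner u u x ∂area M = ∫ x in B, ψ (u x) * gradInner u u x ∂area M :=
            setIntegral_congr_fun hBo.measurableSet fun x hx ↦ by
              rw [hψe _ hx.2, one_mul]
        _ ≤ ∫ x in Ω, ψ (u x) * gradInner u u x ∂area M :=
            setIntegral_mono_set hint (Filter.Eventually.of_forall fun x ↦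
              mul_nonneg (hψ0 _) (gradInner_self_nonneg u x)) hBΩ.eventuallyLE
        _ ≤ (∫ s in a..b, ψ s) * E := hen
        _ ≤ (b - a) * E := mul_le_mul_of_nonneg_right hI hEnn
    have hBm : (area M).real B ≤ m := by
      have hDab : {x ∈ Ω | u x ≤ a} ⊆ {x ∈ Ω | u x ≤ b} := fun x hx ↦ ⟨hx.1, hx.2.trans hab.le⟩
      have hbΩ : {x ∈ Ω | u x ≤ b} ⊆ Ω := fun x hx ↦ hx.1
      rw [hm, ← measureReal_sdiff hDab (measurableSet_sublevel hΩ hu.continuousOn a)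
        (measure_ne_top_of_subset hbΩ hfin)]
      refine measureReal_mono (fun x hx ↦ ⟨⟨hx.1.1, ?_⟩, fun h ↦ ?_⟩)
        (measure_ne_top_of_subset (fun x hx ↦ hx.1.1) hfin)
      · linarith [hx.2.2, hε.1]
      · linarith [hx.2.1, h.2, hε.1]
    have hsqrt : ContinuousOn (fun x ↦ √(gradInner u u x)) Ω :=
      (continuousOn_gradInner hΩ hu hu).sqrt
    have hsB : IntegrableOn (fun x ↦ √(gradInner u u x)) B (area M) := by
      refine Integrable.mono' (hgB.add (integrableOn_const hBfin (C := (1 : ℝ))))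
        ((hsqrt.mono hBΩ).aestronglyMeasurable hBo.measurableSet)
        (Filter.Eventually.of_forall fun x ↦ ?_)
      have h1 := Real.sq_sqrt (gradInner_self_nonneg u x)
      rw [Real.norm_of_nonneg (Real.sqrt_nonneg _), Pi.add_apply]
      nlinarith [sq_nonneg (√(gradInner u u x) - 1)]
    set S := ∫ x in B, √(gradInner u u x) ∂area M with hS
    have hS1 : √q * (b - a - 2 * ε) ≤ S := by
      rw [← ofReal_integral_eq_lintegral_ofReal hsB
        (Filter.Eventually.of_forall fun x ↦ Real.sqrt_nonneg _), ← ENNReal.ofReal_mul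
        (Real.sqrt_nonneg _), ENNReal.ofReal_le_ofReal_iff
        (integral_nonneg fun x ↦ Real.sqrt_nonneg _)] at hlen
      refine le_trans (le_of_eq ?_) hlen
      ring
    -- Cauchy-Schwarz through the discriminant, from `2 c |∇u| ≤ |∇u|² + c²` integrated over `B`; no
    -- positivity of `m` is required.
    have hquad : ∀ c : ℝ, 0 ≤ m * (c * c) + (-2 * S) * c + (b - a) * E := by
      intro c
      have h1 : ∫ x in B, 2 * c * √(gradInner u u x) ∂area M ≤
          ∫ x in B, (gradInner u u x + c ^ 2) ∂area M := by
        refine integral_mono (hsB.const_mul _)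
          (hgB.add (integrableOn_const hBfin (C := c ^ 2))) fun x ↦ ?_
        have h2 := Real.sq_sqrt (gradInner_self_nonneg u x)
        simp only
        nlinarith [sq_nonneg (√(gradInner u u x) - c)]
      rw [integral_const_mul, integral_add hgB (integrableOn_const hBfin (C := c ^ 2)),
        setIntegral_const, smul_eq_mul] at h1
      have h3 : (area M).real B * c ^ 2 ≤ m * c ^ 2 :=
        mul_le_mul_of_nonneg_right hBm (sq_nonneg c)
      linarith
    have hdisc := discrim_le_zero hquad
    rw [discrim] at hdisc
    have hS2 : (√q * (b - a - 2 * ε)) ^ 2 ≤ S ^ 2 :=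
      pow_le_pow_left₀ (mul_nonneg (Real.sqrt_nonneg _) (by linarith [hε.2])) hS1 2
    rw [mul_pow, Real.sq_sqrt hq0] at hS2
    linarith
  have hlim : Filter.Tendsto (fun ε : ℝ ↦ (b - a - 2 * ε) ^ 2 * q) (𝓝[>] 0)
      (𝓝 ((b - a - 2 * 0) ^ 2 * q)) :=
    ((by fun_prop : Continuous fun ε : ℝ ↦ (b - a - 2 * ε) ^ 2 * q).tendsto 0).mono_left
      nhdsWithin_le_nhds
  have h := le_of_tendsto hlim (by
    filter_upwards [Ioo_mem_nhdsGT (show (0 : ℝ) < (b - a) / 2 by linarith)] using hstep)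
  refine le_of_mul_le_mul_left ?_ (sub_pos.2 hab)
  linarith

end Isoperimetric

/-! ### The Bol-type inequality. -/

section Bol

variable {M : Type*} [EMetricSpace M] [ChartedSpace Plane M] [IsManifold (𝓡 2) ∞ M]
  [RiemannianBundle (fun x : M ↦ TangentSpace (𝓡 2) x)]
  [IsContMDiffRiemannianBundle (𝓡 2) ∞ Plane (fun x : M ↦ TangentSpace (𝓡 2) x)]
  [IsRiemannianManifold (𝓡 2) M] [MeasurableSpace M] [BorelSpace M] [SecondCountableTopology M]
  {u : M → ℝ} {Ω : Set M}

theorem area_ne_top_of_isCompact_closure (hΩc : IsCompact (closure Ω)) : area M Ω ≠ ⊤ := by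
  have := isLocallyFiniteMeasure_area (M := M)
  exact measure_ne_top_of_subset subset_closure hΩc.measure_lt_top.ne

theorem integrableOn_exp (hΩ : IsOpen Ω) (hfin : area M Ω ≠ ⊤) (hu : ContinuousOn u Ω)
    (hneg : ∀ x ∈ Ω, u x < 0) : IntegrableOn (fun x ↦ Real.exp (2 * u x)) Ω (area M) := by
  refine integrableOn_of_continuousOn_of_bound (C := 1) hΩ hfin
    (Real.continuous_exp.comp_continuousOn (hu.const_mul 2)) fun x hx ↦ ?_
  rw [abs_of_pos (Real.exp_pos _), Real.exp_le_one_iff]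
  linarith [hneg x hx]

/-- The flux through the boundary of a sublevel set, from the equation satisfied by `u`. -/
theorem setIntegral_laplaceBeltrami_le (hΩ : IsOpen Ω) (hfin : area M Ω ≠ ⊤)
    (hu : ContMDiffOn (𝓡 2) 𝓘(ℝ, ℝ) ∞ u Ω) {C κ lam : ℝ} {f : M → ℝ}
    (hC : ∀ x ∈ Ω, |laplaceBeltrami u x| ≤ C) (hneg : ∀ x ∈ Ω, u x < 0)
    (heq : ∀ x ∈ Ω, -laplaceBeltrami u x + κ = lam * Real.exp (2 * u x) + f x)
    {D : Set M} (hD : MeasurableSet D) (hDΩ : D ⊆ Ω) :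
    ∫ x in D, laplaceBeltrami u x ∂area M ≤ κ * (area M).real D -
      lam * ∫ x in D, Real.exp (2 * u x) ∂area M + ∫ x in Ω, (f x)⁻ ∂area M := by
  have hL : IntegrableOn (laplaceBeltrami u) Ω (area M) :=
    integrableOn_of_continuousOn_of_bound hΩ hfin (continuousOn_laplaceBeltrami hΩ hu) hC
  have hexp := integrableOn_exp hΩ hfin hu.continuousOn hneg
  have hκ : IntegrableOn (fun _ : M ↦ κ) Ω (area M) := integrableOn_const hfin
  -- Integrability of `f` is not assumed: on `Ω` the equation expresses it through bounded
  -- continuous functions.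
  have hf : IntegrableOn f Ω (area M) := by
    refine ((hκ.sub hL).sub (hexp.const_mul lam)).congr_fun (fun x hx ↦ ?_) hΩ.measurableSet
    have := heq x hx
    simp only [Pi.sub_apply]
    linarith
  have hf' : IntegrableOn (fun x ↦ (f x)⁻) Ω (area M) := hf.neg_part
  have hr : IntegrableOn (fun x ↦ κ - lam * Real.exp (2 * u x) + (f x)⁻) D (area M) :=
    ((hκ.sub (hexp.const_mul lam)).add hf').mono_set hDΩ
  calc ∫ x in D, laplaceBeltrami u x ∂area M
      ≤ ∫ x in D, (κ - lam * Real.exp (2 * u x) + (f x)⁻) ∂area M := by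
        refine setIntegral_mono_on (hL.mono_set hDΩ) hr hD fun x hx ↦ ?_
        have h1 := heq x (hDΩ hx)
        have h2 := neg_le_negPart (f x)
        linarith
    _ = κ * (area M).real D - lam * ∫ x in D, Real.exp (2 * u x) ∂area M +
          ∫ x in D, (f x)⁻ ∂area M := by
        have h1 := hκ.mono_set hDΩ
        have h2 : IntegrableOn (fun x ↦ lam * Real.exp (2 * u x)) D (area M) :=
          (hexp.mono_set hDΩ).const_mul lam
        have h3 : IntegrableOn (fun x ↦ κ - lam * Real.exp (2 * u x)) D (area M) := h1.sub h2
        rw [integral_add h3 (hf'.mono_set hDΩ), integral_sub h1 h2, setIntegral_const,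
          integral_const_mul, smul_eq_mul, mul_comm]
    _ ≤ _ := by
        refine add_le_add_right ?_ _
        exact setIntegral_mono_set hf' (Filter.Eventually.of_forall fun x ↦ negPart_nonneg _)
          hDΩ.eventuallyLE

/-- The inequality at a single level of `u`. -/
theorem bol_sublevel {θ κ lam C B : ℝ} {f : M → ℝ} (hθ : 0 < θ)
    (hM : IsoperimetricInequality M θ κ) (hΩ : IsOpen Ω) (hΩc : IsCompact (closure Ω))
    (hu : ContMDiffOn (𝓡 2) 𝓘(ℝ, ℝ) ∞ u (closure Ω))
    (hC : ∀ x ∈ Ω, |laplaceBeltrami u x| ≤ C)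
    (heq : ∀ x ∈ Ω, -laplaceBeltrami u x + κ = lam * Real.exp (2 * u x) + f x)
    (hbd : ∀ x ∈ frontier Ω, u x = 0) (hneg : ∀ x ∈ Ω, u x < 0) (hB : B < 0) :
    Real.exp (2 * B) * (4 * Real.pi * θ * (area M).real {x ∈ Ω | u x ≤ B} -
        κ * (area M).real {x ∈ Ω | u x ≤ B} ^ 2) -
      (4 * Real.pi * θ + 2 * ∫ x in Ω, (f x)⁻ ∂area M) *
        (∫ x in {x ∈ Ω | u x ≤ B}, Real.exp (2 * u x) ∂area M) +
      lam * (∫ x in {x ∈ Ω | u x ≤ B}, Real.exp (2 * u x) ∂area M) ^ 2 ≤ 0 := by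
  have hfin := area_ne_top_of_isCompact_closure (M := M) hΩc
  have huΩ := hu.mono subset_closure
  have hexp := integrableOn_exp hΩ hfin huΩ.continuousOn hneg
  have hcpt : ∀ t < 0, IsCompact {x ∈ Ω | u x ≤ t} := fun t ht ↦
    isCompact_sublevel hΩ hΩc hu.continuousOn hbd ht
  have hmeas := fun t ↦ measurableSet_sublevel hΩ huΩ.continuousOn t
  have hsub : ∀ t, {x ∈ Ω | u x ≤ t} ⊆ Ω := fun t x hx ↦ hx.1
  have hfinD : ∀ t, area M {x ∈ Ω | u x ≤ t} ≠ ⊤ := fun t ↦ measure_ne_top_of_subset (hsub t) hfin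
  have hmonoD : ∀ a b, a < b → {x ∈ Ω | u x ≤ a} ⊆ {x ∈ Ω | u x ≤ b} := fun a b hab x hx ↦
    ⟨hx.1, hx.2.trans hab.le⟩
  obtain ⟨A₀, hA₀⟩ := (hΩc.image_of_continuousOn hu.continuousOn).bddBelow
  -- A level below the infimum of `u`, where both distribution functions vanish, and also below `B`.
  set A := min (A₀ - 1) (B - 1) with hA
  have hAe : {x ∈ Ω | u x ≤ A} = ∅ := by
    refine Set.eq_empty_of_forall_notMem fun x hx ↦ ?_
    have h1 := hA₀ ⟨x, subset_closure hx.1, rfl⟩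
    have h2 := hx.2.trans (min_le_left (A₀ - 1) (B - 1))
    linarith
  set β : ℝ → ℝ := fun t ↦ (area M).real {x ∈ Ω | u x ≤ t} with hβ
  set α : ℝ → ℝ := fun t ↦ ∫ x in {x ∈ Ω | u x ≤ t}, Real.exp (2 * u x) ∂area M with hα
  set p := ∫ x in Ω, (f x)⁻ ∂area M with hp
  have hβA : β A = 0 := by simp only [hβ, hAe, measureReal_empty]
  have hαA : α A = 0 := by simp only [hα, hAe, setIntegral_empty]
  have hβm : ∀ t, 0 ≤ β t ∧ β t ≤ (area M).real Ω := fun t ↦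
    ⟨measureReal_nonneg, measureReal_mono (hsub t) hfin⟩
  have hmono : ∀ a b, a < b → β a ≤ β b := fun a b hab ↦
    measureReal_mono (hmonoD a b hab) (hfinD b)
  have hβd : ∀ a b, a < b → (area M).real ({x ∈ Ω | u x ≤ b} \ {x ∈ Ω | u x ≤ a}) = β b - β a :=
    fun a b hab ↦ measureReal_sdiff (hmonoD a b hab) (hmeas a) (hfinD b)
  have hαd : ∀ a b, a < b → ∫ x in {x ∈ Ω | u x ≤ b} \ {x ∈ Ω | u x ≤ a},
      Real.exp (2 * u x) ∂area M = α b - α a := fun a b hab ↦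
    setIntegral_sdiff (hmeas a) (hexp.mono_set (hsub b)) (hmonoD a b hab)
  have hdm : ∀ a b, MeasurableSet ({x ∈ Ω | u x ≤ b} \ {x ∈ Ω | u x ≤ a}) := fun a b ↦
    (hmeas b).diff (hmeas a)
  have hdsub : ∀ a b, {x ∈ Ω | u x ≤ b} \ {x ∈ Ω | u x ≤ a} ⊆ Ω := fun a b x hx ↦ hx.1.1
  have hdfin : ∀ a b, area M ({x ∈ Ω | u x ≤ b} \ {x ∈ Ω | u x ≤ a}) ≠ ⊤ := fun a b ↦
    measure_ne_top_of_subset (hdsub a b) hfin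
  have hαl : ∀ a b, a < b → Real.exp (2 * a) * (β b - β a) ≤ α b - α a := by
    intro a b hab
    rw [← hβd a b hab, ← hαd a b hab, mul_comm, ← smul_eq_mul, ← setIntegral_const]
    refine setIntegral_mono_on (integrableOn_const (hdfin a b)) (hexp.mono_set (hdsub a b))
      (hdm a b) fun x hx ↦ Real.exp_le_exp.2 ?_
    have : a < u x := not_le.1 fun h ↦ hx.2 ⟨hx.1.1, h⟩
    linarith
  have hαr : ∀ a b, a < b → α b - α a ≤ Real.exp (2 * b) * (β b - β a) := by
    intro a b hab
    rw [← hβd a b hab, ← hαd a b hab, mul_comm, ← smul_eq_mul, ← setIntegral_const]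
    refine setIntegral_mono_on (hexp.mono_set (hdsub a b)) (integrableOn_const (hdfin a b))
      (hdm a b) fun x hx ↦ Real.exp_le_exp.2 ?_
    linarith [hx.1.2]
  have hαm : ∀ t, 0 ≤ α t ∧ α t ≤ (area M).real Ω := by
    intro t
    refine ⟨integral_nonneg fun x ↦ (Real.exp_pos _).le, ?_⟩
    have h1 : α t ≤ ∫ x in {x ∈ Ω | u x ≤ t}, (1 : ℝ) ∂area M := by
      refine setIntegral_mono_on (hexp.mono_set (hsub t)) (integrableOn_const (hfinD t))
        (hmeas t) fun x hx ↦ Real.exp_le_one_iff.2 ?_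
      linarith [hneg x hx.1]
    rw [setIntegral_const, smul_eq_mul, mul_one] at h1
    exact h1.trans (hβm t).2
  have hflux : ∀ t, ∫ x in {x ∈ Ω | u x ≤ t}, laplaceBeltrami u x ∂area M ≤
      κ * β t - lam * α t + p := fun t ↦
    setIntegral_laplaceBeltrami_le hΩ hfin huΩ hC hneg heq (hmeas t) (hsub t)
  set K := 4 * Real.pi * θ + 2 * |κ| * (area M).real Ω with hK
  have hK0 : 0 ≤ K := by positivity
  have hlip : ∀ s t, s < t → 4 * Real.pi * θ * β t - κ * β t ^ 2 - K * (β t - β s) ≤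
      4 * Real.pi * θ * β s - κ * β s ^ 2 := by
    intro s t hst
    have h1 : -κ * (β s + β t) ≤ |κ| * (2 * (area M).real Ω) :=
      mul_le_mul (neg_le_abs κ) (by linarith [(hβm s).2, (hβm t).2])
        (add_nonneg (hβm s).1 (hβm t).1) (abs_nonneg _)
    have h2 := mul_le_mul_of_nonneg_right h1 (sub_nonneg.2 (hmono s t hst))
    rw [hK]
    linarith
  have hC0 : 0 ≤ max C 0 := le_max_right _ _
  -- The single error constant `max C 0 + K` covers both sides of the key estimate: `C` bounds the
  -- flux through the strip, and `K` is a Lipschitz constant of `β ↦ 4πθβ - κβ²` on the range of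
  -- `β`.
  have hfinal := bol_of_increments (β := β) (α := α) (c := 4 * Real.pi * θ) (κ := κ) (lam := lam)
    (p := p) (m := (area M).real Ω) (C := max C 0 + K) (A := A) (B := B) (by positivity)
    (by positivity) (by linarith [min_le_right (A₀ - 1) (B - 1)]) hB (fun t _ ↦ hβm t)
    (fun t _ ↦ hαm t) (fun a b hab _ ↦ hmono a b hab) (fun a b hab _ ↦ hαl a b hab)
    (fun a b hab _ ↦ hαr a b hab) ?_ ?_
  · rw [hβA, hαA] at hfinal
    simpa using hfinal
  · exact fun t ht ↦ (setIntegral_laplaceBeltrami_sublevel_nonneg hΩ hfin huΩ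
      (lt_of_le_of_lt ht hB) hcpt hC).trans (hflux t)
  · intro a b hab hb
    have hx : 0 ≤ β b - β a := sub_nonneg.2 (hmono a b hab)
    have hPa : 0 ≤ κ * β a - lam * α a + p := (setIntegral_laplaceBeltrami_sublevel_nonneg hΩ hfin
      huΩ (by linarith) hcpt hC).trans (hflux a)
    -- The length-area estimate needs one `q ≥ 0` below the isoperimetric expression at every level
    -- in `(a, b)`. The value at `b` minus the oscillation serves; when this is negative the claim
    -- is trivial by signs.
    rcases le_total (4 * Real.pi * θ * β b - κ * β b ^ 2 - (max C 0 + K) * (β b - β a)) 0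
      with hq | hq
    · exact (mul_nonpos_of_nonneg_of_nonpos (by linarith) hq).trans (by positivity)
    · refine (sub_mul_le_of_isoperimetricInequality hM hΩ hfin huΩ hab
        (fun t ht ↦ hcpt t (by linarith)) hC hq fun t ht ↦ ?_).trans ?_
      · refine le_trans ?_ (hlip t b ht.2)
        have h1 : K * (β b - β t) ≤ K * (β b - β a) :=
          mul_le_mul_of_nonneg_left (by linarith [hmono a t ht.1]) hK0
        have h2 : 0 ≤ max C 0 * (β b - β a) := mul_nonneg hC0 hx
        linarith
      · refine mul_le_mul_of_nonneg_left (add_le_add (hflux a) ?_) hx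
        exact mul_le_mul_of_nonneg_right (by linarith [le_max_left C 0]) hx

/-- A Bol-type inequality. -/
theorem bol_inequality {θ κ lam : ℝ} {f : M → ℝ} (hθ : 0 < θ)
    (hM : IsoperimetricInequality M θ κ) (hΩ : IsOpen Ω) (hΩc : IsCompact (closure Ω))
    (hu : ContMDiffOn (𝓡 2) 𝓘(ℝ, ℝ) ∞ u (closure Ω))
    (heq : ∀ x ∈ Ω, -laplaceBeltrami u x + κ = lam * Real.exp (2 * u x) + f x)
    (hbd : ∀ x ∈ frontier Ω, u x = 0) (hneg : ∀ x ∈ Ω, u x < 0) :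
    4 * Real.pi * θ * (area M).real Ω - κ * (area M).real Ω ^ 2 ≤
      (4 * Real.pi * θ + 2 * ∫ x in Ω, (f x)⁻ ∂area M) *
        (∫ x in Ω, Real.exp (2 * u x) ∂area M) -
      lam * (∫ x in Ω, Real.exp (2 * u x) ∂area M) ^ 2 := by
  have hfin := area_ne_top_of_isCompact_closure (M := M) hΩc
  have huΩ := hu.mono subset_closure
  obtain ⟨C, hC⟩ := exists_bound_laplaceBeltrami hΩ hΩc hu
  -- Strictly negative levels increasing to `0`, so that each sublevel set is compact while their
  -- union is all of `Ω`.
  set τ : ℕ → ℝ := fun n ↦ -(1 / ((n : ℝ) + 1)) with hτ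
  have hτ0 : ∀ n, τ n < 0 := fun n ↦ neg_neg_of_pos (by positivity)
  have hτlim : Filter.Tendsto τ Filter.atTop (𝓝 0) := by
    simpa only [neg_zero] using (tendsto_one_div_add_atTop_nhds_zero_nat (𝕜 := ℝ)).neg
  have hτmono : Monotone τ := fun i j hij ↦ neg_le_neg (by gcongr)
  have hDmono : Monotone fun n ↦ {x ∈ Ω | u x ≤ τ n} := fun i j hij x hx ↦
    ⟨hx.1, hx.2.trans (hτmono hij)⟩
  have hU : ⋃ n, {x ∈ Ω | u x ≤ τ n} = Ω := by
    ext x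
    refine ⟨fun hx ↦ (Set.mem_iUnion.1 hx).choose_spec.1, fun hx ↦ Set.mem_iUnion.2 ?_⟩
    obtain ⟨n, hn⟩ := (hτlim.eventually_const_lt (hneg x hx)).exists
    exact ⟨n, hx, hn.le⟩
  have hβ : Filter.Tendsto (fun n ↦ (area M).real {x ∈ Ω | u x ≤ τ n}) Filter.atTop
      (𝓝 ((area M).real Ω)) := by
    have h := tendsto_measure_iUnion_atTop (μ := area M) hDmono
    rw [hU] at h
    exact (ENNReal.tendsto_toReal hfin).comp h
  have hα : Filter.Tendsto (fun n ↦ ∫ x in {x ∈ Ω | u x ≤ τ n}, Real.exp (2 * u x) ∂area M)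
      Filter.atTop (𝓝 (∫ x in Ω, Real.exp (2 * u x) ∂area M)) := by
    have h := tendsto_setIntegral_of_monotone (μ := area M) (f := fun x ↦ Real.exp (2 * u x))
      (fun n ↦ measurableSet_sublevel hΩ huΩ.continuousOn (τ n)) hDmono
      (by rw [hU]; exact integrableOn_exp hΩ hfin huΩ.continuousOn hneg)
    rwa [hU] at h
  have hexp : Filter.Tendsto (fun n ↦ Real.exp (2 * τ n)) Filter.atTop (𝓝 1) := by
    have := (Real.continuous_exp.tendsto _).comp (hτlim.const_mul 2)
    rwa [mul_zero, Real.exp_zero] at this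
  have h := le_of_tendsto' (((hexp.mul ((hβ.const_mul (4 * Real.pi * θ)).sub
    ((hβ.pow 2).const_mul κ))).sub (hα.const_mul (4 * Real.pi * θ + 2 *
      ∫ x in Ω, (f x)⁻ ∂area M))).add ((hα.pow 2).const_mul lam))
    fun n ↦ bol_sublevel hθ hM hΩ hΩc hu hC heq hbd hneg (hτ0 n)
  linarith

/-- Strictness is what allows division by `μ(Ω) - ∫ e²ᵘ` in the final statement. -/
theorem setIntegral_exp_lt_area (hΩ : IsOpen Ω) (hne : Ω.Nonempty) (hfin : area M Ω ≠ ⊤)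
    (hu : ContinuousOn u Ω) (hneg : ∀ x ∈ Ω, u x < 0) :
    ∫ x in Ω, Real.exp (2 * u x) ∂area M < (area M).real Ω := by
  have hexp := integrableOn_exp hΩ hfin hu hneg
  have hone : IntegrableOn (fun _ : M ↦ (1 : ℝ)) Ω (area M) := integrableOn_const hfin
  have hpos : ∀ x ∈ Ω, 0 < 1 - Real.exp (2 * u x) := fun x hx ↦
    sub_pos.2 (Real.exp_lt_one_iff.2 (by linarith [hneg x hx]))
  have h : 0 < ∫ x in Ω, (1 - Real.exp (2 * u x)) ∂area M := by
    rw [setIntegral_pos_iff_support_of_nonneg_ae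
      ((ae_restrict_iff' hΩ.measurableSet).2 (Filter.Eventually.of_forall fun x hx ↦
        (hpos x hx).le)) (hone.sub hexp)]
    exact (area_pos_of_isOpen hΩ hne).trans_le
      (measure_mono fun x hx ↦ ⟨(hpos x hx).ne', hx⟩)
  rw [integral_sub hone hexp, setIntegral_const, smul_eq_mul, mul_one] at h
  linarith

end Bol

end RiemannianSurface

theorem theorem3p2
    {M : Type*} [EMetricSpace M] [SecondCountableTopology M]
    [MeasurableSpace M] [BorelSpace M]
    [ChartedSpace RiemannianSurface.Plane M] [IsManifold (𝓡 2) ∞ M]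
    [RiemannianBundle (fun x : M ↦ TangentSpace (𝓡 2) x)]
    [IsContMDiffRiemannianBundle (𝓡 2) ∞ RiemannianSurface.Plane
      (fun x : M ↦ TangentSpace (𝓡 2) x)]
    [IsRiemannianManifold (𝓡 2) M]
    (θ κ : ℝ) (hθ : 0 < θ) (hθ' : θ ≤ 1)
    (hM : RiemannianSurface.IsoperimetricInequality M θ κ)
    (Ω : Set M) (hΩ : IsOpen Ω) (hΩne : Ω.Nonempty) (hΩc : IsCompact (closure Ω))
    (u f : M → ℝ) (lam Θ : ℝ)
    (hu : ContMDiffOn (𝓡 2) 𝓘(ℝ, ℝ) ∞ u (closure Ω))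
    (heq : ∀ x ∈ Ω, -RiemannianSurface.laplaceBeltrami u x + κ
      = lam * Real.exp (2 * u x) + f x)
    (hbd : ∀ x ∈ frontier Ω, u x = 0)
    (hneg : ∀ x ∈ Ω, u x < 0)
    (hΘ : Θ = 1 / (2 * Real.pi) * ∫ x in Ω, (f x)⁻ ∂(RiemannianSurface.area M)) :
    4 * Real.pi * θ * (RiemannianSurface.area M).real Ω
        - κ * (RiemannianSurface.area M).real Ω ^ 2
      ≤ 4 * Real.pi * (θ + Θ) * (∫ x in Ω, Real.exp (2 * u x) ∂(RiemannianSurface.area M))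
        - lam * (∫ x in Ω, Real.exp (2 * u x) ∂(RiemannianSurface.area M)) ^ 2
    ∧ (Θ = 0 → lam = κ → 0 < lam →
      4 * Real.pi * θ / lam
        ≤ (∫ x in Ω, Real.exp (2 * u x) ∂(RiemannianSurface.area M))
          + (RiemannianSurface.area M).real Ω) := by
  have hfin := RiemannianSurface.area_ne_top_of_isCompact_closure (M := M) hΩc
  have hbol := RiemannianSurface.bol_inequality hθ hM hΩ hΩc hu heq hbd hneg
  have hlt := RiemannianSurface.setIntegral_exp_lt_area hΩ hΩne hfin
    (hu.continuousOn.mono subset_closure) hneg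
  have hp : ∫ x in Ω, (f x)⁻ ∂(RiemannianSurface.area M) = 2 * Real.pi * Θ := by
    rw [hΘ]
    have := Real.pi_pos.ne'
    field_simp
  rw [hp] at hbol
  refine ⟨hbol.trans_eq (by ring), fun h0 hκ hpos ↦ ?_⟩
  rw [div_le_iff₀ hpos]
  rw [h0, ← hκ] at hbol
  -- With `Θ = 0` and `λ = κ` the inequality reads `4πθ (m - A) ≤ λ (m² - A²)`, where `m = μ(Ω)` and
  -- `A = ∫ e²ᵘ`; the factor `m - A` is positive.
  refine le_of_mul_le_mul_right ?_ (sub_pos.2 hlt)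
  linarith
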